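/- **Setting.** Let $\mathbb T=\mathbb R/\mathbb Z$. For $\omega\in\{0,1,2,3\}$ let $f_\omega:\mathbb T\to\mathbb T$, $f_\omega(x)=\frac x2+\frac\omega4$ for $x\in[0,\frac12]$ and $f_\omega(x)=\frac{1-x}2+\frac\omega4$ for $x\in[\frac12,1]$, and $h_\omega(x,y)=\sin2\pi y-\sin2\pi x-\frac{\omega}{3.6}$. Fix $\beta>2$ and $c_{\rm hub},\lambda\in(0,1)$, and let $m,w,\delta,\alpha>0$ be functions of $N\in\mathbb N$ with, as $N\to\infty$, $$m\asymp N^{\frac1{\beta-1}},\quad w=o\big(N^{\frac{\lambda}{\beta-1}}\big),\quad \Delta:=c_{\rm hub}m,\quad \delta\asymp\Delta^{\lambda},\quad \alpha=o\Big(\min\big\{N^{\lambda\frac{\beta-2}{\beta-1}},N^{\frac{1-\lambda}{2\beta-2}}\big\}\Big).$$ Let $G$ be the Chung–Lu random (simple) graph on $\{1,\dots,N\}$ in which the pairs $i\neq j$ are linked independently with probability $\min\{1,w_iw_j/\sum_kw_k\}$, where $$w_i=\tfrac{\beta-2}{\beta-1}\,w\,N^{\frac1{\beta-1}}\Big[N\Big(\tfrac{w(\beta-2)}{m(\beta-1)}\Big)^{\beta-1}+i-1\Big]^{-\frac1{\beta-1}}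 .$$ Write $\mathcal N_i$ for the set of neighbours of $i$, $k_i=\#\mathcal N_i$, $\Delta_0=\max_ik_i$, $\mathcal H=\{i:k_i>\Delta\}$ (hubs), $M=\#\mathcal H$, $\mathcal L=\{j:k_j<\delta\}$ (low degree nodes), $\nu_i=\#(\mathcal N_i\cap\mathcal L)/k_i$, $\nu=\min_{i\in\mathcal H}\nu_i$ (with $\nu=1$ if $\mathcal H=\emptyset$), and $\alpha_i=\alpha\nu_ik_i/\Delta_0$. Given $G$, let $\mathrm{Prob}$ be the law of $(\boldsymbol\omega,x)$, where $\boldsymbol\omega=(\boldsymbol\omega_i^t)_{t\ge0,\,1\le i\le N}$ is iid uniform on $\{0,1,2,3\}$ and $x$ is independent of $\boldsymbol\omega$ and uniform on $\mathbb T^N$. Let $x^0=x$ and $$x_i^{t+1}=f_{\boldsymbol\omega_i^t}(x_i^t)+\frac{\alpha}{\Delta_0}\sum_{j\in\mathcal N_i}h_{\boldsymbol\omega_i^t}(x_i^t,x_j^t)\mod1 .$$ For $i\in\mathcal H$ define the fluctuation $$\xi_i^t(\boldsymbol\omega,x)=\frac{\alpha_i}{\nu_ik_i}\sum_{j\in\mathcal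 N_i\cap\mathcal L}\sin2\pi x_j^t+\frac{\alpha}{\Delta_0}\sum_{j\in\mathcal N_i\setminus\mathcal L}\Big[\sin2\pi x_j^t-\sin2\pi x_i^t-\frac{\boldsymbol\omega_i^t}{3.6}\Big].$$ **Theorem C.** There are a constant $C>0$ and an $N_0$ (depending on $\beta,c_{\rm hub},\lambda$ and the functions $m,w,\delta,\alpha$), and for each $N$ a set of good graphs, such that for $N\ge N_0$ the graph $G$ is good with probability at least $1-CN^{-1/5}$, and the following holds for every good $G$ with $N\ge N_0$ nodes (in (ii): with $N\ge N_1(\kappa)$ nodes). Every hub $i$ follows the mean-field reduced map at coupling $\alpha_i$ up to the fluctuation: for all $(\boldsymbol\omega,x)$ and all $t\ge0$, $$x_i^{t+1}=f_{\alpha_i,\boldsymbol\omega_i^t}(x_i^t)+\xi_i^t(\boldsymbol\omega,x)\mod 1,\qquad f_{a,\omega}(z)=f_\omega(z)+a\int_{\mathbb T}h_\omega(z,y)\,dy\mod1,$$ and $1-\nu\le C\big(N^{-\lambda\frac{\beta-2}{\beta-1}}w^{\beta-2}+N^{-\frac1{\beta-1}}\log N\big)$. Moreover: (i) For every $\varepsilon\ge\max\big\{\tfrac{17}2\alpha(1-\nu),\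 34\pi\alpha^2\delta/\Delta,\ C\alpha\sqrt{\log(M+1)/\Delta}\big\}$, $$\mathrm{Prob}\Big\{\liminf_{T\to\infty}\frac1T\sum_{t=0}^{T-1}\mathbf 1_{\max_{i\in\mathcal H}|\xi_i^t|\le\varepsilon}\ \ge\ 1-\exp\Big(-\frac{\nu\Delta\varepsilon^2}{19\alpha^2}\Big)\Big\}=1 .$$ (ii) Let $0<\kappa<\min\{\frac12,\,1-\lambda,\,\lambda\frac{\beta-2}{\beta-1}\}$ be such that, as $N\to\infty$, $N^{-\lambda\frac{\beta-2}{\beta-1}}w^{\beta-2}=o(\Delta^{-\kappa})$ and $\alpha w/\Delta=o(\Delta^{-\kappa})$ (both are automatic if $w$ is bounded). Then there is $N_1(\kappa)$ such that for all good $G$ with $N\ge N_1(\kappa)$ nodes, all $t_0\in\mathbb N$ and all $T\in\mathbb N$ with $T\le\lceil\exp(\Delta^{1-2\kappa})\rceil$, $$\mathrm{Prob}\Big\{\max_{i\in\mathcal H}\ \max_{t_0\le t<t_0+T}|\xi_i^t|\le3\alpha\Delta^{-\kappa}\Big\}\ \ge\ 1-\exp(-\Delta^{1-2\kappa}).$$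 (iii) For every hub $i$, every $t\in\mathbb N$ and every $s\in\mathbb R$, $$\mathrm{Prob}\{\xi_i^t\le s\}\in\big[F_i(s-s_1)-s_2,\ F_i(s+s_1)+s_2\big],$$ where $F_i$ is the distribution function of the normal law with mean $0$ and variance $\alpha_i^2/(2\nu_ik_i)$, and $$s_1=C\alpha\Big((1+\alpha)N^{-\frac{1-\lambda}{\beta-1}}+N^{-\lambda\frac{\beta-2}{\beta-1}}w^{\beta-2}\Big),\qquad s_2=CN^{-\frac1{2\beta-2}} .$$ -/

import Mathlib

open MeasureTheory ProbabilityTheory Filter Asymptotics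

noncomputable section

namespace HubDynamics

/-! ### Node dynamics and coupling on the circle `𝕋 = ℝ / ℤ` -/

/-- The contraction `f_ω` of the circle, `ω ∈ {0,1,2,3}`: on the fundamental domain `[0,1)` it is
`y/2 + ω/4` for `y ≤ 1/2` and `(1-y)/2 + ω/4` for `y ≥ 1/2`, taken mod 1. -/
def nodeMap (ω : Fin 4) : UnitAddCircle → UnitAddCircle :=
  AddCircle.liftIco 1 0 fun y : ℝ =>
    (((if y ≤ 1 / 2 then y / 2 + (ω.val : ℝ) / 4 else (1 - y) / 2 + (ω.val : ℝ) / 4 : ℝ)) :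
      UnitAddCircle)

/-- `x ↦ sin 2πx` on the circle. -/
def sinC : UnitAddCircle → ℝ :=
  AddCircle.liftIco 1 0 fun y : ℝ => Real.sin (2 * Real.pi * y)

/-- The coupling function `h_ω(x,y) = sin 2πy - sin 2πx - ω/3.6`. -/
def coupling (ω : Fin 4) (x y : UnitAddCircle) : ℝ :=
  sinC y - sinC x - (ω.val : ℝ) / 3.6

/-- The mean-field reduced map `f_{a,ω}(z) = f_ω(z) + a ∫ h_ω(z,x) dx mod 1`. -/
def reducedMap (a : ℝ) (ω : Fin 4) (z : UnitAddCircle) : UnitAddCircle :=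
  nodeMap ω z + ((a * ∫ x : UnitAddCircle, coupling ω z x : ℝ) : UnitAddCircle)

/-! ### Graph quantities -/

section Graph

variable {N : ℕ}

/-- The neighbours of node `i`. -/
def nbrs (G : SimpleGraph (Fin N)) (i : Fin N) : Finset (Fin N) :=
  open scoped Classical in Finset.univ.filter fun j => G.Adj i j

/-- The degree `k_i`. -/
def deg (G : SimpleGraph (Fin N)) (i : Fin N) : ℕ := (nbrs G i).card

/-- The largest degree `Δ₀`. -/
def topDeg (G : SimpleGraph (Fin N)) : ℕ := Finset.univ.sup fun i => deg G i

/-- The hubs: nodes of degree above `Δ`. -/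
def hubs (G : SimpleGraph (Fin N)) (Δ : ℝ) : Finset (Fin N) :=
  open scoped Classical in Finset.univ.filter fun i => Δ < (deg G i : ℝ)

/-- The low degree neighbours of `i`: those of degree below `δ`. -/
def lowNbrs (G : SimpleGraph (Fin N)) (δ : ℝ) (i : Fin N) : Finset (Fin N) :=
  open scoped Classical in (nbrs G i).filter fun j => (deg G j : ℝ) < δ

/-- The neighbours of `i` that are not of low degree. -/
def highNbrs (G : SimpleGraph (Fin N)) (δ : ℝ) (i : Fin N) : Finset (Fin N) :=
  open scoped Classical in (nbrs G i).filter fun j => δ ≤ (deg G j : ℝ)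

/-- The star-like index `ν_i` at node `i`: the proportion of low degree nodes among its
neighbours. -/
def nodeIndex (G : SimpleGraph (Fin N)) (δ : ℝ) (i : Fin N) : ℝ :=
  ((lowNbrs G δ i).card : ℝ) / (deg G i : ℝ)

/-- The star-like index `ν` of the network: the minimum of `ν_i` over all hubs
(`1` if there is no hub). -/
def starIndex (G : SimpleGraph (Fin N)) (Δ δ : ℝ) : ℝ :=
  open scoped Classical in
  if h : (hubs G Δ).Nonempty then (hubs G Δ).inf' h (nodeIndex G δ) else 1

/-- The effective coupling strength `α_i = α ν_i k_i / Δ₀`. -/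
def effCoupling (G : SimpleGraph (Fin N)) (δ α : ℝ) (i : Fin N) : ℝ :=
  α * nodeIndex G δ i * (deg G i : ℝ) / (topDeg G : ℝ)

end Graph

/-! ### The network random dynamical system -/

section Dynamics

variable {N : ℕ}

/-- Noise realizations `ω = (ω_i^t)`, indexed by time `t` and node `i`. -/
abbrev Noise (N : ℕ) : Type := ℕ × Fin N → Fin 4

/-- The network trajectory `x^t` started from `x` under the noise `ω`:
`x_i^{t+1} = f_{ω_i^t}(x_i^t) + (α/Δ₀) ∑_j A_{ij} h_{ω_i^t}(x_i^t, x_j^t) mod 1`. -/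
def traj (G : SimpleGraph (Fin N)) (α : ℝ) (ω : Noise N) (x : Fin N → UnitAddCircle) :
    ℕ → Fin N → UnitAddCircle
  | 0 => x
  | t + 1 => fun i =>
      nodeMap (ω (t, i)) (traj G α ω x t i) +
        ((α / (topDeg G : ℝ) *
          ∑ j ∈ nbrs G i, coupling (ω (t, i)) (traj G α ω x t i) (traj G α ω x t j) : ℝ) :
            UnitAddCircle)

/-- The mean-field fluctuation `ξ_i^t(ω,x)`. -/
def fluct (G : SimpleGraph (Fin N)) (δ α : ℝ) (ω : Noise N) (x : Fin N → UnitAddCircle)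
    (i : Fin N) (t : ℕ) : ℝ :=
  effCoupling G δ α i / (nodeIndex G δ i * (deg G i : ℝ)) *
      ∑ j ∈ lowNbrs G δ i, sinC (traj G α ω x t j) +
    α / (topDeg G : ℝ) *
      ∑ j ∈ highNbrs G δ i,
        (sinC (traj G α ω x t j) - sinC (traj G α ω x t i) - ((ω (t, i)).val : ℝ) / 3.6)

/-- `Prob`: the noise is iid uniform on `{0,1,2,3}` over all times and nodes, and independently
the initial condition is uniform on `𝕋^N`. -/
def dynProb (N : ℕ) : Measure (Noise N × (Fin N → UnitAddCircle)) :=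
  (Measure.infinitePi fun _ : ℕ × Fin N => (PMF.uniformOfFintype (Fin 4)).toMeasure).prod
    (Measure.pi fun _ : Fin N => (volume : Measure UnitAddCircle))

end Dynamics

/-! ### The Chung–Lu power-law random graph -/

section ChungLu

/-- The expected degree sequence with `N` nodes, exponent `β`, mean expected degree `w` and maximum
expected degree `m`; the node with index `i : Fin N` is node number `i + 1`. -/
def expDeg (β w m : ℝ) (N : ℕ) (i : Fin N) : ℝ :=
  (β - 2) / (β - 1) * w * (N : ℝ) ^ (1 / (β - 1)) *
    ((N : ℝ) * (w * (β - 2) / (m * (β - 1))) ^ (β - 1) + (i.val : ℝ)) ^ (-(1 / (β - 1)))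

/-- The unordered pairs of distinct nodes. -/
abbrev NodePair (N : ℕ) : Type := {e : Fin N × Fin N // e.1 < e.2}

/-- Independent edge indicators; nodes `i ≠ j` are linked with probability
`p_{ij} = w_i w_j / ∑_k w_k` (read as `1` should this number exceed `1`). -/
def chungLu (β w m : ℝ) (N : ℕ) : Measure (NodePair N → Bool) :=
  Measure.pi fun e : NodePair N =>
    bernoulliMeasure true false
      (Set.projIcc (0 : ℝ) 1 zero_le_one
        (expDeg β w m N e.1.1 * expDeg β w m N e.1.2 / ∑ k : Fin N, expDeg β w m N k))

/-- The graph with the given edge indicators. -/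
def graphOf {N : ℕ} (c : NodePair N → Bool) : SimpleGraph (Fin N) where
  Adj i j := (∃ h : i < j, c ⟨(i, j), h⟩ = true) ∨ (∃ h : j < i, c ⟨(j, i), h⟩ = true)
  symm := ⟨fun _ _ h => h.symm⟩
  loopless := ⟨fun i h => by rcases h with ⟨h, -⟩ | ⟨h, -⟩ <;> exact lt_irrefl i h⟩

end ChungLu

end HubDynamics

end

/-! The noise acts by exact quarter turns: f_ω = f_0 + ω/4, and the values of sin 2π at the four
quarter turns of any point sum to zero (`sum_sinC_add_quarter`). Hence, given the state at time t,
the coordinates at time t+1 are independent and of the form z_j + η_j/4 + push, where the push at a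
low degree node is O(αδ/Δ). The uniform initial condition has the same form with zero push, because
Lebesgue measure is invariant under quarter turns. The low degree part of the fluctuation at a hub
is therefore α/Δ₀ times a sum of at most Δ₀ independent, bounded, almost centred terms, uniformly in
what is conditioned on (`dynProb_step_le`, `dynProb_traj_le`). The other neighbours cost at most
17/6 α(1-ν), deterministically (`abs_fluct_sub_le`).

For (i), Hoeffding's inequality bounds the conditional probability that the next state is bad.
Exponential moments of the number of bad times and Borel–Cantelli turn this into an almost sure
frequency (`ae_eventually_visits_le`).

For (ii), a union bound over hubs and times is enough once the bias of the sum is small. The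
hypotheses only give αδ/Δ = o(Δ^(-(1-λ)/2)), while κ may be close to 1-λ, so a first order bias
would be too large. The first order bias of node j is a multiple of `drift`, which changes sign
under a half turn because f_0 is a fold. It thus averages out over the noise one step earlier, and a
bias of order (αδ/Δ)² remains (`dynProb_abs_lowSum_ge_le`).

For (iii), sin² + cos² = 1 makes the conditional variance of each term 1/2 at every point z, and the
conditional law is symmetric. The characteristic function of the sum is therefore close to a
Gaussian one that does not depend on z. Smoothing by an auxiliary Gaussian converts this into a
comparison of distribution functions (`rowLaw_quarterSum_le`).

A graph is good when 1-ν obeys the stated bound. Chernoff bounds show that, with high probability,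
nodes of expected degree at most δ/4 have degree below δ, and that every node has few neighbours of
larger expected degree. The weight of the latter is read off from the power law
(`chungLu_starIndex`). -/

noncomputable section
namespace HubDynamics

/-! ### Trigonometry on the circle -/

/-- `x ↦ cos 2πx` on the circle. -/
def cosC : UnitAddCircle → ℝ :=
  Function.Periodic.lift (f := fun y : ℝ => Real.cos (2 * Real.pi * y)) (c := 1) (by
    intro y
    simp only [mul_add, mul_one, Real.cos_add_two_pi])

lemma cosC_coe (y : ℝ) : cosC (y : UnitAddCircle) = Real.cos (2 * Real.pi * y) := rfl

lemma sinC_coe (y : ℝ) : sinC (y : UnitAddCircle) = Real.sin (2 * Real.pi * y) := by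
  rw [← AddCircle.coe_fract, sinC, AddCircle.liftIco_zero_coe_apply
    ⟨Int.fract_nonneg y, Int.fract_lt_one y⟩]
  have h : 2 * Real.pi * Int.fract y = 2 * Real.pi * y - ⌊y⌋ * (2 * Real.pi) := by
    rw [Int.fract]; ring
  rw [h, Real.sin_sub_int_mul_two_pi]

lemma exists_coe_eq (z : UnitAddCircle) : ∃ y : ℝ, (y : UnitAddCircle) = z :=
  QuotientAddGroup.mk_surjective z

lemma abs_sinC_le_one (z : UnitAddCircle) : |sinC z| ≤ 1 := by
  obtain ⟨y, rfl⟩ := exists_coe_eq z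
  rw [sinC_coe]
  exact Real.abs_sin_le_one _

lemma sinC_sq_add_cosC_sq (z : UnitAddCircle) : sinC z ^ 2 + cosC z ^ 2 = 1 := by
  obtain ⟨y, rfl⟩ := exists_coe_eq z
  rw [sinC_coe, cosC_coe]
  exact Real.sin_sq_add_cos_sq _

lemma abs_cosC_le_one (z : UnitAddCircle) : |cosC z| ≤ 1 := by
  obtain ⟨y, rfl⟩ := exists_coe_eq z
  rw [cosC_coe]
  exact Real.abs_cos_le_one _

lemma sinC_add_coe (z : UnitAddCircle) (e : ℝ) :
    sinC (z + (e : UnitAddCircle)) =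
      sinC z * Real.cos (2 * Real.pi * e) + cosC z * Real.sin (2 * Real.pi * e) := by
  obtain ⟨y, rfl⟩ := exists_coe_eq z
  rw [← AddCircle.coe_add, sinC_coe, sinC_coe, cosC_coe, mul_add, Real.sin_add]

lemma cosC_add_coe (z : UnitAddCircle) (e : ℝ) :
    cosC (z + (e : UnitAddCircle)) =
      cosC z * Real.cos (2 * Real.pi * e) - sinC z * Real.sin (2 * Real.pi * e) := by
  obtain ⟨y, rfl⟩ := exists_coe_eq z
  rw [← AddCircle.coe_add, sinC_coe, cosC_coe, cosC_coe, mul_add, Real.cos_add]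

lemma continuous_sinC : Continuous sinC := by
  refine AddCircle.liftIco_zero_continuous (by simp) (by fun_prop)

lemma continuous_cosC : Continuous cosC := by
  have h : Continuous fun y : ℝ => Real.cos (2 * Real.pi * y) := by fun_prop
  exact continuous_coinduced_dom.mpr h

lemma abs_sinC_add_sub_le (z : UnitAddCircle) (e : ℝ) :
    |sinC (z + (e : UnitAddCircle)) - sinC z| ≤ 2 * Real.pi * |e| := by
  obtain ⟨y, rfl⟩ := exists_coe_eq z
  rw [← AddCircle.coe_add, sinC_coe, sinC_coe]
  have h := Real.abs_sin_sub_sin_le (2 * Real.pi * (y + e)) (2 * Real.pi * y)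
  rw [show 2 * Real.pi * (y + e) - 2 * Real.pi * y = 2 * Real.pi * e by ring, abs_mul,
    abs_of_pos Real.two_pi_pos] at h
  exact h

lemma abs_sinC_add_sub_sub_le (z : UnitAddCircle) (e : ℝ) :
    |sinC (z + (e : UnitAddCircle)) - sinC z - 2 * Real.pi * e * cosC z| ≤
      4 * Real.pi ^ 2 * e ^ 2 := by
  rw [sinC_add_coe]
  set s := 2 * Real.pi * e with hs
  have h1 : |Real.cos s - 1| ≤ s ^ 2 / 2 := by
    rw [abs_sub_comm, abs_of_nonneg (by linarith [Real.cos_le_one s])]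
    linarith [Real.one_sub_sq_div_two_le_cos (x := s)]
  -- Quadratic order is all that is needed. For x ≥ 0 the function sin x - x + x²/2 increases: its
  -- derivative cos x - 1 + x is at least x - x²/2 for x ≤ 2, and at least x - 2 beyond.
  have h2 : |Real.sin s - s| ≤ s ^ 2 / 2 := by
    have hgen : ∀ x : ℝ, 0 ≤ x → |Real.sin x - x| ≤ x ^ 2 / 2 := by
      intro x hx
      rw [abs_sub_comm, abs_of_nonneg (by linarith [Real.sin_le hx])]
      have hmono : MonotoneOn (fun x : ℝ => Real.sin x - x + x ^ 2 / 2) (Set.Ici 0) := by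
        refine monotoneOn_of_deriv_nonneg (convex_Ici 0) (by fun_prop)
          (by fun_prop) ?_
        intro x hx
        rw [interior_Ici, Set.mem_Ioi] at hx
        have hd : HasDerivAt (fun x : ℝ => Real.sin x - x + x ^ 2 / 2)
            (Real.cos x - 1 + x) x := by
          have := ((Real.hasDerivAt_sin x).sub (hasDerivAt_id x)).add
            ((hasDerivAt_pow 2 x).div_const 2)
          refine this.congr_deriv ?_
          norm_num
        rw [hd.deriv]
        by_cases hx2 : x ≤ 2
        · nlinarith [Real.one_sub_sq_div_two_le_cos (x := x)]
        · linarith [Real.neg_one_le_cos x]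
      have := hmono (Set.mem_Ici.2 le_rfl) (Set.mem_Ici.2 hx) hx
      simp at this
      linarith
    rcases le_total 0 s with h | h
    · exact hgen s h
    · have := hgen (-s) (by linarith)
      rw [Real.sin_neg, ← abs_neg] at this
      convert this using 2 <;> ring
  have e1 : sinC z * Real.cos s + cosC z * Real.sin s - sinC z - s * cosC z =
      sinC z * (Real.cos s - 1) + cosC z * (Real.sin s - s) := by ring
  rw [e1]
  calc _ ≤ |sinC z * (Real.cos s - 1)| + |cosC z * (Real.sin s - s)| := abs_add_le _ _
    _ ≤ 1 * (s ^ 2 / 2) + 1 * (s ^ 2 / 2) := by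
        rw [abs_mul, abs_mul]
        gcongr
        · exact abs_sinC_le_one z
        · exact abs_cosC_le_one z
    _ = _ := by rw [hs]; ring

/-- The quarter turn by `k / 4`. -/
def quarter (k : Fin 4) : UnitAddCircle := (((k.val : ℝ) / 4 : ℝ) : UnitAddCircle)

lemma sinC_add_quarter (z : UnitAddCircle) (k : Fin 4) :
    sinC (z + quarter k) = ![sinC z, cosC z, -sinC z, -cosC z] k := by
  have h3 : 2 * Real.pi * (3 / 4) = Real.pi + Real.pi / 2 := by ring
  have h2 : 2 * Real.pi * (2 / 4) = Real.pi := by ring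
  have h1 : 2 * Real.pi * (1 / 4) = Real.pi / 2 := by ring
  rw [quarter, sinC_add_coe]
  fin_cases k
  · simp
  · simp only [Fin.mk_one, Nat.cast_one, h1]; simp
  · simp only [Fin.reduceFinMk, Nat.cast_ofNat, h2]; simp
  · simp only [Fin.reduceFinMk, Nat.cast_ofNat, h3]
    simp [Real.cos_add, Real.sin_add]

lemma cosC_add_quarter (z : UnitAddCircle) (k : Fin 4) :
    cosC (z + quarter k) = ![cosC z, -sinC z, -cosC z, sinC z] k := by
  have h3 : 2 * Real.pi * (3 / 4) = Real.pi + Real.pi / 2 := by ring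
  have h2 : 2 * Real.pi * (2 / 4) = Real.pi := by ring
  have h1 : 2 * Real.pi * (1 / 4) = Real.pi / 2 := by ring
  rw [quarter, cosC_add_coe]
  fin_cases k
  · simp
  · simp only [Fin.mk_one, Nat.cast_one, h1]; simp
  · simp only [Fin.reduceFinMk, Nat.cast_ofNat, h2]; simp
  · simp only [Fin.reduceFinMk, Nat.cast_ofNat, h3]
    simp [Real.cos_add, Real.sin_add]

/-- Opposite quarter turns cancel. Through this identity uniform noise centres every term, whatever
the point z, so no ergodic or invariant measure argument is needed. -/
lemma sum_sinC_add_quarter (z : UnitAddCircle) : ∑ k, sinC (z + quarter k) = 0 := by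
  simp only [sinC_add_quarter, Fin.sum_univ_four]
  simp

/-! ### The node maps -/

/-- The two branches fold the circle at 1/2, so the map halves the distance to the nearest integer.
Continuity and Lipschitz bounds then come from the norm. -/
lemma nodeMap_zero (z : UnitAddCircle) : nodeMap 0 z = ((‖z‖ / 2 : ℝ) : UnitAddCircle) := by
  obtain ⟨y, rfl⟩ := exists_coe_eq z
  have hf : Int.fract y ∈ Set.Ico (0 : ℝ) 1 := ⟨Int.fract_nonneg y, Int.fract_lt_one y⟩
  rw [UnitAddCircle.norm_eq, abs_sub_round_eq_min, ← AddCircle.coe_fract, nodeMap,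
    AddCircle.liftIco_zero_coe_apply hf]
  simp only [Fin.val_zero, Nat.cast_zero, zero_div, add_zero]
  congr 1
  split_ifs with h
  · rw [min_eq_left (by linarith)]
  · rw [min_eq_right (by linarith)]

lemma nodeMap_eq (k : Fin 4) (z : UnitAddCircle) : nodeMap k z = nodeMap 0 z + quarter k := by
  obtain ⟨y, rfl⟩ := exists_coe_eq z
  have hf : Int.fract y ∈ Set.Ico (0 : ℝ) 1 := ⟨Int.fract_nonneg y, Int.fract_lt_one y⟩
  rw [← AddCircle.coe_fract, nodeMap, nodeMap, AddCircle.liftIco_zero_coe_apply hf,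
    AddCircle.liftIco_zero_coe_apply hf, quarter, ← AddCircle.coe_add]
  congr 1
  split_ifs <;> simp

lemma continuous_nodeMap (k : Fin 4) : Continuous (nodeMap k) := by
  have h : nodeMap k = fun z => ((‖z‖ / 2 : ℝ) : UnitAddCircle) + quarter k := by
    funext z
    rw [nodeMap_eq, nodeMap_zero]
  rw [h]
  have h2 : Continuous fun z : UnitAddCircle => (‖z‖ / 2 : ℝ) := by fun_prop
  exact ((AddCircle.continuous_mk' (1 : ℝ)).comp h2).add continuous_const

lemma norm_add_half (z : UnitAddCircle) :
    ‖z + ((1 / 2 : ℝ) : UnitAddCircle)‖ = 1 / 2 - ‖z‖ := by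
  obtain ⟨y, rfl⟩ := exists_coe_eq z
  rw [← AddCircle.coe_add, UnitAddCircle.norm_eq, UnitAddCircle.norm_eq, abs_sub_round_eq_min,
    abs_sub_round_eq_min]
  have h0 := Int.fract_nonneg y
  have h1 := Int.fract_lt_one y
  by_cases h : Int.fract y < 1 / 2
  · have : Int.fract (y + 1 / 2) = Int.fract y + 1 / 2 := by
      rw [Int.fract_eq_iff]
      refine ⟨by linarith, by linarith, ⌊y⌋, ?_⟩
      rw [Int.fract]; ring
    rw [this, min_eq_right (by linarith), min_eq_left (by linarith)]
    ring
  · have : Int.fract (y + 1 / 2) = Int.fract y - 1 / 2 := by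
      rw [Int.fract_eq_iff]
      refine ⟨by linarith, by linarith, ⌊y⌋ + 1, ?_⟩
      rw [Int.fract]; push_cast; ring
    rw [this, min_eq_left (by linarith), min_eq_right (by linarith)]
    ring

/-- The mean drift `sin 2πg - cos 2πg`, where `g = f_0(z)`. -/
def drift (z : UnitAddCircle) : ℝ := sinC (nodeMap 0 z) - cosC (nodeMap 0 z)

lemma drift_eq (z : UnitAddCircle) :
    drift z = Real.sin (Real.pi * ‖z‖) - Real.cos (Real.pi * ‖z‖) := by
  rw [drift, nodeMap_zero, sinC_coe, cosC_coe,
    show 2 * Real.pi * (‖z‖ / 2) = Real.pi * ‖z‖ by ring]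

lemma continuous_drift : Continuous drift :=
  (continuous_sinC.comp (continuous_nodeMap 0)).sub (continuous_cosC.comp (continuous_nodeMap 0))

lemma abs_drift_le (z : UnitAddCircle) : |drift z| ≤ 2 := by
  rw [drift]
  calc _ ≤ |sinC (nodeMap 0 z)| + |cosC (nodeMap 0 z)| := abs_sub _ _
    _ ≤ 1 + 1 := add_le_add (abs_sinC_le_one _) (abs_cosC_le_one _)
    _ = 2 := by norm_num

/-- The fold turns a half turn into the reflection of ‖z‖ about 1/4 (`norm_add_half`), which
exchanges sin π‖z‖ and cos π‖z‖. This symmetry removes the first order bias in (ii). -/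
lemma drift_add_half (z : UnitAddCircle) :
    drift (z + ((1 / 2 : ℝ) : UnitAddCircle)) = - drift z := by
  rw [drift_eq, drift_eq, norm_add_half,
    show Real.pi * (1 / 2 - ‖z‖) = Real.pi / 2 - Real.pi * ‖z‖ by ring,
    Real.sin_pi_div_two_sub, Real.cos_pi_div_two_sub]
  ring

lemma sum_drift_add_quarter (z : UnitAddCircle) : ∑ k, drift (z + quarter k) = 0 := by
  have h0 : z + quarter 2 = (z + quarter 0) + ((1 / 2 : ℝ) : UnitAddCircle) := by
    rw [add_assoc, quarter, quarter, ← AddCircle.coe_add]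
    norm_num
  have h1 : z + quarter 3 = (z + quarter 1) + ((1 / 2 : ℝ) : UnitAddCircle) := by
    rw [add_assoc, quarter, quarter, ← AddCircle.coe_add]
    norm_num
  rw [Fin.sum_univ_four, h0, h1, drift_add_half, drift_add_half]
  ring

lemma abs_drift_add_sub_le (z : UnitAddCircle) (e : ℝ) :
    |drift (z + (e : UnitAddCircle)) - drift z| ≤ 2 * Real.pi * |e| := by
  rw [drift_eq, drift_eq]
  have hn : |‖z + (e : UnitAddCircle)‖ - ‖z‖| ≤ |e| := by
    refine (abs_norm_sub_norm_le _ _).trans ?_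
    rw [add_sub_cancel_left]
    exact (QuotientAddGroup.norm_mk_le_norm).trans_eq (Real.norm_eq_abs e)
  set a := ‖z + (e : UnitAddCircle)‖
  have h1 := Real.abs_sin_sub_sin_le (Real.pi * a) (Real.pi * ‖z‖)
  have h2 := Real.abs_cos_sub_cos_le (Real.pi * a) (Real.pi * ‖z‖)
  rw [← mul_sub, abs_mul, abs_of_pos Real.pi_pos] at h1 h2
  have h3 : Real.pi * |a - ‖z‖| ≤ Real.pi * |e| := by gcongr
  have h4 := abs_sub (Real.sin (Real.pi * a) - Real.sin (Real.pi * ‖z‖))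
    (Real.cos (Real.pi * a) - Real.cos (Real.pi * ‖z‖))
  rw [show Real.sin (Real.pi * a) - Real.cos (Real.pi * a) -
    (Real.sin (Real.pi * ‖z‖) - Real.cos (Real.pi * ‖z‖)) =
    (Real.sin (Real.pi * a) - Real.sin (Real.pi * ‖z‖)) -
    (Real.cos (Real.pi * a) - Real.cos (Real.pi * ‖z‖)) by ring]
  linarith

/-! ### The reduced map -/

/-- A half turn preserves the measure and flips the sign of the integrand. -/
lemma integral_sinC : ∫ x : UnitAddCircle, sinC x = 0 := by
  have h1 : ∫ x : UnitAddCircle, sinC (x + quarter 2) = ∫ x : UnitAddCircle, sinC x :=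
    integral_add_right_eq_self _ _
  simp only [sinC_add_quarter] at h1
  have h2 : ∫ x : UnitAddCircle, -sinC x = ∫ x : UnitAddCircle, sinC x := h1
  rw [integral_neg] at h2
  linarith

lemma integral_coupling (k : Fin 4) (z : UnitAddCircle) :
    ∫ x : UnitAddCircle, coupling k z x = - sinC z - (k.val : ℝ) / 3.6 := by
  have hi : Integrable (fun x : UnitAddCircle => sinC x) :=
    continuous_sinC.integrable_of_hasCompactSupport (HasCompactSupport.of_compactSpace _)
  have h : ∀ x, coupling k z x = sinC x + (- sinC z - (k.val : ℝ) / 3.6) := by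
    intro x; rw [coupling]; ring
  simp only [h]
  rw [integral_add hi (integrable_const _), integral_sinC]
  have hv : (volume : Measure UnitAddCircle).real Set.univ = 1 := by
    simp [Measure.real]
  rw [integral_const, hv]
  simp

/-! ### Low and high degree neighbours in the fluctuation -/

section Graph

variable {N : ℕ} (G : SimpleGraph (Fin N))

lemma nbrs_eq_union (δ : ℝ) (i : Fin N) (F : Fin N → ℝ) :
    ∑ j ∈ nbrs G i, F j = ∑ j ∈ lowNbrs G δ i, F j + ∑ j ∈ highNbrs G δ i, F j := by
  classical
  rw [lowNbrs, highNbrs, ← Finset.sum_filter_add_sum_filter_not (nbrs G i)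
    (fun j => (deg G j : ℝ) < δ)]
  simp only [not_lt]

lemma card_low_add_card_high (δ : ℝ) (i : Fin N) :
    ((lowNbrs G δ i).card : ℝ) + (highNbrs G δ i).card = deg G i := by
  have := nbrs_eq_union G δ i (fun _ => 1)
  simp at this
  rw [deg, this]

lemma nodeIndex_mul_deg (δ : ℝ) (i : Fin N) :
    nodeIndex G δ i * deg G i = (lowNbrs G δ i).card := by
  rw [nodeIndex]
  -- An isolated node has ν_i = 0/0 = 0, and both sides vanish.
  by_cases h : (deg G i : ℝ) = 0
  · have := card_low_add_card_high G δ i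
    have h1 : (0 : ℝ) ≤ (lowNbrs G δ i).card := by positivity
    have h2 : (0 : ℝ) ≤ (highNbrs G δ i).card := by positivity
    rw [h]; simp; linarith
  · field_simp

lemma effCoupling_eq (δ α : ℝ) (i : Fin N) :
    effCoupling G δ α i = α / topDeg G * (lowNbrs G δ i).card := by
  rw [effCoupling, mul_assoc, nodeIndex_mul_deg]; ring

lemma fluct_eq (δ α : ℝ) (ω : Noise N) (x : Fin N → UnitAddCircle) (i : Fin N) (t : ℕ) :
    fluct G δ α ω x i t = α / topDeg G *
      (∑ j ∈ lowNbrs G δ i, sinC (traj G α ω x t j) +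
        ∑ j ∈ highNbrs G δ i, coupling (ω (t, i)) (traj G α ω x t i) (traj G α ω x t j)) := by
  rw [fluct, effCoupling_eq, nodeIndex_mul_deg, mul_add]
  congr 1
  -- With no low degree neighbour the prefactor is a division by zero, but the sum it multiplies is
  -- empty.
  by_cases h : (lowNbrs G δ i) = ∅
  · simp [h]
  · have : ((lowNbrs G δ i).card : ℝ) ≠ 0 := by simpa using h
    field_simp

/-- The identity is exact, at every node. Replacing sin 2πx_j by its space mean 0 at the low degree
neighbours gives the mean-field map, and the fluctuation is by definition everything else. -/
lemma traj_succ_eq_reducedMap (δ α : ℝ) (ω : Noise N) (x : Fin N → UnitAddCircle) (i : Fin N)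
    (t : ℕ) :
    traj G α ω x (t + 1) i =
      reducedMap (effCoupling G δ α i) (ω (t, i)) (traj G α ω x t i) +
        ((fluct G δ α ω x i t : ℝ) : UnitAddCircle) := by
  rw [reducedMap, integral_coupling, add_assoc, ← AddCircle.coe_add]
  change nodeMap (ω (t, i)) (traj G α ω x t i) + _ = _
  congr 2
  rw [fluct_eq, effCoupling_eq, nbrs_eq_union G δ]
  have : ∑ j ∈ lowNbrs G δ i, coupling (ω (t, i)) (traj G α ω x t i) (traj G α ω x t j) =
      ∑ j ∈ lowNbrs G δ i, sinC (traj G α ω x t j) + (lowNbrs G δ i).card *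
        (-sinC (traj G α ω x t i) - ((ω (t, i)).val : ℝ) / 3.6) := by
    simp only [coupling, Finset.sum_sub_distrib, Finset.sum_const, nsmul_eq_mul]
    ring
  rw [this]
  ring

lemma abs_coupling_le (k : Fin 4) (x y : UnitAddCircle) : |coupling k x y| ≤ 17 / 6 := by
  have h1 := abs_le.1 (abs_sinC_le_one x)
  have h2 := abs_le.1 (abs_sinC_le_one y)
  have h3 : (0 : ℝ) ≤ (k.val : ℝ) := by positivity
  have h4 : (k.val : ℝ) ≤ 3 := by
    have : k.val ≤ 3 := by omega
    exact_mod_cast this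
  -- The bound is 1 + 1 + 3/3.6 = 17/6.
  have h5 : (k.val : ℝ) / 3.6 = (k.val : ℝ) * (5 / 18) := by norm_num; ring
  rw [coupling, abs_le, h5]
  constructor <;> linarith [h1.1, h1.2, h2.1, h2.2]

lemma deg_le_topDeg (i : Fin N) : deg G i ≤ topDeg G :=
  Finset.le_sup (f := fun i => deg G i) (Finset.mem_univ i)

lemma lt_topDeg_of_mem_hubs {Δ : ℝ} {i : Fin N} (hi : i ∈ hubs G Δ) : Δ < topDeg G := by
  have h : Δ < deg G i := by simpa [hubs] using hi
  exact h.trans_le (by exact_mod_cast deg_le_topDeg G i)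

lemma nodeIndex_le_one (δ : ℝ) (i : Fin N) : nodeIndex G δ i ≤ 1 := by
  rw [nodeIndex]
  refine div_le_one_of_le₀ ?_ (by positivity)
  exact_mod_cast Finset.card_le_card (Finset.filter_subset _ _)

lemma starIndex_le_one (Δ δ : ℝ) : starIndex G Δ δ ≤ 1 := by
  rw [starIndex]
  split_ifs with h
  · obtain ⟨i, hi⟩ := h
    exact (Finset.inf'_le _ hi).trans (nodeIndex_le_one G δ i)
  · exact le_rfl

lemma starIndex_le_nodeIndex {Δ δ : ℝ} {i : Fin N} (hi : i ∈ hubs G Δ) :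
    starIndex G Δ δ ≤ nodeIndex G δ i := by
  rw [starIndex, dif_pos ⟨i, hi⟩]
  exact Finset.inf'_le _ hi

lemma card_highNbrs_le {Δ δ : ℝ} {i : Fin N} (hi : i ∈ hubs G Δ) :
    ((highNbrs G δ i).card : ℝ) ≤ (1 - starIndex G Δ δ) * topDeg G := by
  have h1 := card_low_add_card_high G δ i
  have h2 := nodeIndex_mul_deg G δ i
  have h3 := starIndex_le_nodeIndex G (δ := δ) hi
  have h4 := starIndex_le_one G Δ δ
  have h5 : (deg G i : ℝ) ≤ topDeg G := by exact_mod_cast deg_le_topDeg G i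
  have h6 : (0 : ℝ) ≤ deg G i := by positivity
  calc ((highNbrs G δ i).card : ℝ) = (1 - nodeIndex G δ i) * deg G i := by linarith
    _ ≤ (1 - starIndex G Δ δ) * deg G i := by gcongr
    _ ≤ _ := by
      have : 0 ≤ 1 - starIndex G Δ δ := by linarith
      gcongr

lemma card_lowNbrs_le (δ : ℝ) (i : Fin N) : ((lowNbrs G δ i).card : ℝ) ≤ topDeg G := by
  have : (lowNbrs G δ i).card ≤ deg G i := Finset.card_le_card (Finset.filter_subset _ _)
  exact_mod_cast this.trans (deg_le_topDeg G i)

/-- The neighbours of high degree contribute at most `17/6 α (1 - ν)` to the fluctuation. -/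
lemma abs_fluct_sub_le {Δ δ α : ℝ} (hα : 0 < α) (hΔ : 0 < Δ) (ω : Noise N)
    (x : Fin N → UnitAddCircle) {i : Fin N} (hi : i ∈ hubs G Δ) (t : ℕ) :
    |fluct G δ α ω x i t - α / topDeg G * ∑ j ∈ lowNbrs G δ i, sinC (traj G α ω x t j)| ≤
      17 / 6 * α * (1 - starIndex G Δ δ) := by
  have hD : (0 : ℝ) < topDeg G := hΔ.trans (lt_topDeg_of_mem_hubs G hi)
  rw [fluct_eq, mul_add, add_sub_cancel_left, abs_mul, abs_of_pos (by positivity)]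
  have h1 : |∑ j ∈ highNbrs G δ i, coupling (ω (t, i)) (traj G α ω x t i) (traj G α ω x t j)| ≤
      (highNbrs G δ i).card * (17 / 6 : ℝ) := by
    refine (Finset.abs_sum_le_sum_abs _ _).trans ?_
    rw [← nsmul_eq_mul]
    exact Finset.sum_le_card_nsmul _ _ _ fun j _ => abs_coupling_le _ _ _
  calc _ ≤ α / topDeg G * ((1 - starIndex G Δ δ) * topDeg G * (17 / 6 : ℝ)) := by
        gcongr
        exact h1.trans (by gcongr; exact card_highNbrs_le G hi)
    _ = _ := by field_simp

end Graph


/-! ### Resampling one row of the noise -/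

section Resampling

variable {N : ℕ}

/-- The law of the noise at all nodes at one time. -/
def rowLaw (N : ℕ) : Measure (Fin N → Fin 4) :=
  Measure.pi fun _ : Fin N => (PMF.uniformOfFintype (Fin 4)).toMeasure

instance : IsProbabilityMeasure (rowLaw N) := by unfold rowLaw; infer_instance

instance : IsProbabilityMeasure (volume : Measure UnitAddCircle) :=
  ⟨UnitAddCircle.measure_univ⟩

instance : IsProbabilityMeasure (dynProb N) := by unfold dynProb; infer_instance

/-- Replace the noise at time `t` by `η`. -/
def resample (t : ℕ) (ω : Noise N) (η : Fin N → Fin 4) : Noise N :=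
  fun p => if p.1 = t then η p.2 else ω p

lemma measurable_resample (t : ℕ) :
    Measurable fun q : Noise N × (Fin N → Fin 4) => resample t q.1 q.2 := by
  refine measurable_pi_lambda _ fun p => ?_
  unfold resample
  split_ifs
  · exact (measurable_pi_apply p.2).comp measurable_snd
  · exact (measurable_pi_apply p).comp measurable_fst

/-- Overwriting one row by an independent copy keeps the iid law, so conditioning on all other rows
becomes plain integration over η. It suffices to test on boxes, whose preimages split into a box off
time t and a box for η. -/
lemma measurePreserving_resample (t : ℕ) :
    MeasurePreserving (fun q : Noise N × (Fin N → Fin 4) => resample t q.1 q.2)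
      ((Measure.infinitePi fun _ : ℕ × Fin N => (PMF.uniformOfFintype (Fin 4)).toMeasure).prod
        (rowLaw N))
      (Measure.infinitePi fun _ : ℕ × Fin N => (PMF.uniformOfFintype (Fin 4)).toMeasure) := by
  classical
  refine ⟨measurable_resample t, Measure.eq_infinitePi _ ?_⟩
  intro s A hA
  have hpre : (fun q : Noise N × (Fin N → Fin 4) => resample t q.1 q.2) ⁻¹' Set.pi s A =
      (Set.pi (s.filter fun p => ¬ p.1 = t) A) ×ˢ
        (Set.pi Set.univ fun i => if (t, i) ∈ s then A (t, i) else Set.univ) := by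
    ext ⟨ω, η⟩
    simp only [Set.mem_preimage, Set.mem_pi, Finset.mem_coe, Set.mem_prod, Finset.mem_filter,
      Set.mem_univ, true_implies, resample]
    constructor
    · intro h
      refine ⟨fun p hp => ?_, fun i => ?_⟩
      · have := h p hp.1
        rwa [if_neg hp.2] at this
      · split_ifs with hi
        · have := h _ hi
          simpa using this
        · trivial
    · rintro ⟨h1, h2⟩ p hp
      split_ifs with hpt
      · have := h2 p.2
        obtain ⟨p1, p2⟩ := p
        subst hpt
        rwa [if_pos hp] at this
      · exact h1 p ⟨hp, hpt⟩
  rw [Measure.map_apply (measurable_resample t) (MeasurableSet.pi s.countable_toSet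
    fun i _ => hA i), hpre, Measure.prod_prod, Measure.infinitePi_pi _ (fun i _ => hA i), rowLaw,
    Measure.pi_pi, ← Finset.prod_filter_mul_prod_filter_not s (fun p => p.1 = t), mul_comm]
  congr 1
  have h1 : ∀ i : Fin N, (PMF.uniformOfFintype (Fin 4)).toMeasure
      (if (t, i) ∈ s then A (t, i) else Set.univ) =
      if (t, i) ∈ s then (PMF.uniformOfFintype (Fin 4)).toMeasure (A (t, i)) else 1 := by
    intro i
    split_ifs
    · rfl
    · simp
  simp only [h1]
  rw [← Finset.prod_filter]
  refine Finset.prod_bij (fun i _ => (t, i)) ?_ ?_ ?_ ?_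
  · intro i hi; simpa using hi
  · intro i _ j _ h; simpa using h
  · rintro ⟨p1, p2⟩ hp
    simp only [Finset.mem_filter] at hp
    obtain ⟨hp, rfl⟩ := hp
    exact ⟨p2, by simpa using hp, rfl⟩
  · intro i _; rfl

lemma lintegral_dynProb_resample (t : ℕ) {F : Noise N × (Fin N → UnitAddCircle) → ENNReal}
    (hF : Measurable F) :
    ∫⁻ p, F p ∂(dynProb N) =
      ∫⁻ p, ∫⁻ η, F (resample t p.1 η, p.2) ∂(rowLaw N) ∂(dynProb N) := by
  have hm : Measurable fun q : (Noise N × (Fin N → UnitAddCircle)) × (Fin N → Fin 4) =>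
      F (resample t q.1.1 q.2, q.1.2) := by
    refine hF.comp (Measurable.prodMk ?_ (measurable_snd.comp measurable_fst))
    exact (measurable_resample t).comp
      (Measurable.prodMk (measurable_fst.comp measurable_fst) measurable_snd)
  unfold dynProb
  rw [lintegral_prod_symm _ hF.aemeasurable,
    lintegral_prod_symm _ hm.lintegral_prod_right'.aemeasurable]
  refine lintegral_congr fun x => ?_
  have hx : Measurable fun ω : Noise N => F (ω, x) := hF.comp (by fun_prop)
  rw [← (measurePreserving_resample t).lintegral_comp hx, lintegral_prod]
  exact (hx.comp (measurable_resample t)).aemeasurable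

/-- For each fixed η the translation preserves Lebesgue measure, so random quarter turns may be
inserted into the initial condition. Time 0 can then be treated like all later times. -/
lemma lintegral_dynProb_shift {F : Noise N × (Fin N → UnitAddCircle) → ENNReal}
    (hF : Measurable F) :
    ∫⁻ p, F p ∂(dynProb N) =
      ∫⁻ p, ∫⁻ η, F (p.1, fun j => p.2 j + quarter (η j)) ∂(rowLaw N) ∂(dynProb N) := by
  have hm : Measurable fun q : (Noise N × (Fin N → UnitAddCircle)) × (Fin N → Fin 4) =>
      F (q.1.1, fun j => q.1.2 j + quarter (q.2 j)) := by
    refine hF.comp (Measurable.prodMk (measurable_fst.comp measurable_fst) ?_)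
    refine measurable_pi_lambda _ fun j => ?_
    refine Measurable.add ?_ ?_
    · exact (measurable_pi_apply j).comp (measurable_snd.comp measurable_fst)
    · exact (Measurable.of_discrete (f := quarter)).comp
        ((measurable_pi_apply j).comp measurable_snd)
  rw [lintegral_lintegral_swap hm.aemeasurable]
  have h : ∀ η : Fin N → Fin 4,
      ∫⁻ p, F (p.1, fun j => p.2 j + quarter (η j)) ∂(dynProb N) = ∫⁻ p, F p ∂(dynProb N) := by
    intro η
    have hη : Measurable fun p : Noise N × (Fin N → UnitAddCircle) =>
        F (p.1, fun j => p.2 j + quarter (η j)) := 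
      hm.comp (measurable_id.prodMk measurable_const)
    unfold dynProb
    rw [lintegral_prod _ hF.aemeasurable, lintegral_prod _ hη.aemeasurable]
    refine lintegral_congr fun ω => ?_
    exact lintegral_add_right_eq_self (fun x : Fin N → UnitAddCircle => F (ω, x))
      (fun j => quarter (η j))
  simp only [h, lintegral_const, measure_univ, mul_one]

lemma measureReal_le_of_lintegral {Ω : Type*} [MeasurableSpace Ω] {P : Measure Ω}
    [IsProbabilityMeasure P] {E : Set Ω} {g : Ω → Set (Fin N → Fin 4)} {B : ℝ}
    (hE : P E = ∫⁻ p, rowLaw N (g p) ∂P) (hB : ∀ p, (rowLaw N).real (g p) ≤ B) :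
    P.real E ≤ B := by
  have hB0 : 0 ≤ B := by
    obtain ⟨p⟩ := P.nonempty_of_neZero
    exact measureReal_nonneg.trans (hB p)
  refine ENNReal.toReal_le_of_le_ofReal hB0 ?_
  rw [hE]
  calc _ ≤ ∫⁻ _, ENNReal.ofReal B ∂P := by
        refine lintegral_mono fun p => ?_
        rw [← ENNReal.ofReal_toReal (measure_ne_top (rowLaw N) (g p))]
        exact ENNReal.ofReal_le_ofReal (hB p)
    _ = _ := by simp

lemma dynProb_le_of_resample (t : ℕ) {E : Set (Noise N × (Fin N → UnitAddCircle))}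
    (hE : MeasurableSet E) {B : ℝ}
    (hB : ∀ p : Noise N × (Fin N → UnitAddCircle),
      (rowLaw N).real {η | (resample t p.1 η, p.2) ∈ E} ≤ B) :
    (dynProb N).real E ≤ B := by
  refine measureReal_le_of_lintegral ?_ hB
  rw [← lintegral_indicator_one hE, lintegral_dynProb_resample t (by fun_prop (disch := exact hE))]
  refine lintegral_congr fun p => ?_
  rw [← lintegral_indicator_one (MeasurableSet.of_discrete)]
  rfl

lemma dynProb_le_of_shift {E : Set (Noise N × (Fin N → UnitAddCircle))}
    (hE : MeasurableSet E) {B : ℝ}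
    (hB : ∀ p : Noise N × (Fin N → UnitAddCircle),
      (rowLaw N).real {η | (p.1, fun j => p.2 j + quarter (η j)) ∈ E} ≤ B) :
    (dynProb N).real E ≤ B := by
  refine measureReal_le_of_lintegral ?_ hB
  rw [← lintegral_indicator_one hE, lintegral_dynProb_shift (by fun_prop (disch := exact hE))]
  refine lintegral_congr fun p => ?_
  rw [← lintegral_indicator_one (MeasurableSet.of_discrete)]
  rfl

end Resampling

/-! ### One step of the dynamics -/

section Step

variable {N : ℕ} (G : SimpleGraph (Fin N)) (α : ℝ)

/-- The displacement of node `i` by the coupling when its noise symbol is `k`. -/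
def push (y : Fin N → UnitAddCircle) (i : Fin N) (k : Fin 4) : ℝ :=
  α / (topDeg G : ℝ) * ∑ j ∈ nbrs G i, coupling k (y i) (y j)

/-- The network map with noise `η`. -/
def step (η : Fin N → Fin 4) (y : Fin N → UnitAddCircle) : Fin N → UnitAddCircle :=
  fun i => nodeMap 0 (y i) + quarter (η i) + (push G α y i (η i) : UnitAddCircle)

lemma traj_succ (ω : Noise N) (x : Fin N → UnitAddCircle) (t : ℕ) :
    traj G α ω x (t + 1) = step G α (fun i => ω (t, i)) (traj G α ω x t) := by
  funext i
  rw [step, ← nodeMap_eq]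
  rfl

/-- Causality: the state at time t uses only the rows before t. -/
lemma traj_resample (ω : Noise N) (x : Fin N → UnitAddCircle) (η : Fin N → Fin 4) {s t : ℕ}
    (h : t ≤ s) : traj G α (resample s ω η) x t = traj G α ω x t := by
  induction t with
  | zero => rfl
  | succ t ih =>
    rw [traj_succ, traj_succ, ih (by omega)]
    congr 1
    funext i
    simp [resample, show t ≠ s by omega]

lemma traj_resample_succ (ω : Noise N) (x : Fin N → UnitAddCircle) (η : Fin N → Fin 4) (t : ℕ) :
    traj G α (resample t ω η) x (t + 1) = step G α η (traj G α ω x t) := by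
  rw [traj_succ, traj_resample G α ω x η le_rfl]
  congr 1
  funext i
  simp [resample]

/-- The symbol enters the coupling only through the term -ω/3.6. This affine dependence correlates
the push with the quarter turn, and so produces the first order bias `meanShift`. -/
lemma push_eq (y : Fin N → UnitAddCircle) (i : Fin N) (k : Fin 4) :
    push G α y i k = push G α y i 0 - α / topDeg G * deg G i / 3.6 * k.val := by
  simp only [push, coupling, Finset.sum_sub_distrib, Finset.sum_const, nsmul_eq_mul, deg]
  simp
  ring

lemma abs_push_le (hα : 0 < α) (y : Fin N → UnitAddCircle) (i : Fin N) (k : Fin 4) :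
    |push G α y i k| ≤ 17 / 6 * (α / topDeg G * deg G i) := by
  rw [push, abs_mul, abs_of_nonneg (by positivity)]
  have h1 : |∑ j ∈ nbrs G i, coupling k (y i) (y j)| ≤ (nbrs G i).card * (17 / 6 : ℝ) := by
    refine (Finset.abs_sum_le_sum_abs _ _).trans ?_
    rw [← nsmul_eq_mul]
    exact Finset.sum_le_card_nsmul _ _ _ fun j _ => abs_coupling_le _ _ _
  calc _ ≤ α / topDeg G * ((nbrs G i).card * (17 / 6 : ℝ)) := by gcongr
    _ = _ := by rw [deg]; ring

lemma measurable_step (η : Fin N → Fin 4) : Measurable (step G α η) := by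
  refine measurable_pi_lambda _ fun i => Continuous.measurable ?_
  have h0 := continuous_nodeMap 0
  have h1 := continuous_sinC
  have h2 := AddCircle.continuous_mk' (1 : ℝ)
  have h3 : Continuous fun y : Fin N → UnitAddCircle => push G α y i (η i) := by
    unfold push coupling
    fun_prop
  exact ((h0.comp (continuous_apply i)).add continuous_const).add (h2.comp h3)

lemma measurable_traj (t : ℕ) :
    Measurable fun p : Noise N × (Fin N → UnitAddCircle) => traj G α p.1 p.2 t := by
  induction t with
  | zero => exact measurable_snd
  | succ t ih =>
    simp only [traj_succ]
    have h : Measurable fun q : (Fin N → UnitAddCircle) × (Fin N → Fin 4) =>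
        step G α q.2 q.1 :=
      measurable_from_prod_countable_left fun η => measurable_step G α η
    have h2 : Measurable fun p : Noise N × (Fin N → UnitAddCircle) => fun i => p.1 (t, i) :=
      measurable_pi_lambda _ fun i => (measurable_pi_apply (t, i)).comp measurable_fst
    have h3 : Measurable fun p : Noise N × (Fin N → UnitAddCircle) =>
        (traj G α p.1 p.2 t, fun i => p.1 (t, i)) := ih.prodMk h2
    exact Measurable.comp (f := fun p : Noise N × (Fin N → UnitAddCircle) =>
        (traj G α p.1 p.2 t, fun i => p.1 (t, i))) h h3

/-- A bound for the law of two consecutive states that holds conditionally on the first one. -/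
lemma dynProb_step_le (t : ℕ) {E : Set ((Fin N → UnitAddCircle) × (Fin N → UnitAddCircle))}
    (hE : MeasurableSet E) {B : ℝ}
    (hB : ∀ y, (rowLaw N).real {η | (y, step G α η y) ∈ E} ≤ B) :
    (dynProb N).real {p | (traj G α p.1 p.2 t, traj G α p.1 p.2 (t + 1)) ∈ E} ≤ B := by
  have hm : MeasurableSet {p : Noise N × (Fin N → UnitAddCircle) |
      (traj G α p.1 p.2 t, traj G α p.1 p.2 (t + 1)) ∈ E} :=
    measurableSet_preimage ((measurable_traj G α t).prodMk (measurable_traj G α (t + 1))) hE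
  refine dynProb_le_of_resample t hm ?_
  rintro ⟨ω, x⟩
  have h := hB (traj G α ω x t)
  have h2 : {η | (resample t ω η, x) ∈ {p : Noise N × (Fin N → UnitAddCircle) |
      (traj G α p.1 p.2 t, traj G α p.1 p.2 (t + 1)) ∈ E}} =
      {η | (traj G α ω x t, step G α η (traj G α ω x t)) ∈ E} := by
    ext η
    simp only [Set.mem_ofPred_eq, traj_resample_succ, traj_resample G α ω x η le_rfl]
  rw [h2]
  exact h

/-- A bound for the law of the state at time `t` that holds for all distributions of the form
`z_j + η_j / 4 + e_j(η_j)` with small displacements `e_j`. -/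
lemma dynProb_traj_le (hα : 0 < α) (t : ℕ) {E : Set (Fin N → UnitAddCircle)}
    (hE : MeasurableSet E) {B : ℝ}
    (hB : ∀ (z : Fin N → UnitAddCircle) (e : Fin N → Fin 4 → ℝ),
      (∀ j k, |e j k| ≤ 17 / 6 * (α / topDeg G * deg G j)) →
      (rowLaw N).real {η | (fun j => z j + quarter (η j) + (e j (η j) : UnitAddCircle)) ∈ E} ≤ B) :
    (dynProb N).real {p | traj G α p.1 p.2 t ∈ E} ≤ B := by
  cases t with
  | zero =>
    refine dynProb_le_of_shift (measurableSet_preimage (measurable_traj G α 0) hE) ?_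
    rintro ⟨ω, x⟩
    have := hB x (fun _ _ => 0) (fun j k => by simp only [abs_zero]; positivity)
    simpa [traj] using this
  | succ t =>
    refine dynProb_step_le G α t (measurableSet_preimage measurable_snd hE) fun y => ?_
    exact hB _ _ fun j k => abs_push_le G α hα y j k

end Step


/-! ### Hoeffding's inequality for one row of the noise -/

section Hoeffding

variable {N : ℕ}

lemma integral_uniform_fin_four {E : Type*} [NormedAddCommGroup E] [NormedSpace ℝ E]
    [CompleteSpace E] (f : Fin 4 → E) :
    ∫ k, f k ∂(PMF.uniformOfFintype (Fin 4)).toMeasure = (1 / 4 : ℝ) • ∑ k, f k := by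
  rw [PMF.integral_eq_sum, Finset.smul_sum]
  refine Finset.sum_congr rfl fun k _ => ?_
  simp

lemma integral_rowLaw_eval {E : Type*} [NormedAddCommGroup E] [NormedSpace ℝ E]
    [CompleteSpace E] (f : Fin 4 → E) (j : Fin N) :
    ∫ η, f (η j) ∂(rowLaw N) = (1 / 4 : ℝ) • ∑ k, f k := by
  rw [← integral_uniform_fin_four, rowLaw]
  exact integral_comp_eval (μ := fun _ : Fin N => (PMF.uniformOfFintype (Fin 4)).toMeasure)
    (AEStronglyMeasurable.of_discrete)

lemma rowLaw_sum_ge_le (J : Finset (Fin N)) (X : Fin N → Fin 4 → ℝ) {c : ℝ} (hc : 0 ≤ c)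
    (hX : ∀ j ∈ J, ∀ k, |X j k| ≤ c) {s : ℝ} (hs : 0 ≤ s) :
    (rowLaw N).real {η | s ≤ ∑ j ∈ J, (X j (η j) - 1 / 4 * ∑ k, X j k)} ≤
      Real.exp (-s ^ 2 / (2 * (J.card * c ^ 2))) := by
  have hind : iIndepFun (fun j η => X j (η j) - 1 / 4 * ∑ k, X j k) (rowLaw N) :=
    iIndepFun_pi (μ := fun _ : Fin N => (PMF.uniformOfFintype (Fin 4)).toMeasure)
      (X := fun j k' => X j k' - 1 / 4 * ∑ k, X j k) fun _ => AEMeasurable.of_discrete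
  have hsub : ∀ j ∈ J, HasSubgaussianMGF (fun η : Fin N → Fin 4 => X j (η j) - 1 / 4 * ∑ k, X j k)
      ((‖c - -c‖₊ / 2) ^ 2) (rowLaw N) := by
    intro j hj
    have h := hasSubgaussianMGF_of_mem_Icc (μ := rowLaw N) (X := fun η => X j (η j))
      (a := -c) (b := c) AEMeasurable.of_discrete
      (Eventually.of_forall fun η => abs_le.1 (hX j hj (η j)))
    rwa [integral_rowLaw_eval (fun k => X j k)] at h
  have h := HasSubgaussianMGF.measure_sum_ge_le_of_iIndepFun hind hsub hs
  have h2 : ((∑ _j ∈ J, (‖c - -c‖₊ / 2) ^ 2 : NNReal) : ℝ) = J.card * c ^ 2 := by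
    push_cast
    rw [Finset.sum_const, nsmul_eq_mul, Real.norm_eq_abs, abs_of_nonneg (by linarith)]
    ring
  rwa [h2] at h

lemma rowLaw_hoeffding (J : Finset (Fin N)) (X : Fin N → Fin 4 → ℝ) {c : ℝ} (hc : 0 ≤ c)
    (hX : ∀ j ∈ J, ∀ k, |X j k| ≤ c) {s : ℝ} (hs : 0 ≤ s) :
    (rowLaw N).real {η | s ≤ |∑ j ∈ J, (X j (η j) - 1 / 4 * ∑ k, X j k)|} ≤
      2 * Real.exp (-s ^ 2 / (2 * (J.card * c ^ 2))) := by
  have h1 := rowLaw_sum_ge_le J X hc hX hs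
  have h2 := rowLaw_sum_ge_le J (fun j k => - X j k) hc (by simpa using hX) hs
  calc _ ≤ (rowLaw N).real ({η | s ≤ ∑ j ∈ J, (X j (η j) - 1 / 4 * ∑ k, X j k)} ∪
        {η | s ≤ ∑ j ∈ J, (- X j (η j) - 1 / 4 * ∑ k, - X j k)}) := by
        refine measureReal_mono (fun η hη => ?_)
        have hη' : s ≤ |∑ j ∈ J, (X j (η j) - 1 / 4 * ∑ k, X j k)| := hη
        rcases le_abs'.1 hη' with h | h
        · right
          have e : ∑ j ∈ J, (- X j (η j) - 1 / 4 * ∑ k, - X j k) =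
              - ∑ j ∈ J, (X j (η j) - 1 / 4 * ∑ k, X j k) := by
            rw [← Finset.sum_neg_distrib]
            refine Finset.sum_congr rfl fun j _ => ?_
            rw [Finset.sum_neg_distrib]; ring
          change s ≤ _
          rw [e]; linarith
        · left; exact h
    _ ≤ _ := (measureReal_union_le _ _).trans (by linarith)

/-- Deviations of a sum of independent terms from `m_j`, when the means are within `r` of `m_j`. -/
lemma rowLaw_deviation (J : Finset (Fin N)) (X : Fin N → Fin 4 → ℝ) (m : Fin N → ℝ) {c r D : ℝ}
    (hc : 0 < c) (hr : 0 ≤ r) (hX : ∀ j ∈ J, ∀ k, |X j k| ≤ c) (hD : J.card ≤ D)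
    (hm : ∀ j ∈ J, |1 / 4 * ∑ k, X j k - m j| ≤ r) {s : ℝ} (hs : 0 < s) :
    (rowLaw N).real {η | s + D * r ≤ |∑ j ∈ J, (X j (η j) - m j)|} ≤
      2 * Real.exp (-s ^ 2 / (2 * (D * c ^ 2))) := by
  -- For empty J the Hoeffding exponent is a division by zero and cannot be compared with the one
  -- for D. The event itself is then empty because s > 0.
  by_cases hJ : J.Nonempty
  swap
  · rw [Finset.not_nonempty_iff_eq_empty] at hJ
    subst hJ
    have hD0 : 0 ≤ D := by simpa using hD
    simp only [Finset.sum_empty, abs_zero]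
    have : {η : Fin N → Fin 4 | s + D * r ≤ 0} = ∅ := by
      ext η
      simp only [Set.mem_ofPred_eq, Set.mem_empty_iff_false, iff_false, not_le]
      positivity
    rw [this, measureReal_empty]
    positivity
  have hJ0 : (0 : ℝ) < J.card := by exact_mod_cast hJ.card_pos
  have hexp : 2 * Real.exp (-s ^ 2 / (2 * (J.card * c ^ 2))) ≤
      2 * Real.exp (-s ^ 2 / (2 * (D * c ^ 2))) := by
    rw [neg_div, neg_div]
    gcongr
  refine le_trans (measureReal_mono fun η hη => ?_)
    ((rowLaw_hoeffding J X hc.le hX hs.le).trans hexp)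
  have h1 : |∑ j ∈ J, (1 / 4 * ∑ k, X j k - m j)| ≤ D * r := by
    refine (Finset.abs_sum_le_sum_abs _ _).trans ((Finset.sum_le_card_nsmul _ _ _ hm).trans ?_)
    rw [nsmul_eq_mul]
    gcongr
  have h2 : ∑ j ∈ J, (X j (η j) - m j) = ∑ j ∈ J, (X j (η j) - 1 / 4 * ∑ k, X j k) +
      ∑ j ∈ J, (1 / 4 * ∑ k, X j k - m j) := by
    rw [← Finset.sum_add_distrib]
    exact Finset.sum_congr rfl fun j _ => by ring
  have hη' : s + D * r ≤ |∑ j ∈ J, (X j (η j) - m j)| := hη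
  rw [h2] at hη'
  have h3 := abs_add_le (∑ j ∈ J, (X j (η j) - 1 / 4 * ∑ k, X j k))
    (∑ j ∈ J, (1 / 4 * ∑ k, X j k - m j))
  change s ≤ |_|
  linarith

end Hoeffding


/-! ### Frequency of visits to a conditionally rare set -/

section Frequency

variable {N : ℕ} (G : SimpleGraph (Fin N)) (α : ℝ)

/-- The number of visits of the trajectory to `B` before time `T`. -/
def visits (B : Set (Fin N → UnitAddCircle)) (T : ℕ)
    (p : Noise N × (Fin N → UnitAddCircle)) : ℝ :=
  ∑ t ∈ Finset.range T, B.indicator (fun _ => (1 : ℝ)) (traj G α p.1 p.2 t)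

lemma measurable_visits {B : Set (Fin N → UnitAddCircle)} (hB : MeasurableSet B) (T : ℕ) :
    Measurable (visits G α B T) := by
  unfold visits
  refine Finset.measurable_sum _ fun t _ => ?_
  exact Measurable.comp (f := fun p : Noise N × (Fin N → UnitAddCircle) => traj G α p.1 p.2 t)
    (measurable_const.indicator hB) (measurable_traj G α t)

/-- The expectation is 1 + (e^θ - 1) P(A), with e^θ - 1 ≤ θ + θ² and 1 + x ≤ e^x. -/
lemma lintegral_exp_indicator_le {A : Set (Fin N → Fin 4)} {p θ : ℝ} (hθ0 : 0 ≤ θ) (hθ1 : θ ≤ 1)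
    (hA : (rowLaw N).real A ≤ p) :
    ∫⁻ η, ENNReal.ofReal (Real.exp (θ * A.indicator (fun _ => (1 : ℝ)) η)) ∂(rowLaw N) ≤
      ENNReal.ofReal (Real.exp (p * (θ + θ ^ 2))) := by
  have hp : 0 ≤ p := measureReal_nonneg.trans hA
  have he : 1 ≤ Real.exp θ := Real.one_le_exp hθ0
  have h1 : ∀ η, ENNReal.ofReal (Real.exp (θ * A.indicator (fun _ => (1 : ℝ)) η)) =
      1 + A.indicator (fun _ => ENNReal.ofReal (Real.exp θ - 1)) η := by
    intro η
    by_cases h : η ∈ A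
    · rw [Set.indicator_of_mem h, Set.indicator_of_mem h, mul_one, ← ENNReal.ofReal_one,
        ← ENNReal.ofReal_add (by norm_num) (by linarith)]
      congr 1; ring
    · rw [Set.indicator_of_notMem h, Set.indicator_of_notMem h]; simp
  simp only [h1]
  rw [lintegral_add_left measurable_const, lintegral_indicator (MeasurableSet.of_discrete)]
  simp only [lintegral_const, measure_univ, mul_one, Measure.restrict_apply, MeasurableSet.univ,
    Set.univ_inter]
  rw [← ENNReal.ofReal_toReal (measure_ne_top (rowLaw N) A), ← ENNReal.ofReal_mul (by linarith),
    ← ENNReal.ofReal_one, ← ENNReal.ofReal_add (by norm_num)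
      (mul_nonneg (by linarith) ENNReal.toReal_nonneg)]
  refine ENNReal.ofReal_le_ofReal ?_
  have h2 := Real.abs_exp_sub_one_sub_id_le (x := θ) (by rw [abs_of_nonneg hθ0]; exact hθ1)
  have h3 : Real.exp θ - 1 ≤ θ + θ ^ 2 := by linarith [(abs_le.1 h2).2]
  calc 1 + (Real.exp θ - 1) * (rowLaw N).real A ≤ 1 + (θ + θ ^ 2) * p := by
        gcongr
    _ ≤ _ := by
        have := Real.add_one_le_exp (p * (θ + θ ^ 2))
        linarith

/-- The conditional bound is used once per step, as for a supermartingale. The visit at time 0 is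
not controlled by `hp` and costs the extra factor e^θ. -/
lemma lintegral_exp_visits_le {B : Set (Fin N → UnitAddCircle)} (hB : MeasurableSet B) {p θ : ℝ}
    (hθ0 : 0 ≤ θ) (hθ1 : θ ≤ 1) (hp : ∀ y, (rowLaw N).real {η | step G α η y ∈ B} ≤ p) (T : ℕ) :
    ∫⁻ q, ENNReal.ofReal (Real.exp (θ * visits G α B (T + 1) q)) ∂(dynProb N) ≤
      ENNReal.ofReal (Real.exp (θ + T * (p * (θ + θ ^ 2)))) := by
  induction T with
  | zero =>
    calc _ ≤ ∫⁻ _, ENNReal.ofReal (Real.exp θ) ∂(dynProb N) := by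
          refine lintegral_mono fun q => ENNReal.ofReal_le_ofReal (Real.exp_le_exp.2 ?_)
          simp only [visits, zero_add, Finset.range_one, Finset.sum_singleton]
          refine mul_le_of_le_one_right hθ0 ?_
          exact Set.indicator_le' (fun _ _ => le_rfl) (fun _ _ => zero_le_one) _
      _ ≤ _ := by simp
  | succ T ih =>
    have hm : Measurable fun q => ENNReal.ofReal (Real.exp (θ * visits G α B (T + 1 + 1) q)) := by
      have := measurable_visits G α hB (T + 1 + 1)
      fun_prop
    -- Among the times up to T + 1, row T affects only the state at T + 1. The earlier indicators
    -- therefore leave the inner integral.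
    rw [lintegral_dynProb_resample T hm]
    have hsplit : ∀ (q : Noise N × (Fin N → UnitAddCircle)) (η : Fin N → Fin 4),
        ENNReal.ofReal (Real.exp (θ * visits G α B (T + 1 + 1) (resample T q.1 η, q.2))) =
        ENNReal.ofReal (Real.exp (θ * visits G α B (T + 1) q)) *
          ENNReal.ofReal (Real.exp (θ * {η | step G α η (traj G α q.1 q.2 T) ∈ B}.indicator
            (fun _ => (1 : ℝ)) η)) := by
      intro q η
      rw [← ENNReal.ofReal_mul (Real.exp_pos _).le, ← Real.exp_add, ← mul_add]
      congr 4
      rw [visits, Finset.sum_range_succ, visits]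
      congr 1
      · refine Finset.sum_congr rfl fun t ht => ?_
        rw [traj_resample G α q.1 q.2 η (by simp at ht; omega)]
      · rw [traj_resample_succ]
        rfl
    simp only [hsplit]
    calc _ ≤ ∫⁻ q, ENNReal.ofReal (Real.exp (θ * visits G α B (T + 1) q)) *
          ENNReal.ofReal (Real.exp (p * (θ + θ ^ 2))) ∂(dynProb N) := by
          refine lintegral_mono fun q => ?_
          rw [lintegral_const_mul _ (Measurable.of_discrete)]
          gcongr
          exact lintegral_exp_indicator_le hθ0 hθ1 (hp _)
      _ ≤ ENNReal.ofReal (Real.exp (θ + T * (p * (θ + θ ^ 2)))) *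
          ENNReal.ofReal (Real.exp (p * (θ + θ ^ 2))) := by
          rw [lintegral_mul_const']
          · gcongr
          · exact ENNReal.ofReal_ne_top
      _ = _ := by
          rw [← ENNReal.ofReal_mul (Real.exp_pos _).le, ← Real.exp_add]
          congr 2
          push_cast; ring

/-- If the conditional probability to visit `B` at the next step is at most `p`, then almost surely
the frequency of visits is asymptotically at most `p`. -/
lemma ae_eventually_visits_le {B : Set (Fin N → UnitAddCircle)} (hB : MeasurableSet B) {p ρ : ℝ}
    (hp1 : p ≤ 1) (hρ0 : 0 < ρ) (hρ1 : ρ ≤ 1)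
    (hp : ∀ y, (rowLaw N).real {η | step G α η y ∈ B} ≤ p) :
    ∀ᵐ q ∂(dynProb N), ∀ᶠ T : ℕ in atTop, visits G α B T q ≤ (p + ρ) * T := by
  have hp0 : 0 ≤ p := measureReal_nonneg.trans (hp fun _ => 0)
  have hbound : ∀ T : ℕ, dynProb N {q | (p + ρ) * ((T + 1 : ℕ) : ℝ) < visits G α B (T + 1) q} ≤
      ENNReal.ofReal (Real.exp 1 * Real.exp (-ρ ^ 2 / 4) ^ T) := by
    intro T
    -- With p ≤ 1 the exponent after Markov's inequality is at most 1 + T(θ² - θρ), and this choice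
    -- of θ makes it 1 - Tρ²/4, which is summable in T.
    set θ := ρ / 2 with hθ
    have hm := lintegral_exp_visits_le G α hB (θ := θ) (by linarith) (by linarith) hp T
    set K := Real.exp (θ * ((p + ρ) * ((T + 1 : ℕ) : ℝ))) with hK
    have hKpos : 0 < K := Real.exp_pos _
    have hmk := mul_meas_ge_le_lintegral (μ := dynProb N)
      (f := fun q => ENNReal.ofReal (Real.exp (θ * visits G α B (T + 1) q)))
      (by have := measurable_visits G α hB (T + 1); fun_prop) (ENNReal.ofReal K)
    have hsub : {q | (p + ρ) * ((T + 1 : ℕ) : ℝ) < visits G α B (T + 1) q} ⊆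
        {q | ENNReal.ofReal K ≤ ENNReal.ofReal (Real.exp (θ * visits G α B (T + 1) q))} := by
      intro q hq
      refine ENNReal.ofReal_le_ofReal (Real.exp_le_exp.2 ?_)
      have hq' : (p + ρ) * ((T + 1 : ℕ) : ℝ) < visits G α B (T + 1) q := hq
      have : 0 ≤ θ := by linarith
      gcongr
    have h1 : dynProb N {q | (p + ρ) * ((T + 1 : ℕ) : ℝ) < visits G α B (T + 1) q} ≤
        ENNReal.ofReal (Real.exp (θ + T * (p * (θ + θ ^ 2)))) / ENNReal.ofReal K := by
      rw [ENNReal.le_div_iff_mul_le (Or.inl (by simpa using hKpos))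
        (Or.inl ENNReal.ofReal_ne_top), mul_comm]
      exact (mul_le_mul_right (measure_mono hsub) _).trans (hmk.trans hm)
    refine h1.trans ?_
    rw [← ENNReal.ofReal_div_of_pos hKpos]
    refine ENNReal.ofReal_le_ofReal ?_
    rw [hK, ← Real.exp_sub, ← Real.exp_nat_mul, ← Real.exp_add]
    refine Real.exp_le_exp.2 ?_
    push_cast
    have hT : (0 : ℝ) ≤ T := by positivity
    have e1 : (T : ℝ) * (p * ((ρ / 2) ^ 2)) ≤ T * (1 * (ρ / 2) ^ 2) := by gcongr
    have e2 : 0 ≤ ρ / 2 * (p + ρ) := by positivity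
    rw [hθ]
    nlinarith
  have hsum : ∑' T : ℕ, dynProb N {q | (p + ρ) * ((T + 1 : ℕ) : ℝ) < visits G α B (T + 1) q} ≠
      ⊤ := by
    refine ne_top_of_le_ne_top ?_ (ENNReal.tsum_le_tsum hbound)
    have hr : Real.exp (-ρ ^ 2 / 4) < 1 := by
      rw [Real.exp_lt_one_iff]
      have : 0 < ρ ^ 2 := by positivity
      linarith
    have hs : Summable fun T : ℕ => Real.exp 1 * Real.exp (-ρ ^ 2 / 4) ^ T :=
      (summable_geometric_of_lt_one (Real.exp_pos _).le hr).mul_left _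
    exact hs.tsum_ofReal_ne_top
  -- Borel–Cantelli.
  filter_upwards [ae_eventually_notMem hsum] with q hq
  obtain ⟨T₀, hT₀⟩ := eventually_atTop.1 hq
  filter_upwards [eventually_ge_atTop (T₀ + 1)] with T hT
  obtain ⟨T, rfl⟩ : ∃ T', T = T' + 1 := ⟨T - 1, by omega⟩
  exact not_lt.1 (hT₀ T (by omega))

end Frequency

/-! ### Time averages of the fluctuation -/

section TimeAverage

variable {N : ℕ} (G : SimpleGraph (Fin N))

lemma deg_lt_of_mem_lowNbrs {δ : ℝ} {i j : Fin N} (hj : j ∈ lowNbrs G δ i) :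
    (deg G j : ℝ) < δ := by
  simp only [lowNbrs, Finset.mem_filter] at hj
  exact hj.2

lemma starIndex_nonneg (Δ δ : ℝ) : 0 ≤ starIndex G Δ δ := by
  rw [starIndex]
  split_ifs with h
  · refine Finset.le_inf' _ _ fun i _ => ?_
    rw [nodeIndex]
    positivity
  · exact zero_le_one

/-- The interaction of the low degree neighbours with hub `i`. -/
def lowSum (δ : ℝ) (i : Fin N) (y : Fin N → UnitAddCircle) : ℝ :=
  ∑ j ∈ lowNbrs G δ i, sinC (y j)

lemma continuous_lowSum (δ : ℝ) (i : Fin N) : Continuous (lowSum G δ i) := by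
  have := continuous_sinC
  unfold lowSum
  fun_prop

/-- Without displacements all terms are centred. A displacement moves each mean by at most 2π times
its size, and over at most Δ₀ neighbours of degree below δ this adds up to 17/3 παδ. -/
lemma rowLaw_abs_lowSum_ge_le {δ α Δ : ℝ} (hα : 0 < α) (hδ : 0 < δ) (hΔ : 0 < Δ) {i : Fin N}
    (hi : i ∈ hubs G Δ) (z : Fin N → UnitAddCircle) (e : Fin N → Fin 4 → ℝ)
    (he : ∀ j k, |e j k| ≤ 17 / 6 * (α / topDeg G * deg G j)) {s : ℝ} (hs : 0 < s) :
    (rowLaw N).real {η | s + 17 / 3 * Real.pi * α * δ ≤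
      |lowSum G δ i fun j => z j + quarter (η j) + (e j (η j) : UnitAddCircle)|} ≤
      2 * Real.exp (-s ^ 2 / (2 * topDeg G)) := by
  have hD : (0 : ℝ) < topDeg G := hΔ.trans (lt_topDeg_of_mem_hubs G hi)
  have h := rowLaw_deviation (lowNbrs G δ i)
    (fun j k => sinC (z j + quarter k + (e j k : UnitAddCircle))) (fun _ => 0) (c := 1)
    (r := 2 * Real.pi * (17 / 6 * (α / topDeg G * δ))) one_pos (by positivity)
    (fun j _ k => abs_sinC_le_one _) (card_lowNbrs_le G δ i) ?_ hs
  · have e1 : (topDeg G : ℝ) * (2 * Real.pi * (17 / 6 * (α / topDeg G * δ))) =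
        17 / 3 * Real.pi * α * δ := by field_simp; ring
    simpa only [e1, sub_zero, one_pow, mul_one, lowSum] using h
  · intro j hj
    have hdeg := (deg_lt_of_mem_lowNbrs G hj).le
    have hb : ∀ k, |e j k| ≤ 17 / 6 * (α / topDeg G * δ) := fun k =>
      (he j k).trans (by gcongr)
    have h0 := sum_sinC_add_quarter (z j)
    have h1 : ∑ k, sinC (z j + quarter k + (e j k : UnitAddCircle)) =
        ∑ k, (sinC (z j + quarter k + (e j k : UnitAddCircle)) - sinC (z j + quarter k)) := by
      rw [Finset.sum_sub_distrib, h0, sub_zero]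
    have h2 : |∑ k, (sinC (z j + quarter k + (e j k : UnitAddCircle)) -
        sinC (z j + quarter k))| ≤ 4 * (2 * Real.pi * (17 / 6 * (α / topDeg G * δ))) := by
      refine (Finset.abs_sum_le_sum_abs _ _).trans
        ((Finset.sum_le_card_nsmul _ _ (2 * Real.pi * (17 / 6 * (α / topDeg G * δ)))
          fun k _ => ?_).trans_eq ?_)
      · refine (abs_sinC_add_sub_le _ _).trans ?_
        have := Real.pi_pos
        gcongr
        exact hb k
      · simp
    rw [h1, sub_zero, abs_mul, abs_of_pos (by norm_num : (0 : ℝ) < 1 / 4)]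
    linarith

lemma rowLaw_iUnion_hubs_le {Δ B : ℝ} (g : Fin N → Set (Fin N → Fin 4))
    (h : ∀ i ∈ hubs G Δ, (rowLaw N).real (g i) ≤ B) :
    (rowLaw N).real {η | ∃ i ∈ hubs G Δ, η ∈ g i} ≤ (hubs G Δ).card * B := by
  have : {η | ∃ i ∈ hubs G Δ, η ∈ g i} = ⋃ i ∈ hubs G Δ, g i := by ext; simp
  rw [this, ← nsmul_eq_mul]
  exact (measureReal_biUnion_finset_le _ _).trans (Finset.sum_le_card_nsmul _ _ _ h)

/-- The fraction of time during which all hubs have fluctuation at most `ε`. -/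
lemma ae_le_liminf_frequency {δ α Δ C ε : ℝ} (hα : 0 < α) (hδ : 0 < δ) (hΔ : 0 < Δ) (hC : 6 ≤ C)
    (h1 : 17 / 2 * α * (1 - starIndex G Δ δ) ≤ ε) (h2 : 34 * Real.pi * α ^ 2 * δ / Δ ≤ ε)
    (h3 : C * α * √(Real.log ((hubs G Δ).card + 1) / Δ) ≤ ε) :
    ∀ᵐ p ∂(dynProb N), 1 - Real.exp (-(starIndex G Δ δ * Δ * ε ^ 2 / (19 * α ^ 2))) ≤
      liminf (fun T : ℕ => (1 / (T : ℝ)) * ∑ t ∈ Finset.range T,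
        Set.indicator {s : ℕ | ∀ i ∈ hubs G Δ, |fluct G δ α p.1 p.2 i s| ≤ ε}
          (fun _ => (1 : ℝ)) t) atTop := by
  have hπ := Real.pi_pos
  have hε : 0 < ε := lt_of_lt_of_le (by positivity) h2
  set P := Real.exp (-(starIndex G Δ δ * Δ * ε ^ 2 / (19 * α ^ 2))) with hP
  set M : ℝ := ((hubs G Δ).card : ℝ) with hM
  -- By `h1` the high degree neighbours use at most ε/3, so the low degree part must exceed 2ε/3 at
  -- a bad time. B depends on the state alone, as the visit count requires.
  set B : Set (Fin N → UnitAddCircle) :=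
    {y | ∃ i ∈ hubs G Δ, 2 / 3 * ε * topDeg G / α ≤ |lowSum G δ i y|} with hBdef
  have hBm : MeasurableSet B := by
    have : B = ⋃ i ∈ hubs G Δ, {y | 2 / 3 * ε * topDeg G / α ≤ |lowSum G δ i y|} := by
      ext; simp [hBdef]
    rw [this]
    refine Finset.measurableSet_biUnion _ fun i _ => ?_
    exact measurableSet_le measurable_const (continuous_lowSum G δ i).abs.measurable
  -- Of the 2ε/3, the bias takes at most ε/6 by `h2`. A deviation ε/2 is left for Hoeffding, with
  -- exponent Δ₀ε²/(8α²).
  have hstep : ∀ y, (rowLaw N).real {η | step G α η y ∈ B} ≤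
      M * (2 * Real.exp (-(Δ * ε ^ 2 / (8 * α ^ 2)))) := by
    intro y
    refine rowLaw_iUnion_hubs_le G
      (fun i => {η | 2 / 3 * ε * topDeg G / α ≤ |lowSum G δ i (step G α η y)|}) fun i hi => ?_
    have hD : Δ < topDeg G := lt_topDeg_of_mem_hubs G hi
    have hD0 : (0 : ℝ) < topDeg G := hΔ.trans hD
    have h := rowLaw_abs_lowSum_ge_le G hα hδ hΔ hi (fun j => nodeMap 0 (y j)) (push G α y)
      (fun j k => abs_push_le G α hα y j k) (s := ε / 2 * topDeg G / α) (by positivity)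
    refine (measureReal_mono ?_).trans (h.trans ?_)
    · intro η hη
      have hη' : 2 / 3 * ε * topDeg G / α ≤ |lowSum G δ i (step G α η y)| := hη
      refine le_trans ?_ hη'
      have h2' : 34 * Real.pi * α ^ 2 * δ ≤ ε * topDeg G := by
        rw [div_le_iff₀ hΔ] at h2
        exact h2.trans (by gcongr)
      have : 17 / 3 * Real.pi * α * δ ≤ ε * topDeg G / 6 / α := by
        rw [le_div_iff₀ hα]; linarith
      calc _ ≤ ε / 2 * topDeg G / α + ε * topDeg G / 6 / α := by linarith
        _ = _ := by ring
    · have : Δ * ε ^ 2 / (8 * α ^ 2) ≤ (ε / 2 * topDeg G / α) ^ 2 / (2 * topDeg G) := by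
        calc _ ≤ topDeg G * ε ^ 2 / (8 * α ^ 2) := by gcongr
          _ = _ := by field_simp; ring
      rw [neg_div]
      gcongr
  -- The union over hubs is absorbed as follows. Put X = Δε²/α². Then C ≥ 6 gives 36 log(M+1) ≤ X,
  -- hence 2M ≤ (M+1)² ≤ e^(X/18). Finally 1/8 - 1/18 ≥ 1/19 and ν ≤ 1.
  have hPle : M * (2 * Real.exp (-(Δ * ε ^ 2 / (8 * α ^ 2)))) ≤ P := by
    by_cases hM0 : M = 0
    · rw [hM0, zero_mul]; exact (Real.exp_pos _).le
    have hM1 : 1 ≤ M := by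
      rw [hM] at hM0 ⊢
      exact_mod_cast Nat.one_le_iff_ne_zero.2 (by exact_mod_cast hM0)
    have hlog : 0 ≤ Real.log (M + 1) := Real.log_nonneg (by linarith)
    have h3' : 36 * Real.log (M + 1) ≤ Δ * ε ^ 2 / α ^ 2 := by
      have h6 : 6 * α * √(Real.log (M + 1) / Δ) ≤ ε := le_trans (by gcongr) h3
      have h7 : (6 * α * √(Real.log (M + 1) / Δ)) ^ 2 ≤ ε ^ 2 := by gcongr
      rw [mul_pow, Real.sq_sqrt (by positivity)] at h7
      rw [le_div_iff₀ (by positivity)]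
      calc 36 * Real.log (M + 1) * α ^ 2 =
          Δ * ((6 * α) ^ 2 * (Real.log (M + 1) / Δ)) := by field_simp; ring
        _ ≤ _ := by gcongr
    have h2M : 2 * M ≤ Real.exp (2 * Real.log (M + 1)) := by
      rw [mul_comm 2 (Real.log _), Real.exp_mul, Real.exp_log (by linarith)]
      norm_num
      nlinarith
    calc M * (2 * Real.exp (-(Δ * ε ^ 2 / (8 * α ^ 2)))) =
        (2 * M) * Real.exp (-(Δ * ε ^ 2 / (8 * α ^ 2))) := by ring
      _ ≤ Real.exp (2 * Real.log (M + 1)) * Real.exp (-(Δ * ε ^ 2 / (8 * α ^ 2))) := by gcongr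
      _ = Real.exp (2 * Real.log (M + 1) - Δ * ε ^ 2 / (8 * α ^ 2)) := by
          rw [← Real.exp_add]; rfl
      _ ≤ P := by
          refine Real.exp_le_exp.2 ?_
          have hν := starIndex_le_one G Δ δ
          have hX : 0 ≤ Δ * ε ^ 2 / α ^ 2 := by positivity
          have e1 : starIndex G Δ δ * Δ * ε ^ 2 / (19 * α ^ 2) ≤ (Δ * ε ^ 2 / α ^ 2) / 19 := by
            rw [show starIndex G Δ δ * Δ * ε ^ 2 / (19 * α ^ 2) =
              starIndex G Δ δ * ((Δ * ε ^ 2 / α ^ 2) / 19) by field_simp]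
            exact mul_le_of_le_one_left (by positivity) hν
          have e2 : Δ * ε ^ 2 / (8 * α ^ 2) = (Δ * ε ^ 2 / α ^ 2) / 8 := by field_simp
          rw [e2]
          linarith
  have hP1 : P ≤ 1 := by
    rw [hP, Real.exp_le_one_iff, neg_nonpos]
    have := starIndex_nonneg G Δ δ
    positivity
  have hae : ∀ᵐ q ∂(dynProb N), ∀ n : ℕ, ∀ᶠ T : ℕ in atTop,
      visits G α B T q ≤ (P + 1 / ((n : ℝ) + 1)) * T := by
    rw [ae_all_iff]
    intro n
    have hn : (0 : ℝ) < (n : ℝ) + 1 := by positivity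
    refine ae_eventually_visits_le G α hBm hP1 (by positivity) ?_
      fun y => (hstep y).trans hPle
    rw [div_le_one hn]; linarith [(Nat.cast_nonneg n : (0 : ℝ) ≤ n)]
  filter_upwards [hae] with q hq
  set u : ℕ → ℝ := fun T => (1 / (T : ℝ)) * ∑ t ∈ Finset.range T,
        Set.indicator {s : ℕ | ∀ i ∈ hubs G Δ, |fluct G δ α q.1 q.2 i s| ≤ ε}
          (fun _ => (1 : ℝ)) t with hu
  have hind : ∀ t, 1 - B.indicator (fun _ => (1 : ℝ)) (traj G α q.1 q.2 t) ≤
      Set.indicator {s : ℕ | ∀ i ∈ hubs G Δ, |fluct G δ α q.1 q.2 i s| ≤ ε}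
          (fun _ => (1 : ℝ)) t := by
    intro t
    by_cases hb : traj G α q.1 q.2 t ∈ B
    · rw [Set.indicator_of_mem hb, sub_self]
      exact Set.indicator_nonneg (fun _ _ => zero_le_one) _
    · rw [Set.indicator_of_notMem hb, Set.indicator_of_mem, sub_zero]
      intro i hi
      have hD0 : (0 : ℝ) < topDeg G := hΔ.trans (lt_topDeg_of_mem_hubs G hi)
      have hlow : |lowSum G δ i (traj G α q.1 q.2 t)| < 2 / 3 * ε * topDeg G / α := by
        by_contra hcon
        exact hb ⟨i, hi, not_lt.1 hcon⟩
      have hf := abs_fluct_sub_le G (δ := δ) hα hΔ q.1 q.2 hi t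
      have hl : |α / topDeg G * lowSum G δ i (traj G α q.1 q.2 t)| ≤ 2 / 3 * ε := by
        rw [abs_mul, abs_of_pos (by positivity)]
        calc _ ≤ α / topDeg G * (2 / 3 * ε * topDeg G / α) := by gcongr
          _ = _ := by field_simp
      have := abs_sub_abs_le_abs_sub (fluct G δ α q.1 q.2 i t)
        (α / topDeg G * lowSum G δ i (traj G α q.1 q.2 t))
      have hf' : |fluct G δ α q.1 q.2 i t - α / topDeg G * lowSum G δ i (traj G α q.1 q.2 t)| ≤
        17 / 6 * α * (1 - starIndex G Δ δ) := hf
      linarith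
  -- The upper bound supplies the coboundedness without which the real `liminf` could not be bounded
  -- from below.
  have hle1 : ∀ T, u T ≤ 1 := by
    intro T
    simp only [hu]
    rcases Nat.eq_zero_or_pos T with rfl | hT
    · simp
    have hT' : (0 : ℝ) < T := by exact_mod_cast hT
    rw [one_div, inv_mul_le_iff₀ hT', mul_one]
    calc _ ≤ ∑ t ∈ Finset.range T, (1 : ℝ) := Finset.sum_le_sum fun t _ =>
          Set.indicator_le' (fun _ _ => le_rfl) (fun _ _ => zero_le_one) _
      _ = T := by simp
  refine le_of_forall_pos_le_add fun ρ hρ => ?_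
  obtain ⟨n, hn⟩ := exists_nat_one_div_lt hρ
  rw [← sub_le_iff_le_add]
  refine le_liminf_of_le ?_ ?_
  · exact (isBoundedUnder_of ⟨1, hle1⟩).isCoboundedUnder_ge
  filter_upwards [hq n, eventually_gt_atTop 0] with T hT hT0
  have hT' : (0 : ℝ) < T := by exact_mod_cast hT0
  simp only [hu]
  rw [one_div, ← div_eq_inv_mul, le_div_iff₀ hT']
  have hs := Finset.sum_le_sum fun t (_ : t ∈ Finset.range T) => hind t
  rw [Finset.sum_sub_distrib] at hs
  simp only [Finset.sum_const, Finset.card_range, nsmul_eq_mul, mul_one] at hs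
  rw [visits] at hT
  nlinarith

end TimeAverage


/-! ### The distribution function of a centred Gaussian law -/

section GaussianCdf

lemma integral_cos_mul_exp_neg_sq {v : ℝ} (hv : 0 < v) (x : ℝ) :
    ∫ t : ℝ, Real.cos (t * x) * Real.exp (-(v / 2) * t ^ 2) =
      √(2 * Real.pi / v) * Real.exp (-x ^ 2 / (2 * v)) := by
  have h := fourierIntegral_gaussian (b := ((v / 2 : ℝ) : ℂ)) (by simpa using hv) (x : ℂ)
  have h1 : ∀ t : ℝ, Complex.exp (Complex.I * x * t) * Complex.exp (-((v / 2 : ℝ) : ℂ) * t ^ 2) =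
      ((Real.exp (-(v / 2) * t ^ 2) : ℝ) : ℂ) * Complex.exp ((t * x : ℝ) * Complex.I) := by
    intro t
    push_cast
    rw [mul_comm]
    congr 2
    ring
  simp only [h1] at h
  have hint : Integrable fun t : ℝ =>
      ((Real.exp (-(v / 2) * t ^ 2) : ℝ) : ℂ) * Complex.exp ((t * x : ℝ) * Complex.I) := by
    have h0 := (integrable_exp_neg_mul_sq (b := v / 2) (by positivity)).ofReal (𝕜 := ℂ)
    refine Integrable.mul_of_top_left h0 ?_
    refine memLp_top_of_bound (by fun_prop) 1 (Eventually.of_forall fun t => ?_)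
    rw [Complex.norm_exp_ofReal_mul_I]
  have h2 := congrArg Complex.re h
  have h3 : (∫ t : ℝ, ((Real.exp (-(v / 2) * t ^ 2) : ℝ) : ℂ) *
      Complex.exp ((t * x : ℝ) * Complex.I)).re =
      ∫ t : ℝ, Real.cos (t * x) * Real.exp (-(v / 2) * t ^ 2) := by
    have := integral_re hint
    simp only [RCLike.re_to_complex] at this
    rw [← this]
    congr 1
    funext t
    rw [Complex.re_ofReal_mul, Complex.exp_ofReal_mul_I_re, mul_comm]
  rw [h3] at h2
  rw [h2]
  have h4 : ((Real.pi : ℂ) / ((v / 2 : ℝ) : ℂ)) ^ (1 / 2 : ℂ) *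
      Complex.exp (-(x : ℂ) ^ 2 / (4 * ((v / 2 : ℝ) : ℂ))) =
      ((√(2 * Real.pi / v) * Real.exp (-x ^ 2 / (2 * v)) : ℝ) : ℂ) := by
    rw [Real.sqrt_eq_rpow, Complex.ofReal_mul, Complex.ofReal_cpow (by positivity)]
    push_cast
    congr 2
    · field_simp
    · congr 1
      have : (v : ℂ) ≠ 0 := by exact_mod_cast hv.ne'
      field_simp
      norm_num
  rw [h4, Complex.ofReal_re]

lemma intervalIntegral_cos_mul (t u : ℝ) :
    ∫ x in (0 : ℝ)..u, Real.cos (t * x) = u * Real.sinc (t * u) := by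
  by_cases ht : t = 0
  · simp [ht]
  by_cases hu : u = 0
  · simp [hu]
  rw [intervalIntegral.integral_comp_mul_left _ ht, integral_cos, Real.sinc_of_ne_zero
    (mul_ne_zero ht hu)]
  simp
  field_simp

lemma gaussianReal_real_Iic_zero {v : NNReal} (hv : v ≠ 0) :
    (gaussianReal 0 v).real (Set.Iic 0) = 1 / 2 := by
  have hat := nullSingletonClass_gaussianReal (μ := 0) hv
  have h1 : (gaussianReal 0 v).real (Set.Iic 0) = (gaussianReal 0 v).real (Set.Ici 0) := by
    have : gaussianReal 0 v = (gaussianReal 0 v).map (fun x => -x) := by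
      rw [gaussianReal_map_neg, neg_zero]
    conv_lhs => rw [this]
    rw [map_measureReal_apply measurable_neg measurableSet_Iic]
    congr 1
    ext x; simp
  have h2 : (gaussianReal 0 v).real (Set.Ici 0) = (gaussianReal 0 v).real (Set.Ioi 0) := by
    rw [Measure.real, Measure.real, measure_congr Ioi_ae_eq_Ici]
  have h3 : (gaussianReal 0 v).real (Set.Iic 0)ᶜ = 1 - (gaussianReal 0 v).real (Set.Iic 0) :=
    probReal_compl_eq_one_sub measurableSet_Iic
  rw [Set.compl_Iic, ← h2, ← h1] at h3
  linarith

/-- Fourier inversion: the density is written as the integral of its characteristic function and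
integrated from 0 to u, and the two integrals are exchanged. Starting at 0, where symmetry gives the
value 1/2, leaves a kernel u sinc(tu) without singularity at t = 0. -/
lemma gaussianReal_real_Iic {v : NNReal} (hv : v ≠ 0) (u : ℝ) :
    (gaussianReal 0 v).real (Set.Iic u) = 1 / 2 + 1 / (2 * Real.pi) *
      ∫ t : ℝ, u * Real.sinc (t * u) * Real.exp (-((v : ℝ) / 2) * t ^ 2) := by
  have hv0 : (0 : ℝ) < v := by positivity
  have hpdf : ∀ x, gaussianPDFReal 0 v x = 1 / (2 * Real.pi) *
      ∫ t : ℝ, Real.cos (t * x) * Real.exp (-((v : ℝ) / 2) * t ^ 2) := by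
    intro x
    rw [integral_cos_mul_exp_neg_sq hv0, gaussianPDFReal, ← mul_assoc, sub_zero]
    congr 1
    have hp := Real.pi_pos
    rw [Real.sqrt_div (by positivity), Real.sqrt_mul (by positivity) (v : ℝ)]
    have h1 : √(2 * Real.pi) * √(2 * Real.pi) = 2 * Real.pi := Real.mul_self_sqrt (by positivity)
    have h2 : 0 < √(2 * Real.pi) := by positivity
    have h3 : 0 < √(v : ℝ) := by positivity
    field_simp
    linarith
  have happ : ∀ s : Set ℝ, (gaussianReal 0 v).real s = ∫ x in s, gaussianPDFReal 0 v x := by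
    intro s
    rw [Measure.real, gaussianReal_apply_eq_integral 0 hv, ENNReal.toReal_ofReal]
    exact integral_nonneg fun x => gaussianPDFReal_nonneg 0 v x
  have hint := integrable_gaussianPDFReal 0 v
  have hsub := intervalIntegral.integral_Iic_sub_Iic (a := 0) (b := u)
    hint.integrableOn hint.integrableOn
  rw [← happ, ← happ, gaussianReal_real_Iic_zero hv] at hsub
  have hsw : ∫ x in (0 : ℝ)..u, gaussianPDFReal 0 v x = 1 / (2 * Real.pi) *
      ∫ t : ℝ, u * Real.sinc (t * u) * Real.exp (-((v : ℝ) / 2) * t ^ 2) := by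
    simp only [hpdf]
    rw [intervalIntegral.integral_const_mul, intervalIntegral_integral_swap]
    · congr 2
      funext t
      rw [intervalIntegral.integral_mul_const, intervalIntegral_cos_mul]
    · have : IsFiniteMeasure (volume.restrict (Set.uIoc 0 u)) := by
        unfold Set.uIoc; infer_instance
      have h0 : Integrable (fun p : ℝ × ℝ => (1 : ℝ) * Real.exp (-((v : ℝ) / 2) * p.2 ^ 2))
          ((volume.restrict (Set.uIoc 0 u)).prod volume) :=
        Integrable.mul_prod (f := fun _ : ℝ => (1 : ℝ)) (integrable_const _)
          (integrable_exp_neg_mul_sq (b := (v : ℝ) / 2) (by positivity))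
      refine h0.mono' (by unfold Function.uncurry; fun_prop) (Eventually.of_forall fun p => ?_)
      simp only [Function.uncurry]
      rw [norm_mul, Real.norm_eq_abs, Real.norm_eq_abs, Real.abs_exp]
      gcongr
      exact Real.abs_cos_le_one _
  linarith

lemma gaussianReal_real_Iic_neg_le {v : NNReal} (hv : v ≠ 0) {a : ℝ} (ha : 0 ≤ a) :
    (gaussianReal 0 v).real (Set.Iic (-a)) ≤ Real.exp (-a ^ 2 / (2 * v)) := by
  have hv0 : (0 : ℝ) < v := by positivity
  -- The parameter -a/v minimises the Chernoff bound.
  have h := measure_le_le_exp_mul_mgf (μ := gaussianReal 0 v) (X := id) (t := -(a / v)) (-a)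
    (by rw [neg_nonpos]; positivity) (integrable_exp_mul_gaussianReal _)
  rw [mgf_id_gaussianReal] at h
  refine (le_of_eq rfl).trans (h.trans_eq ?_)
  simp only
  rw [← Real.exp_add]
  congr 1
  field_simp
  ring

lemma gaussianReal_real_Ici_le {v : NNReal} (hv : v ≠ 0) {a : ℝ} (ha : 0 ≤ a) :
    (gaussianReal 0 v).real (Set.Ici a) ≤ Real.exp (-a ^ 2 / (2 * v)) := by
  refine le_trans (le_of_eq ?_) (gaussianReal_real_Iic_neg_le hv ha)
  have : gaussianReal 0 v = (gaussianReal 0 v).map (fun x => -x) := by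
    rw [gaussianReal_map_neg, neg_zero]
  conv_rhs => rw [this]
  rw [map_measureReal_apply measurable_neg measurableSet_Iic]
  congr 1
  ext x; simp

/-- Adding an independent Gaussian of variance `v₂` moves the distribution function little. -/
lemma gaussianReal_add_real_Iic {v₁ v₂ : NNReal} (h2 : v₂ ≠ 0) {a : ℝ} (ha : 0 ≤ a) (u : ℝ) :
    (gaussianReal 0 (v₁ + v₂)).real (Set.Iic u) ≤
        (gaussianReal 0 v₁).real (Set.Iic (u + a)) + Real.exp (-a ^ 2 / (2 * v₂)) ∧
      (gaussianReal 0 v₁).real (Set.Iic (u - a)) ≤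
        (gaussianReal 0 (v₁ + v₂)).real (Set.Iic u) + Real.exp (-a ^ 2 / (2 * v₂)) := by
  have hconv : gaussianReal 0 (v₁ + v₂) =
      ((gaussianReal 0 v₁).prod (gaussianReal 0 v₂)).map (fun p => p.1 + p.2) := by
    have := gaussianReal_conv_gaussianReal (m₁ := 0) (m₂ := 0) (v₁ := v₁) (v₂ := v₂)
    rw [add_zero] at this
    rw [← this]
    rfl
  have hm : Measurable fun p : ℝ × ℝ => p.1 + p.2 := by fun_prop
  have hfst : ∀ s, ((gaussianReal 0 v₁).prod (gaussianReal 0 v₂)).real (s ×ˢ Set.univ) =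
      (gaussianReal 0 v₁).real s := by
    intro s; rw [measureReal_prod_prod]; simp
  have hsnd : ∀ s, ((gaussianReal 0 v₁).prod (gaussianReal 0 v₂)).real (Set.univ ×ˢ s) =
      (gaussianReal 0 v₂).real s := by
    intro s; rw [measureReal_prod_prod]; simp
  rw [hconv, map_measureReal_apply hm measurableSet_Iic]
  constructor
  · refine le_trans (measureReal_mono (s₂ := (Set.Iic (u + a)) ×ˢ Set.univ ∪
      Set.univ ×ˢ (Set.Iic (-a))) ?_) ((measureReal_union_le _ _).trans ?_)
    · rintro ⟨x, y⟩ hxy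
      simp only [Set.mem_preimage, Set.mem_Iic] at hxy
      simp only [Set.mem_union, Set.mem_prod, Set.mem_Iic, Set.mem_univ, and_true, true_and]
      by_contra hcon
      push Not at hcon
      linarith [hcon.1, hcon.2]
    · rw [hfst, hsnd]
      gcongr
      exact gaussianReal_real_Iic_neg_le h2 ha
  · rw [← hfst]
    refine le_trans (measureReal_mono (s₂ := ((fun p : ℝ × ℝ => p.1 + p.2) ⁻¹' Set.Iic u) ∪
      Set.univ ×ˢ (Set.Ici a)) ?_) ((measureReal_union_le _ _).trans ?_)
    · rintro ⟨x, y⟩ hxy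
      simp only [Set.mem_prod, Set.mem_Iic, Set.mem_univ, and_true] at hxy
      simp only [Set.mem_union, Set.mem_prod, Set.mem_preimage, Set.mem_Iic, Set.mem_Ici,
        Set.mem_univ, true_and]
      by_contra hcon
      push Not at hcon
      linarith [hcon.1, hcon.2]
    · rw [hsnd]
      gcongr
      exact gaussianReal_real_Ici_le h2 ha

lemma integrable_abs_pow_three_mul_exp {b : ℝ} (hb : 0 < b) :
    Integrable fun t : ℝ => |t| ^ 3 * Real.exp (-b * t ^ 2) := by
  have h := (integrable_rpow_mul_exp_neg_mul_sq hb (s := 3) (by norm_num)).norm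
  refine h.congr (Eventually.of_forall fun t => ?_)
  simp only [norm_mul, Real.norm_eq_abs, Real.abs_exp]
  rw [show (3 : ℝ) = ((3 : ℕ) : ℝ) by norm_num, Real.rpow_natCast, abs_pow]

lemma integral_abs_pow_three_mul_exp {b : ℝ} (hb : 0 < b) :
    ∫ t : ℝ, |t| ^ 3 * Real.exp (-b * t ^ 2) = 1 / b ^ 2 := by
  have h := integral_comp_abs (f := fun t : ℝ => t ^ 3 * Real.exp (-b * t ^ 2))
  simp only [sq_abs] at h
  rw [h]
  have h2 := integral_rpow_mul_exp_neg_mul_rpow (p := 2) (q := 3) (b := b)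
    (by norm_num) (by norm_num) hb
  norm_num at h2
  simp only [neg_mul]
  rw [h2]
  field_simp

end GaussianCdf


/-! ### Normal approximation for one row of the noise -/

section NormalApproximation

variable {N : ℕ}

/-- Factors are exchanged one at a time. The extra M on the left avoids the exponent `J.card - 1`.
-/
lemma abs_prod_sub_pow_le {ι : Type*} (J : Finset ι) (a : ι → ℝ) {b M ε : ℝ}
    (hM : 0 ≤ M) (hb : |b| ≤ M) (ha : ∀ j ∈ J, |a j| ≤ M) (hab : ∀ j ∈ J, |a j - b| ≤ ε) :
    |∏ j ∈ J, a j - b ^ J.card| * M ≤ J.card * ε * M ^ J.card := by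
  classical
  induction J using Finset.induction_on with
  | empty => simp
  | insert i J hi ih =>
    have ih' := ih (fun j hj => ha j (Finset.mem_insert_of_mem hj))
      (fun j hj => hab j (Finset.mem_insert_of_mem hj))
    rw [Finset.prod_insert hi, Finset.card_insert_of_notMem hi]
    have h1 : a i * ∏ j ∈ J, a j - b ^ (J.card + 1) =
        a i * (∏ j ∈ J, a j - b ^ J.card) + (a i - b) * b ^ J.card := by ring
    have h2 := ha i (Finset.mem_insert_self i J)
    have h3 := hab i (Finset.mem_insert_self i J)
    have hε : 0 ≤ ε := (abs_nonneg _).trans h3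
    rw [h1]
    calc _ ≤ (|a i| * |∏ j ∈ J, a j - b ^ J.card| + |a i - b| * |b| ^ J.card) * M := by
          gcongr
          refine (abs_add_le _ _).trans_eq ?_
          rw [abs_mul, abs_mul, abs_pow]
      _ = |a i| * (|∏ j ∈ J, a j - b ^ J.card| * M) + |a i - b| * |b| ^ J.card * M := by ring
      _ ≤ M * (J.card * ε * M ^ J.card) + ε * M ^ J.card * M := by gcongr
      _ = _ := by push_cast; ring

/-- The characteristic function of `sin 2π(z + k/4)` for uniform `k`. -/
def quarterChar (z : UnitAddCircle) (t : ℝ) : ℝ :=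
  (Real.cos (t * sinC z) + Real.cos (t * cosC z)) / 2

lemma abs_quarterChar_le_one (z : UnitAddCircle) (t : ℝ) : |quarterChar z t| ≤ 1 := by
  have h1 := abs_le.1 (Real.abs_cos_le_one (t * sinC z))
  have h2 := abs_le.1 (Real.abs_cos_le_one (t * cosC z))
  rw [quarterChar, abs_le]
  constructor <;> linarith [h1.1, h1.2, h2.1, h2.2]

/-- Since sin² + cos² = 1 the quadratic term does not depend on z, and by symmetry there are no odd
terms. The error is therefore of fourth order. -/
lemma abs_quarterChar_sub_le (z : UnitAddCircle) {t : ℝ} (ht : |t| ≤ 1) :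
    |quarterChar z t - (1 - t ^ 2 / 4)| ≤ 5 / 96 * t ^ 4 := by
  have hs := abs_sinC_le_one z
  have hc := abs_cosC_le_one z
  have hgen : ∀ a : ℝ, |a| ≤ 1 → |Real.cos (t * a) - (1 - (t * a) ^ 2 / 2)| ≤ 5 / 96 * t ^ 4 := by
    intro a ha
    have h1 : |t * a| ≤ |t| := by
      rw [abs_mul]; exact mul_le_of_le_one_right (abs_nonneg t) ha
    refine (Real.cos_bound (h1.trans ht)).trans ?_
    have : |t * a| ^ 4 ≤ |t| ^ 4 := by gcongr
    rw [(by decide : Even 4).pow_abs t] at this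
    linarith
  have h1 := hgen _ hs
  have h2 := hgen _ hc
  have h3 := sinC_sq_add_cosC_sq z
  have h4 : quarterChar z t - (1 - t ^ 2 / 4) =
      ((Real.cos (t * sinC z) - (1 - (t * sinC z) ^ 2 / 2)) +
        (Real.cos (t * cosC z) - (1 - (t * cosC z) ^ 2 / 2))) / 2 := by
    rw [quarterChar]
    linear_combination (-t ^ 2 / 4) * h3
  rw [h4, abs_div, abs_two]
  have := abs_add_le (Real.cos (t * sinC z) - (1 - (t * sinC z) ^ 2 / 2))
    (Real.cos (t * cosC z) - (1 - (t * cosC z) ^ 2 / 2))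
  linarith

lemma abs_prod_quarterChar_sub_le (J : Finset (Fin N)) (z : Fin N → UnitAddCircle) {t : ℝ}
    (ht : |t| ≤ 1) :
    |∏ j ∈ J, quarterChar (z j) t - Real.exp (-(J.card / 4) * t ^ 2)| ≤
      J.card / 4 * t ^ 4 * Real.exp (-(J.card / 8) * t ^ 2) := by
  have ht2 : t ^ 2 ≤ 1 := by
    rw [← sq_abs]; exact pow_le_one₀ (abs_nonneg t) ht
  have ht4 : t ^ 4 ≤ t ^ 2 := by nlinarith [sq_nonneg t]
  have ht20 := sq_nonneg t
  have ht40 : 0 ≤ t ^ 4 := by positivity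
  have hexp := Real.abs_exp_sub_one_sub_id_le (x := -t ^ 2 / 4)
    (by rw [abs_le]; constructor <;> linarith)
  have hM1 : 1 - t ^ 2 / 8 ≤ Real.exp (-t ^ 2 / 8) := by
    linarith [Real.add_one_le_exp (-t ^ 2 / 8)]
  have hMpos := Real.exp_pos (-t ^ 2 / 8)
  -- For |t| ≤ 1 both factors are bounded by e^(-t²/8). They differ by at most (5/96 + 1/16)t⁴ ≤
  -- t⁴/8, and dividing by M ≥ 1/2 at the end turns 1/8 into 1/4.
  have hmain := abs_prod_sub_pow_le J (fun j => quarterChar (z j) t)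
    (b := Real.exp (-t ^ 2 / 4)) (M := Real.exp (-t ^ 2 / 8)) (ε := 1 / 8 * t ^ 4) hMpos.le
    (by rw [Real.abs_exp, Real.exp_le_exp]; linarith)
    (by
      intro j _
      have := abs_le.1 (abs_quarterChar_sub_le (z j) ht)
      rw [abs_le]
      constructor <;> linarith [this.1, this.2])
    (by
      intro j _
      have h1 := abs_le.1 (abs_quarterChar_sub_le (z j) ht)
      have h2 := abs_le.1 hexp
      have h3 : (-t ^ 2 / 4) ^ 2 = t ^ 4 / 16 := by ring
      rw [h3] at h2
      rw [abs_le]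
      constructor <;> linarith [h1.1, h1.2, h2.1, h2.2])
  rw [← Real.exp_nat_mul, ← Real.exp_nat_mul,
    show (J.card : ℝ) * (-t ^ 2 / 4) = -(J.card / 4) * t ^ 2 by ring,
    show (J.card : ℝ) * (-t ^ 2 / 8) = -(J.card / 8) * t ^ 2 by ring] at hmain
  have hM2 : 1 / 2 ≤ Real.exp (-t ^ 2 / 8) := by linarith
  set A := |∏ j ∈ J, quarterChar (z j) t - Real.exp (-(J.card / 4) * t ^ 2)|
  have hA : 0 ≤ A := abs_nonneg _
  nlinarith

/-- The sum of `sin 2π(z_j + η_j/4)` over `J`. -/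
def quarterSum (J : Finset (Fin N)) (z : Fin N → UnitAddCircle) (η : Fin N → Fin 4) : ℝ :=
  ∑ j ∈ J, sinC (z j + quarter (η j))

/-- By independence the expectation factorises over all nodes, with factor 1 off J. At each node of
J opposite quarter turns give conjugate values, so the characteristic function is real. -/
lemma integral_cexp_quarterSum (J : Finset (Fin N)) (z : Fin N → UnitAddCircle) (t : ℝ) :
    ∫ η, Complex.exp ((t * quarterSum J z η : ℝ) * Complex.I) ∂(rowLaw N) =
      ((∏ j ∈ J, quarterChar (z j) t : ℝ) : ℂ) := by
  classical
  have h1 : ∀ η : Fin N → Fin 4, Complex.exp ((t * quarterSum J z η : ℝ) * Complex.I) =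
      ∏ j, (if j ∈ J then Complex.exp ((t * sinC (z j + quarter (η j)) : ℝ) * Complex.I)
        else 1) := by
    intro η
    rw [Finset.prod_ite_mem, Finset.univ_inter, ← Complex.exp_sum, quarterSum, ← Finset.sum_mul,
      Finset.mul_sum]
    push_cast
    rfl
  simp only [h1]
  rw [rowLaw, integral_fintype_prod_eq_prod (fun j k =>
    if j ∈ J then Complex.exp ((t * sinC (z j + quarter k) : ℝ) * Complex.I) else 1)]
  have h2 : ∀ j, ∫ k, (if j ∈ J then Complex.exp ((t * sinC (z j + quarter k) : ℝ) * Complex.I)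
      else 1) ∂(PMF.uniformOfFintype (Fin 4)).toMeasure =
      if j ∈ J then ((quarterChar (z j) t : ℝ) : ℂ) else 1 := by
    intro j
    split_ifs
    · rw [integral_uniform_fin_four]
      simp only [sinC_add_quarter, Fin.sum_univ_four]
      simp only [Matrix.cons_val]
      rw [quarterChar]
      push_cast
      rw [Complex.cos, Complex.cos, Complex.real_smul]
      push_cast
      ring_nf
    · simp
  simp only [h2]
  rw [Finset.prod_ite_mem, Finset.univ_inter]
  push_cast
  rfl

lemma integral_sin_quarterSum (J : Finset (Fin N)) (z : Fin N → UnitAddCircle) (t u : ℝ) :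
    ∫ η, Real.sin (t * (u - quarterSum J z η)) ∂(rowLaw N) =
      Real.sin (t * u) * ∏ j ∈ J, quarterChar (z j) t := by
  have h := integral_cexp_quarterSum J z (-t)
  have hq : ∀ j, quarterChar (z j) (-t) = quarterChar (z j) t := by
    intro j; simp [quarterChar]
  simp only [hq] at h
  have h2 := congrArg (fun w => (Complex.exp ((t * u : ℝ) * Complex.I) * w).im) h
  rw [← integral_const_mul] at h2
  have hint : Integrable (fun η => Complex.exp ((t * u : ℝ) * Complex.I) *
      Complex.exp ((-t * quarterSum J z η : ℝ) * Complex.I)) (rowLaw N) := Integrable.of_finite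
  have h3 := integral_im hint
  simp only [RCLike.im_to_complex] at h3
  rw [← h3] at h2
  rw [Complex.im_mul_ofReal, Complex.exp_ofReal_mul_I_im] at h2
  rw [← h2]
  congr 1
  funext η
  rw [← Complex.exp_add, ← add_mul, ← Complex.ofReal_add, Complex.exp_ofReal_mul_I_im]
  congr 1
  ring

/-- The distribution function of `quarterSum`, smoothed by a Gaussian of variance `h`. -/
lemma abs_smoothed_sub_le (J : Finset (Fin N)) (hJ : J.Nonempty) (z : Fin N → UnitAddCircle)
    {h : NNReal} (hh : 1 ≤ h) (u : ℝ) :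
    |∫ η, (gaussianReal 0 h).real (Set.Iic (u - quarterSum J z η)) ∂(rowLaw N) -
      (gaussianReal 0 ((J.card : NNReal) / 2 + h)).real (Set.Iic u)| ≤
      16 / J.card + 32 * Real.exp (-(h : ℝ) / 4) := by
  have hh1 : (1 : ℝ) ≤ h := by exact_mod_cast hh
  have hh0 : h ≠ 0 := by positivity
  have hn : (0 : ℝ) < J.card := by exact_mod_cast hJ.card_pos
  have hv0 : (J.card : NNReal) / 2 + h ≠ 0 := by positivity
  set g : ℝ → ℝ := fun t => Real.exp (-((h : ℝ) / 2) * t ^ 2) with hg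
  have hgint : Integrable g := integrable_exp_neg_mul_sq (by positivity)
  have hsint : ∀ c : ℝ, ∀ b : ℝ, 0 < b →
      Integrable fun t : ℝ => c * Real.sinc (t * c) * Real.exp (-b * t ^ 2) := by
    intro c b hb
    refine ((integrable_exp_neg_mul_sq hb).const_mul |c|).mono' ?_
      (Eventually.of_forall fun t => ?_)
    · have := Real.continuous_sinc
      fun_prop
    · rw [norm_mul, norm_mul, Real.norm_eq_abs, Real.norm_eq_abs, Real.norm_eq_abs, Real.abs_exp]
      have := Real.abs_sinc_le_one (t * c)
      gcongr
      exact mul_le_of_le_one_right (abs_nonneg c) this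
  -- The row space is finite, so exchanging the integrals only exchanges an integral with a finite
  -- sum.
  have hS : ∫ η, (gaussianReal 0 h).real (Set.Iic (u - quarterSum J z η)) ∂(rowLaw N) =
      1 / 2 + 1 / (2 * Real.pi) * ∫ t : ℝ, ∫ η, (u - quarterSum J z η) *
        Real.sinc (t * (u - quarterSum J z η)) * g t ∂(rowLaw N) := by
    simp only [gaussianReal_real_Iic hh0]
    rw [integral_add (integrable_const _) Integrable.of_finite, integral_const_mul]
    simp only [integral_const, probReal_univ, one_smul]
    congr 2
    simp only [integral_fintype Integrable.of_finite]
    rw [integral_finsetSum]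
    · simp only [integral_smul, hg]
    · exact fun η _ => (hsint _ ((h : ℝ) / 2) (by positivity)).smul ((rowLaw N).real {η})
  rw [hS, gaussianReal_real_Iic hv0]
  have hintS : Integrable fun t : ℝ => ∫ η, (u - quarterSum J z η) *
        Real.sinc (t * (u - quarterSum J z η)) * g t ∂(rowLaw N) := by
    simp only [integral_fintype Integrable.of_finite]
    exact integrable_finsetSum _ fun η _ => (hsint _ ((h : ℝ) / 2) (by positivity)).smul
      ((rowLaw N).real {η})
  have hintG := hsint u ((((J.card : NNReal) / 2 + h : NNReal) : ℝ) / 2) (by positivity)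
  rw [add_sub_add_left_eq_sub, ← mul_sub, ← integral_sub hintS hintG, abs_mul,
    abs_of_pos (by positivity)]
  have hi1 := integrable_abs_pow_three_mul_exp (b := (J.card : ℝ) / 8) (by positivity)
  have hi2 := integrable_abs_pow_three_mul_exp (b := (h : ℝ) / 4) (by positivity)
  -- For |t| ≤ 1 the product estimate applies. For |t| > 1 the characteristic functions differ by at
  -- most 2, and the smoothing factor supplies e^(-h/4) e^(-ht²/4). The integrals of |t|³ times a
  -- Gaussian then give 16/n and 32/h² ≤ 32.
  have hbound : |∫ t : ℝ, ((∫ η, (u - quarterSum J z η) *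
        Real.sinc (t * (u - quarterSum J z η)) * g t ∂(rowLaw N)) -
        u * Real.sinc (t * u) *
          Real.exp (-((((J.card : NNReal) / 2 + h : NNReal) : ℝ) / 2) * t ^ 2))| ≤
      ∫ t : ℝ, ((J.card : ℝ) / 4 * (|t| ^ 3 * Real.exp (-((J.card : ℝ) / 8) * t ^ 2)) +
        2 * Real.exp (-(h : ℝ) / 4) * (|t| ^ 3 * Real.exp (-((h : ℝ) / 4) * t ^ 2))) := by
    rw [← Real.norm_eq_abs]
    refine norm_integral_le_of_norm_le ((hi1.const_mul _).add (hi2.const_mul _)) ?_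
    have hne : ∀ᵐ t : ℝ, t ≠ 0 := by
      rw [ae_iff]; simp
    filter_upwards [hne] with t ht
    have hsinc : ∀ c : ℝ, c * Real.sinc (t * c) = Real.sin (t * c) / t := by
      intro c
      by_cases hc : c = 0
      · simp [hc]
      rw [Real.sinc_of_ne_zero (mul_ne_zero ht hc)]
      field_simp
    simp only [hsinc]
    rw [integral_mul_const, integral_div, integral_sin_quarterSum]
    have hexp : Real.exp (-((((J.card : NNReal) / 2 + h : NNReal) : ℝ) / 2) * t ^ 2) =
        Real.exp (-(J.card / 4) * t ^ 2) * g t := by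
      rw [hg, ← Real.exp_add]
      congr 1
      push_cast
      ring
    rw [hexp, show Real.sin (t * u) * (∏ j ∈ J, quarterChar (z j) t) / t * g t -
      Real.sin (t * u) / t * (Real.exp (-(J.card / 4) * t ^ 2) * g t) =
      Real.sin (t * u) * (∏ j ∈ J, quarterChar (z j) t - Real.exp (-(J.card / 4) * t ^ 2)) / t *
        g t by ring, norm_mul, norm_div, norm_mul, Real.norm_eq_abs, Real.norm_eq_abs,
        Real.norm_eq_abs, Real.norm_eq_abs]
    have hgpos : 0 < g t := Real.exp_pos _
    have hg1 : g t ≤ 1 := by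
      rw [hg, Real.exp_le_one_iff]
      have : 0 ≤ (h : ℝ) / 2 * t ^ 2 := by positivity
      linarith
    have htpos : 0 < |t| := abs_pos.2 ht
    rw [abs_of_pos hgpos]
    set A := |∏ j ∈ J, quarterChar (z j) t - Real.exp (-(J.card / 4) * t ^ 2)| with hA
    have hA0 : 0 ≤ A := abs_nonneg _
    have hsin := Real.abs_sin_le_one (t * u)
    have hstep : |Real.sin (t * u)| * A / |t| * g t ≤ A / |t| * g t := by
      gcongr
      exact mul_le_of_le_one_left hA0 hsin
    refine hstep.trans ?_
    by_cases ht1 : |t| ≤ 1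
    · have hA1 := abs_prod_quarterChar_sub_le J z ht1
      rw [← hA] at hA1
      have : A / |t| * g t ≤ (J.card : ℝ) / 4 *
          (|t| ^ 3 * Real.exp (-((J.card : ℝ) / 8) * t ^ 2)) := by
        calc A / |t| * g t ≤ A / |t| * 1 := by gcongr
          _ ≤ (J.card / 4 * t ^ 4 * Real.exp (-(J.card / 8) * t ^ 2)) / |t| := by
              rw [mul_one]; gcongr
          _ = _ := by
              rw [← (by decide : Even 4).pow_abs t]
              field_simp
      have h0 : 0 ≤ 2 * Real.exp (-(h : ℝ) / 4) *
        (|t| ^ 3 * Real.exp (-((h : ℝ) / 4) * t ^ 2)) := by positivity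
      linarith
    · have ht1' : 1 < |t| := not_le.1 ht1
      have hA2 : A ≤ 2 := by
        have h1 : |∏ j ∈ J, quarterChar (z j) t| ≤ 1 := by
          rw [Finset.abs_prod]
          exact Finset.prod_le_one (fun _ _ => abs_nonneg _)
            fun j _ => abs_quarterChar_le_one (z j) t
        have h2 : |Real.exp (-(J.card / 4) * t ^ 2)| ≤ 1 := by
          rw [Real.abs_exp, Real.exp_le_one_iff]
          have : 0 ≤ (J.card : ℝ) / 4 * t ^ 2 := by positivity
          linarith
        have h3 := abs_sub (∏ j ∈ J, quarterChar (z j) t) (Real.exp (-(J.card / 4) * t ^ 2))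
        rw [hA]
        linarith
      have hgle : g t ≤ Real.exp (-(h : ℝ) / 4) * Real.exp (-((h : ℝ) / 4) * t ^ 2) := by
        rw [hg, ← Real.exp_add]
        refine Real.exp_le_exp.2 ?_
        have : 1 ≤ t ^ 2 := by
          rw [← sq_abs]; nlinarith
        nlinarith
      have : A / |t| * g t ≤ 2 * Real.exp (-(h : ℝ) / 4) *
        (|t| ^ 3 * Real.exp (-((h : ℝ) / 4) * t ^ 2)) := by
        calc A / |t| * g t ≤ 2 / 1 *
            (Real.exp (-(h : ℝ) / 4) * Real.exp (-((h : ℝ) / 4) * t ^ 2)) := by gcongr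
          _ = 2 * Real.exp (-(h : ℝ) / 4) * (1 ^ 3 * Real.exp (-((h : ℝ) / 4) * t ^ 2)) := by ring
          _ ≤ _ := by gcongr
      have h0 : 0 ≤ (J.card : ℝ) / 4 *
          (|t| ^ 3 * Real.exp (-((J.card : ℝ) / 8) * t ^ 2)) := by positivity
      linarith
  rw [integral_add (hi1.const_mul _) (hi2.const_mul _), integral_const_mul, integral_const_mul,
    integral_abs_pow_three_mul_exp (by positivity),
    integral_abs_pow_three_mul_exp (by positivity)] at hbound
  have hpi : 1 / (2 * Real.pi) ≤ 1 := by
    rw [div_le_one (by positivity)]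
    linarith [Real.pi_gt_three]
  have he1 : (J.card : ℝ) / 4 * (1 / ((J.card : ℝ) / 8) ^ 2) = 16 / J.card := by
    field_simp; norm_num
  have he2 : 2 * Real.exp (-(h : ℝ) / 4) * (1 / ((h : ℝ) / 4) ^ 2) ≤
      32 * Real.exp (-(h : ℝ) / 4) := by
    have : 1 / ((h : ℝ) / 4) ^ 2 ≤ 16 := by
      rw [div_le_iff₀ (by positivity)]
      nlinarith
    nlinarith [Real.exp_pos (-(h : ℝ) / 4)]
  rw [he1] at hbound
  calc _ ≤ 1 * _ := mul_le_mul_of_nonneg_right hpi (abs_nonneg _)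
    _ ≤ _ := by rw [one_mul]; linarith

lemma integral_indicator_rowLaw (A : Set (Fin N → Fin 4)) :
    ∫ η, A.indicator (fun _ => (1 : ℝ)) η ∂(rowLaw N) = (rowLaw N).real A := by
  rw [integral_indicator (MeasurableSet.of_discrete)]
  simp

/-- Normal approximation of `quarterSum`, up to a shift by `h` of the argument. -/
lemma rowLaw_quarterSum_le (J : Finset (Fin N)) (hJ : J.Nonempty) (z : Fin N → UnitAddCircle)
    {h : ℝ} (hh : 1 ≤ h) (v : ℝ) :
    (rowLaw N).real {η | quarterSum J z η ≤ v} ≤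
        (gaussianReal 0 ((J.card : NNReal) / 2)).real (Set.Iic (v + h)) +
          (16 / J.card + 34 * Real.exp (-h / 8)) ∧
      (gaussianReal 0 ((J.card : NNReal) / 2)).real (Set.Iic (v - h)) ≤
        (rowLaw N).real {η | quarterSum J z η ≤ v} +
          (16 / J.card + 34 * Real.exp (-h / 8)) := by
  set k : NNReal := h.toNNReal with hk
  have hkh : (k : ℝ) = h := Real.coe_toNNReal h (by linarith)
  have hk1 : 1 ≤ k := by
    rw [← NNReal.coe_le_coe, hkh]; exact_mod_cast hh
  have hk0 : k ≠ 0 := by positivity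
  -- The smoothing variance equals h, and h/2 of the shift is spent twice: on comparing the
  -- indicator with its smoothing, and on removing the added variance. Each costs a tail e^(-h/8),
  -- whence 34 = 32 + 1 + 1.
  have hexp : Real.exp (-(h / 2) ^ 2 / (2 * k)) = Real.exp (-h / 8) := by
    rw [hkh]; congr 1; field_simp; norm_num
  have hexp2 : Real.exp (-(k : ℝ) / 4) ≤ Real.exp (-h / 8) := by
    rw [hkh]; exact Real.exp_le_exp.2 (by linarith)
  have hlow := gaussianReal_real_Iic_neg_le hk0 (a := h / 2) (by linarith)
  have hhigh := gaussianReal_real_Ici_le hk0 (a := h / 2) (by linarith)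
  rw [hexp] at hlow hhigh
  constructor
  · have h1 : (rowLaw N).real {η | quarterSum J z η ≤ v} ≤
        ∫ η, ((gaussianReal 0 k).real (Set.Iic (v + h / 2 - quarterSum J z η)) +
          Real.exp (-h / 8)) ∂(rowLaw N) := by
      rw [← integral_indicator_rowLaw]
      refine integral_mono Integrable.of_finite Integrable.of_finite fun η => ?_
      by_cases hη : quarterSum J z η ≤ v
      · rw [Set.indicator_of_mem (by exact hη)]
        have hmono : (gaussianReal 0 k).real (Set.Iic (h / 2)) ≤
            (gaussianReal 0 k).real (Set.Iic (v + h / 2 - quarterSum J z η)) :=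
          measureReal_mono (Set.Iic_subset_Iic.2 (by linarith))
        have hc : (gaussianReal 0 k).real (Set.Iic (h / 2))ᶜ =
            1 - (gaussianReal 0 k).real (Set.Iic (h / 2)) :=
          probReal_compl_eq_one_sub measurableSet_Iic
        have hc2 : (gaussianReal 0 k).real (Set.Iic (h / 2))ᶜ ≤
            (gaussianReal 0 k).real (Set.Ici (h / 2)) := by
          rw [Set.compl_Iic]
          exact measureReal_mono Set.Ioi_subset_Ici_self
        linarith
      · rw [Set.indicator_of_notMem (by exact hη)]
        positivity
    rw [integral_add Integrable.of_finite (integrable_const _)] at h1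
    simp only [integral_const, probReal_univ, one_smul] at h1
    have h2 := (abs_le.1 (abs_smoothed_sub_le J hJ z hk1 (v + h / 2))).2
    have h3 := (gaussianReal_add_real_Iic (v₁ := (J.card : NNReal) / 2) hk0 (a := h / 2)
      (by linarith) (v + h / 2)).1
    rw [hexp, show v + h / 2 + h / 2 = v + h by ring] at h3
    linarith
  · have h1 : ∫ η, (gaussianReal 0 k).real (Set.Iic (v - h / 2 - quarterSum J z η)) ∂(rowLaw N) ≤
        ∫ η, ({η | quarterSum J z η ≤ v}.indicator (fun _ => (1 : ℝ)) η + Real.exp (-h / 8))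
          ∂(rowLaw N) := by
      refine integral_mono Integrable.of_finite Integrable.of_finite fun η => ?_
      by_cases hη : quarterSum J z η ≤ v
      · simp only [Set.indicator_of_mem (show η ∈ {η | quarterSum J z η ≤ v} from hη)]
        have := measureReal_le_one (μ := gaussianReal 0 k)
          (s := Set.Iic (v - h / 2 - quarterSum J z η))
        linarith [Real.exp_pos (-h / 8)]
      · simp only [Set.indicator_of_notMem (show η ∉ {η | quarterSum J z η ≤ v} from hη), zero_add]
        refine le_trans (measureReal_mono (Set.Iic_subset_Iic.2 ?_)) hlow
        linarith [not_le.1 hη]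
    rw [integral_add Integrable.of_finite (integrable_const _), integral_indicator_rowLaw] at h1
    simp only [integral_const, probReal_univ, one_smul] at h1
    have h2 := (abs_le.1 (abs_smoothed_sub_le J hJ z hk1 (v - h / 2))).1
    have h3 := (gaussianReal_add_real_Iic (v₁ := (J.card : NNReal) / 2) hk0 (a := h / 2)
      (by linarith) (v - h / 2)).2
    rw [hexp, show v - h / 2 - h / 2 = v - h by ring] at h3
    linarith

end NormalApproximation


/-! ### The law of the fluctuation at a fixed time -/

section FixedTime

variable {N : ℕ} (G : SimpleGraph (Fin N))

lemma one_sub_measureReal_compl_le {Ω : Type*} [MeasurableSpace Ω] (P : Measure Ω)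
    [IsProbabilityMeasure P] (A : Set Ω) : 1 - P.real Aᶜ ≤ P.real A := by
  have h := measureReal_union_le (μ := P) A Aᶜ
  rw [Set.union_compl_self, probReal_univ] at h
  linarith

lemma abs_lowSum_sub_quarterSum_le {δ α : ℝ} (hα : 0 < α) (hδ : 0 < δ) {Δ : ℝ} (hΔ : 0 < Δ)
    {i : Fin N} (hi : i ∈ hubs G Δ)
    (z : Fin N → UnitAddCircle) (e : Fin N → Fin 4 → ℝ)
    (he : ∀ j k, |e j k| ≤ 17 / 6 * (α / topDeg G * deg G j)) (η : Fin N → Fin 4) :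
    |lowSum G δ i (fun j => z j + quarter (η j) + (e j (η j) : UnitAddCircle)) -
      quarterSum (lowNbrs G δ i) z η| ≤ 17 / 3 * Real.pi * α * δ := by
  have hD : (0 : ℝ) < topDeg G := hΔ.trans (lt_topDeg_of_mem_hubs G hi)
  have hπ := Real.pi_pos
  rw [lowSum, quarterSum, ← Finset.sum_sub_distrib]
  calc _ ≤ (lowNbrs G δ i).card • (2 * Real.pi * (17 / 6 * (α / topDeg G * δ))) := by
        refine (Finset.abs_sum_le_sum_abs _ _).trans (Finset.sum_le_card_nsmul _ _ _ fun j hj => ?_)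
        refine (abs_sinC_add_sub_le _ _).trans ?_
        have hdeg := (deg_lt_of_mem_lowNbrs G hj).le
        gcongr
        exact (he j (η j)).trans (by gcongr)
    _ ≤ topDeg G * (2 * Real.pi * (17 / 6 * (α / topDeg G * δ))) := by
        have := card_lowNbrs_le G δ i
        rw [nsmul_eq_mul]
        gcongr
    _ = _ := by field_simp; ring

lemma gaussianReal_scale_real_Iic {σ : ℝ} (hσ : 0 < σ) (v : NNReal) (u : ℝ) :
    (gaussianReal 0 (σ ^ 2 * v).toNNReal).real (Set.Iic u) =
      (gaussianReal 0 v).real (Set.Iic (u / σ)) := by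
  have h := gaussianReal_map_const_mul (μ := 0) (v := v) σ
  have hv : (σ ^ 2 * v : ℝ).toNNReal = NNReal.mk (σ ^ 2) (sq_nonneg _) * v := by
    ext
    rw [Real.coe_toNNReal _ (by positivity)]
    rfl
  rw [hv]
  rw [mul_zero] at h
  rw [← h, map_measureReal_apply (by fun_prop) measurableSet_Iic]
  congr 1
  ext x
  simp only [Set.mem_preimage, Set.mem_Iic]
  rw [le_div_iff₀ hσ, mul_comm]

/-- Normal approximation of the fluctuation at a hub. -/
lemma fluct_normal_approximation {δ α Δ h s₁ : ℝ} (hα : 0 < α) (hδ : 0 < δ) (hΔ : 0 < Δ)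
    (hh : 1 ≤ h) {i : Fin N} (hi : i ∈ hubs G Δ) (hJ : (lowNbrs G δ i).Nonempty)
    (hs₁ : α * h / Δ + 17 / 3 * Real.pi * α ^ 2 * δ / Δ +
      17 / 6 * α * (1 - starIndex G Δ δ) ≤ s₁) (t : ℕ) (s : ℝ) :
    (dynProb N).real {p | fluct G δ α p.1 p.2 i t ≤ s} ∈ Set.Icc
      ((gaussianReal 0 (effCoupling G δ α i ^ 2 /
        (2 * (nodeIndex G δ i * (deg G i : ℝ)))).toNNReal).real (Set.Iic (s - s₁)) -
          (16 / (lowNbrs G δ i).card + 34 * Real.exp (-h / 8)))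
      ((gaussianReal 0 (effCoupling G δ α i ^ 2 /
        (2 * (nodeIndex G δ i * (deg G i : ℝ)))).toNNReal).real (Set.Iic (s + s₁)) +
          (16 / (lowNbrs G δ i).card + 34 * Real.exp (-h / 8))) := by
  have hπ := Real.pi_pos
  have hDΔ : Δ < topDeg G := lt_topDeg_of_mem_hubs G hi
  have hD : (0 : ℝ) < topDeg G := hΔ.trans hDΔ
  have hn : (0 : ℝ) < (lowNbrs G δ i).card := by exact_mod_cast hJ.card_pos
  set n := (lowNbrs G δ i).card with hndef
  set σ := α / (topDeg G : ℝ) with hσdef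
  have hσ : 0 < σ := by positivity
  set ν := starIndex G Δ δ with hν
  have hvar : effCoupling G δ α i ^ 2 / (2 * (nodeIndex G δ i * (deg G i : ℝ))) =
      σ ^ 2 * (((n : NNReal) / 2 : NNReal) : ℝ) := by
    rw [effCoupling_eq, nodeIndex_mul_deg, ← hndef, ← hσdef]
    push_cast
    field_simp
  rw [hvar, gaussianReal_scale_real_Iic hσ, gaussianReal_scale_real_Iic hσ]
  set w := 17 / 3 * Real.pi * α * δ with hw
  have hslack : σ * h + σ * w + 17 / 6 * α * (1 - ν) ≤ s₁ := by
    refine le_trans ?_ hs₁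
    have h1 : σ * h ≤ α * h / Δ := by
      rw [hσdef, div_mul_eq_mul_div]; gcongr
    have h2 : σ * w ≤ 17 / 3 * Real.pi * α ^ 2 * δ / Δ := by
      rw [hσdef, hw, div_mul_eq_mul_div,
        show α * (17 / 3 * Real.pi * α * δ) = 17 / 3 * Real.pi * α ^ 2 * δ by ring]
      gcongr
    linarith
  have hfl : ∀ p : Noise N × (Fin N → UnitAddCircle),
      |fluct G δ α p.1 p.2 i t - σ * lowSum G δ i (traj G α p.1 p.2 t)| ≤
        17 / 6 * α * (1 - ν) := fun p => abs_fluct_sub_le G hα hΔ p.1 p.2 hi t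
  have hmeas : Measurable fun y => σ * lowSum G δ i y :=
    ((continuous_lowSum G δ i).const_mul σ |>.measurable)
  constructor
  -- `dynProb_traj_le` bounds probabilities only from above, so the lower estimate passes through
  -- the complementary event.
  · have hup : (dynProb N).real {p | traj G α p.1 p.2 t ∈
        {y | s - 17 / 6 * α * (1 - ν) < σ * lowSum G δ i y}} ≤
        1 - (gaussianReal 0 ((n : NNReal) / 2)).real (Set.Iic ((s - s₁) / σ)) +
          (16 / n + 34 * Real.exp (-h / 8)) := by
      refine dynProb_traj_le G α hα t (measurableSet_lt measurable_const hmeas)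
        fun z e he => ?_
      set v := (s - 17 / 6 * α * (1 - ν)) / σ - w with hv
      have hq := (rowLaw_quarterSum_le (lowNbrs G δ i) hJ z hh v).2
      rw [← hndef] at hq
      have hsub : {η : Fin N → Fin 4 |
          (fun j => z j + quarter (η j) + (e j (η j) : UnitAddCircle)) ∈
            {y | s - 17 / 6 * α * (1 - ν) < σ * lowSum G δ i y}} ⊆
          {η | quarterSum (lowNbrs G δ i) z η ≤ v}ᶜ := by
        intro η hη hcon
        have h1 : s - 17 / 6 * α * (1 - ν) < σ * lowSum G δ i
          (fun j => z j + quarter (η j) + (e j (η j) : UnitAddCircle)) := hη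
        have h2 : quarterSum (lowNbrs G δ i) z η ≤ v := hcon
        have h3 := (abs_le.1 (abs_lowSum_sub_quarterSum_le G hα hδ hΔ hi z e he η)).2
        rw [← div_lt_iff₀' hσ] at h1
        linarith
      have hmono : (gaussianReal 0 ((n : NNReal) / 2)).real (Set.Iic ((s - s₁) / σ)) ≤
          (gaussianReal 0 ((n : NNReal) / 2)).real (Set.Iic (v - h)) := by
        refine measureReal_mono (Set.Iic_subset_Iic.2 ?_)
        rw [hv, div_le_iff₀ hσ, sub_mul, sub_mul, div_mul_cancel₀ _ hσ.ne']
        linarith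
      refine (measureReal_mono hsub).trans ?_
      rw [probReal_compl_eq_one_sub MeasurableSet.of_discrete]
      linarith
    have hc := one_sub_measureReal_compl_le (dynProb N) {p | fluct G δ α p.1 p.2 i t ≤ s}
    have hm : (dynProb N).real {p | fluct G δ α p.1 p.2 i t ≤ s}ᶜ ≤
        (dynProb N).real {p | traj G α p.1 p.2 t ∈
          {y | s - 17 / 6 * α * (1 - ν) < σ * lowSum G δ i y}} := by
      refine measureReal_mono fun p hp => ?_
      have hp' : s < fluct G δ α p.1 p.2 i t := not_le.1 hp
      change s - 17 / 6 * α * (1 - ν) < σ * lowSum G δ i (traj G α p.1 p.2 t)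
      have := (abs_le.1 (hfl p)).2
      linarith
    linarith
  · have hm : (dynProb N).real {p | fluct G δ α p.1 p.2 i t ≤ s} ≤
        (dynProb N).real {p | traj G α p.1 p.2 t ∈
          {y | σ * lowSum G δ i y ≤ s + 17 / 6 * α * (1 - ν)}} := by
      refine measureReal_mono fun p hp => ?_
      have hp' : fluct G δ α p.1 p.2 i t ≤ s := hp
      change σ * lowSum G δ i (traj G α p.1 p.2 t) ≤ s + 17 / 6 * α * (1 - ν)
      have := (abs_le.1 (hfl p)).1
      linarith
    refine hm.trans (dynProb_traj_le G α hα t (measurableSet_le hmeas measurable_const)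
      fun z e he => ?_)
    set v := (s + 17 / 6 * α * (1 - ν)) / σ + w with hv
    have hq := (rowLaw_quarterSum_le (lowNbrs G δ i) hJ z hh v).1
    rw [← hndef] at hq
    have hsub : {η : Fin N → Fin 4 |
        (fun j => z j + quarter (η j) + (e j (η j) : UnitAddCircle)) ∈
          {y | σ * lowSum G δ i y ≤ s + 17 / 6 * α * (1 - ν)}} ⊆
        {η | quarterSum (lowNbrs G δ i) z η ≤ v} := by
      intro η hη
      have h1 : σ * lowSum G δ i (fun j => z j + quarter (η j) + (e j (η j) : UnitAddCircle)) ≤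
        s + 17 / 6 * α * (1 - ν) := hη
      have h3 := (abs_le.1 (abs_lowSum_sub_quarterSum_le G hα hδ hΔ hi z e he η)).1
      rw [← le_div_iff₀' hσ] at h1
      change quarterSum (lowNbrs G δ i) z η ≤ v
      linarith
    have hmono : (gaussianReal 0 ((n : NNReal) / 2)).real (Set.Iic (v + h)) ≤
        (gaussianReal 0 ((n : NNReal) / 2)).real (Set.Iic ((s + s₁) / σ)) := by
      refine measureReal_mono (Set.Iic_subset_Iic.2 ?_)
      rw [hv, le_div_iff₀ hσ, add_mul, add_mul, div_mul_cancel₀ _ hσ.ne']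
      linarith
    refine (measureReal_mono hsub).trans (hq.trans ?_)
    linarith

/-! ### Large deviations with the mean computed to second order -/

/-- The conditional mean of `sin 2πx_j` one step ahead, to first order in the coupling. -/
def meanShift (α : ℝ) (y : Fin N → UnitAddCircle) (j : Fin N) : ℝ :=
  -(Real.pi * (α / topDeg G * deg G j / 3.6)) * drift (y j)

/-- In the Taylor expansion in the push, order zero sums to zero. At first order the constant part
of the push cancels against the quarter turns of the cosine, and its part linear in k leaves a
multiple of `drift`. The rest is quadratic. -/
lemma abs_mean_sinC_push_sub_le (α : ℝ) (y : Fin N → UnitAddCircle) (j : Fin N) {ρ : ℝ}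
    (hρ : ∀ k, |push G α y j k| ≤ ρ) :
    |1 / 4 * ∑ k, sinC (nodeMap 0 (y j) + quarter k + (push G α y j k : UnitAddCircle)) -
      meanShift G α y j| ≤ 4 * Real.pi ^ 2 * ρ ^ 2 := by
  set z := nodeMap 0 (y j) with hz
  have h0 := sum_sinC_add_quarter z
  have h1 : ∑ k, 2 * Real.pi * push G α y j k * cosC (z + quarter k) =
      4 * meanShift G α y j := by
    simp only [cosC_add_quarter, Fin.sum_univ_four]
    rw [push_eq G α y j 1, push_eq G α y j 2, push_eq G α y j 3]
    simp only [Matrix.cons_val]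
    rw [meanShift, drift, ← hz]
    simp only [Fin.val_one, Fin.val_two, Nat.cast_one, Nat.cast_ofNat,
      show ((3 : Fin 4) : ℕ) = 3 from rfl]
    ring
  have h2 : 1 / 4 * ∑ k, sinC (z + quarter k + (push G α y j k : UnitAddCircle)) -
      meanShift G α y j = 1 / 4 * ∑ k, (sinC (z + quarter k + (push G α y j k : UnitAddCircle)) -
        sinC (z + quarter k) - 2 * Real.pi * push G α y j k * cosC (z + quarter k)) := by
    rw [Finset.sum_sub_distrib, Finset.sum_sub_distrib, h0, h1]
    ring
  rw [h2, abs_mul, abs_of_pos (by norm_num : (0 : ℝ) < 1 / 4)]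
  have h3 : |∑ k, (sinC (z + quarter k + (push G α y j k : UnitAddCircle)) -
        sinC (z + quarter k) - 2 * Real.pi * push G α y j k * cosC (z + quarter k))| ≤
      4 * (4 * Real.pi ^ 2 * ρ ^ 2) := by
    refine (Finset.abs_sum_le_sum_abs _ _).trans
      ((Finset.sum_le_card_nsmul _ _ (4 * Real.pi ^ 2 * ρ ^ 2) fun k _ => ?_).trans_eq ?_)
    · refine (abs_sinC_add_sub_sub_le _ _).trans ?_
      have : push G α y j k ^ 2 ≤ ρ ^ 2 := by
        rw [← sq_abs]
        have := hρ k
        gcongr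
      gcongr
    · simp
  linarith

/-- Averaged over the preceding noise row, the drift cancels up to its Lipschitz constant times the
displacement. Together with the small prefactor this is of second order. -/
lemma abs_mean_meanShift_le {α ρ : ℝ} (z : Fin N → UnitAddCircle)
    (e : Fin N → Fin 4 → ℝ) (j : Fin N) (hα : 0 < α) (hρ : ∀ k, |e j k| ≤ ρ)
    (hb : α / topDeg G * deg G j / 3.6 ≤ ρ) :
    |1 / 4 * ∑ k, -(Real.pi * (α / topDeg G * deg G j / 3.6)) *
      drift (z j + quarter k + (e j k : UnitAddCircle))| ≤ 2 * Real.pi ^ 2 * ρ ^ 2 := by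
  have hπ := Real.pi_pos
  set b := α / topDeg G * deg G j / 3.6 with hbdef
  have hb0 : 0 ≤ b := by positivity
  have hρ0 : 0 ≤ ρ := hb0.trans hb
  have h0 := sum_drift_add_quarter (z j)
  have h1 : ∑ k, drift (z j + quarter k + (e j k : UnitAddCircle)) =
      ∑ k, (drift (z j + quarter k + (e j k : UnitAddCircle)) - drift (z j + quarter k)) := by
    rw [Finset.sum_sub_distrib, h0, sub_zero]
  have h2 : |∑ k, drift (z j + quarter k + (e j k : UnitAddCircle))| ≤
      4 * (2 * Real.pi * ρ) := by
    rw [h1]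
    refine (Finset.abs_sum_le_sum_abs _ _).trans
      ((Finset.sum_le_card_nsmul _ _ (2 * Real.pi * ρ) fun k _ => ?_).trans_eq ?_)
    · refine (abs_drift_add_sub_le _ _).trans ?_
      have := hρ k
      gcongr
    · simp
  rw [← Finset.mul_sum, abs_mul, abs_mul, abs_neg, abs_of_nonneg (by positivity : 0 ≤ Real.pi * b),
    abs_of_pos (by norm_num : (0 : ℝ) < 1 / 4)]
  calc _ ≤ 1 / 4 * (Real.pi * ρ * (4 * (2 * Real.pi * ρ))) := by gcongr
    _ = _ := by ring

/-- Two layers of noise are used. Given the state at time t, the sum at t+1 concentrates around the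
sum of `meanShift`. That sum has terms of size 2πρ and concentrates around zero by the randomness
already present at time t. Each layer costs 2 exponentials, and the biases 4π²ρ² and 2π²ρ² add up.
-/
lemma dynProb_abs_lowSum_ge_le {δ α Δ ρ : ℝ} (hα : 0 < α) (hδ : 0 < δ) (hΔ : 0 < Δ)
    {i : Fin N} (hi : i ∈ hubs G Δ) (hρ : ρ = 17 / 6 * (α / topDeg G * δ)) (t : ℕ) {s : ℝ}
    (hs : 0 < s) :
    (dynProb N).real {p | s * (1 + 2 * Real.pi * ρ) + topDeg G * (6 * Real.pi ^ 2 * ρ ^ 2) ≤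
      |lowSum G δ i (traj G α p.1 p.2 t)|} ≤ 4 * Real.exp (-s ^ 2 / (2 * topDeg G)) := by
  have hπ := Real.pi_pos
  have hD : (0 : ℝ) < topDeg G := hΔ.trans (lt_topDeg_of_mem_hubs G hi)
  have hρ0 : 0 < ρ := by rw [hρ]; positivity
  have hexp0 := Real.exp_pos (-s ^ 2 / (2 * topDeg G))
  have hcs := continuous_lowSum G δ i
  cases t with
  | zero =>
    refine dynProb_le_of_shift ?_ ?_
    · exact measurableSet_le measurable_const
        (hcs.abs.measurable.comp (measurable_traj G α 0))
    · rintro ⟨ω, x⟩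
      have h := rowLaw_deviation (lowNbrs G δ i) (fun j k => sinC (x j + quarter k)) (fun _ => 0)
        (c := 1) (r := 0) one_pos le_rfl (fun j _ k => abs_sinC_le_one _) (card_lowNbrs_le G δ i)
        (fun j _ => by rw [sum_sinC_add_quarter]; simp) hs
      simp only [sub_zero, mul_zero, add_zero, one_pow, mul_one] at h
      refine (measureReal_mono fun η hη => ?_).trans (h.trans (by linarith))
      have h1 : s * (1 + 2 * Real.pi * ρ) + topDeg G * (6 * Real.pi ^ 2 * ρ ^ 2) ≤
        |lowSum G δ i (fun j => x j + quarter (η j))| := hη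
      refine le_trans ?_ h1
      have : 0 ≤ s * (2 * Real.pi * ρ) := by positivity
      have : 0 ≤ topDeg G * (6 * Real.pi ^ 2 * ρ ^ 2) := by positivity
      linarith
  | succ t =>
    have hcm : Continuous fun y : Fin N → UnitAddCircle =>
        ∑ j ∈ lowNbrs G δ i, meanShift G α y j := by
      have := continuous_drift
      unfold meanShift
      fun_prop
    have hb : ∀ j ∈ lowNbrs G δ i, 17 / 6 * (α / topDeg G * deg G j) ≤ ρ := by
      intro j hj
      have := (deg_lt_of_mem_lowNbrs G hj).le
      rw [hρ]
      gcongr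
    have hb2 : ∀ j ∈ lowNbrs G δ i, α / topDeg G * deg G j / 3.6 ≤ ρ := by
      intro j hj
      refine le_trans ?_ (hb j hj)
      have : 0 ≤ α / topDeg G * deg G j := by positivity
      norm_num
      linarith
    have h1 : (dynProb N).real {p | (traj G α p.1 p.2 t, traj G α p.1 p.2 (t + 1)) ∈
        {q : (Fin N → UnitAddCircle) × (Fin N → UnitAddCircle) |
          s + topDeg G * (4 * Real.pi ^ 2 * ρ ^ 2) ≤
            |lowSum G δ i q.2 - ∑ j ∈ lowNbrs G δ i, meanShift G α q.1 j|}} ≤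
        2 * Real.exp (-s ^ 2 / (2 * topDeg G)) := by
      refine dynProb_step_le G α t (measurableSet_le measurable_const ?_) fun y => ?_
      · exact ((hcs.comp continuous_snd).sub (hcm.comp continuous_fst)).abs.measurable
      · have h := rowLaw_deviation (lowNbrs G δ i)
          (fun j k => sinC (nodeMap 0 (y j) + quarter k + (push G α y j k : UnitAddCircle)))
          (meanShift G α y) (c := 1) (r := 4 * Real.pi ^ 2 * ρ ^ 2) one_pos (by positivity)
          (fun j _ k => abs_sinC_le_one _) (card_lowNbrs_le G δ i)
          (fun j hj => abs_mean_sinC_push_sub_le G α y j fun k =>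
            (abs_push_le G α hα y j k).trans (hb j hj)) hs
        simp only [one_pow, mul_one, Finset.sum_sub_distrib] at h
        exact h
    have h2 : (dynProb N).real {p | traj G α p.1 p.2 t ∈ {y : Fin N → UnitAddCircle |
          s * (2 * Real.pi * ρ) + topDeg G * (2 * Real.pi ^ 2 * ρ ^ 2) ≤
            |∑ j ∈ lowNbrs G δ i, meanShift G α y j|}} ≤
        2 * Real.exp (-s ^ 2 / (2 * topDeg G)) := by
      refine dynProb_traj_le G α hα t (measurableSet_le measurable_const hcm.abs.measurable)
        fun z e he => ?_
      have h := rowLaw_deviation (lowNbrs G δ i)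
          (fun j k => -(Real.pi * (α / topDeg G * deg G j / 3.6)) *
            drift (z j + quarter k + (e j k : UnitAddCircle)))
          (fun _ => 0) (c := 2 * Real.pi * ρ) (r := 2 * Real.pi ^ 2 * ρ ^ 2) (by positivity)
          (by positivity) ?_ (card_lowNbrs_le G δ i) ?_ (s := s * (2 * Real.pi * ρ)) (by positivity)
      · simp only [sub_zero] at h
        have e1 : -(s * (2 * Real.pi * ρ)) ^ 2 / (2 * (topDeg G * (2 * Real.pi * ρ) ^ 2)) =
            -s ^ 2 / (2 * topDeg G) := by
          field_simp
        rw [e1] at h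
        exact h
      · intro j hj k
        rw [abs_mul, abs_neg, abs_of_nonneg (by positivity)]
        calc _ ≤ Real.pi * ρ * 2 := by
              gcongr
              · exact hb2 j hj
              · exact abs_drift_le _
          _ = _ := by ring
      · intro j hj
        rw [sub_zero]
        exact abs_mean_meanShift_le G z e j hα (fun k => (he j k).trans (hb j hj)) (hb2 j hj)
    refine le_trans (measureReal_mono (s₂ := _ ∪ _) fun p hp => ?_)
      ((measureReal_union_le _ _).trans (add_le_add h1 h2 |>.trans_eq (by ring)))
    by_contra hcon
    rw [Set.mem_union, not_or] at hcon
    have c1 : |lowSum G δ i (traj G α p.1 p.2 (t + 1)) -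
        ∑ j ∈ lowNbrs G δ i, meanShift G α (traj G α p.1 p.2 t) j| <
        s + topDeg G * (4 * Real.pi ^ 2 * ρ ^ 2) := not_le.1 hcon.1
    have c2 : |∑ j ∈ lowNbrs G δ i, meanShift G α (traj G α p.1 p.2 t) j| <
        s * (2 * Real.pi * ρ) + topDeg G * (2 * Real.pi ^ 2 * ρ ^ 2) := not_le.1 hcon.2
    have hp' : s * (1 + 2 * Real.pi * ρ) + topDeg G * (6 * Real.pi ^ 2 * ρ ^ 2) ≤
      |lowSum G δ i (traj G α p.1 p.2 (t + 1))| := hp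
    have := abs_sub_abs_le_abs_sub (lowSum G δ i (traj G α p.1 p.2 (t + 1)))
      (∑ j ∈ lowNbrs G δ i, meanShift G α (traj G α p.1 p.2 t) j)
    linarith

/-- On a time window of exponential length all fluctuations stay small. -/
lemma dynProb_window_ge {δ α Δ κ : ℝ} (hα : 0 < α) (hδ : 0 < δ) (hΔ : 0 < Δ)
    (hr1 : 2 * Real.pi * (17 / 6 * (α * δ / Δ)) ≤ 1 / 20)
    (hr2 : 6 * Real.pi ^ 2 * (17 / 6 * (α * δ / Δ)) ^ 2 ≤ Δ ^ (-κ) / 8)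
    (hν : 17 / 6 * (1 - starIndex G Δ δ) ≤ Δ ^ (-κ) / 8)
    (hN : 8 * (N : ℝ) ≤ Real.exp (Δ ^ (1 - 2 * κ))) (t₀ T : ℕ)
    (hT : T ≤ ⌈Real.exp (Δ ^ (1 - 2 * κ))⌉₊) :
    1 - Real.exp (-(Δ ^ (1 - 2 * κ))) ≤
      (dynProb N).real {p | ∀ i ∈ hubs G Δ, ∀ t : ℕ, t₀ ≤ t → t < t₀ + T →
        |fluct G δ α p.1 p.2 i t| ≤ 3 * α * Δ ^ (-κ)} := by
  have hπ := Real.pi_pos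
  set D := Δ ^ (1 - 2 * κ) with hD
  have hDpos : 0 < D := Real.rpow_pos_of_pos hΔ _
  set K := Δ ^ (-κ) with hK
  have hKpos : 0 < K := Real.rpow_pos_of_pos hΔ _
  have hKD : Δ * K ^ 2 = D := by
    rw [hK, hD, ← Real.rpow_natCast, ← Real.rpow_mul hΔ.le]
    nth_rewrite 1 [← Real.rpow_one Δ]
    rw [← Real.rpow_add hΔ]
    congr 1; push_cast; ring
  -- The deviation 5/2 K Δ₀ fits because 5/2 (1 + 1/20) + 1/8 ≤ 3 - 1/8, and its Hoeffding exponent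
  -- has the constant (5/2)²/2 = 17/8 + 1.
  have hone : ∀ i ∈ hubs G Δ, ∀ t : ℕ,
      (dynProb N).real {p | 3 * α * K < |fluct G δ α p.1 p.2 i t|} ≤
        4 * Real.exp (-(17 / 8 + 1) * D) := by
    intro i hi t
    have hDΔ : Δ < topDeg G := lt_topDeg_of_mem_hubs G hi
    have hD0 : (0 : ℝ) < topDeg G := hΔ.trans hDΔ
    set ρ := 17 / 6 * (α / topDeg G * δ) with hρ
    have hρ0 : 0 < ρ := by positivity
    have hρr : ρ ≤ 17 / 6 * (α * δ / Δ) := by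
      rw [hρ, div_mul_eq_mul_div α]; gcongr
    have h := dynProb_abs_lowSum_ge_le G hα hδ hΔ hi hρ t (s := 5 / 2 * topDeg G * K)
      (by positivity)
    refine (measureReal_mono fun p hp => ?_).trans (h.trans ?_)
    · have hp' : 3 * α * K < |fluct G δ α p.1 p.2 i t| := hp
      have hf := abs_fluct_sub_le G (δ := δ) hα hΔ p.1 p.2 hi t
      have hf' : |fluct G δ α p.1 p.2 i t - α / topDeg G *
        lowSum G δ i (traj G α p.1 p.2 t)| ≤ 17 / 6 * α * (1 - starIndex G Δ δ) := hf
      have h1 := abs_sub_abs_le_abs_sub (fluct G δ α p.1 p.2 i t)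
        (α / topDeg G * lowSum G δ i (traj G α p.1 p.2 t))
      rw [abs_mul, abs_of_pos (by positivity : 0 < α / (topDeg G : ℝ))] at h1
      set L := |lowSum G δ i (traj G α p.1 p.2 t)| with hL
      have h2 : 17 / 6 * α * (1 - starIndex G Δ δ) ≤ α * (K / 8) := by
        calc _ = α * (17 / 6 * (1 - starIndex G Δ δ)) := by ring
          _ ≤ _ := by gcongr
      have h3 : α * (3 * K - K / 8) ≤ α / topDeg G * L := by linarith
      have h4 : (3 * K - K / 8) * topDeg G ≤ L := by
        have : α * ((3 * K - K / 8) * topDeg G) ≤ α * L := by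
          calc _ = α * (3 * K - K / 8) * topDeg G := by ring
            _ ≤ α / topDeg G * L * topDeg G := by gcongr
            _ = _ := by field_simp
        exact le_of_mul_le_mul_left this hα
      change _ ≤ L
      refine le_trans ?_ h4
      have h5 : 2 * Real.pi * ρ ≤ 1 / 20 := le_trans (by gcongr) hr1
      have h6 : 6 * Real.pi ^ 2 * ρ ^ 2 ≤ K / 8 := le_trans (by gcongr) hr2
      calc _ ≤ 5 / 2 * topDeg G * K * (1 + 1 / 20) + topDeg G * (K / 8) := by gcongr
        _ ≤ _ := by
          have : 0 < K * topDeg G := by positivity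
          linarith
    · have : (17 / 8 + 1) * D ≤ (5 / 2 * topDeg G * K) ^ 2 / (2 * topDeg G) := by
        calc (17 / 8 + 1) * D = (17 / 8 + 1) * (Δ * K ^ 2) := by rw [hKD]
          _ ≤ (17 / 8 + 1) * (topDeg G * K ^ 2) := by gcongr
          _ = _ := by field_simp; ring
      rw [neg_div, neg_mul]
      gcongr
  set A : Set (Noise N × (Fin N → UnitAddCircle)) := {p | ∀ i ∈ hubs G Δ, ∀ t : ℕ, t₀ ≤ t →
    t < t₀ + T → |fluct G δ α p.1 p.2 i t| ≤ 3 * α * K} with hA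
  have hbad : (dynProb N).real Aᶜ ≤ Real.exp (-D) := by
    have hsub : Aᶜ ⊆ ⋃ i ∈ hubs G Δ, ⋃ t ∈ Finset.Ico t₀ (t₀ + T),
        {p | 3 * α * K < |fluct G δ α p.1 p.2 i t|} := by
      intro p hp
      simp only [hA, Set.mem_compl_iff, Set.mem_ofPred_eq, not_forall, not_le] at hp
      obtain ⟨i, hi, t, ht1, ht2, hlt⟩ := hp
      simp only [Set.mem_iUnion, Finset.mem_Ico]
      exact ⟨i, hi, t, ⟨ht1, ht2⟩, hlt⟩
    have hMN : ((hubs G Δ).card : ℝ) ≤ N := by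
      have := Finset.card_le_univ (hubs G Δ)
      rw [Fintype.card_fin] at this
      exact_mod_cast this
    -- The window costs e^D and, by `hN`, the hubs another e^D. From the exponent 25/8 D this leaves
    -- 9/8 D.
    have hT2 : (T : ℝ) ≤ 2 * Real.exp D := by
      have h1 : (T : ℝ) ≤ ⌈Real.exp D⌉₊ := by exact_mod_cast hT
      have h2 := Nat.ceil_lt_add_one (Real.exp_pos D).le
      have h3 := Real.one_le_exp hDpos.le
      linarith
    calc (dynProb N).real Aᶜ ≤ (dynProb N).real (⋃ i ∈ hubs G Δ, ⋃ t ∈ Finset.Ico t₀ (t₀ + T),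
        {p | 3 * α * K < |fluct G δ α p.1 p.2 i t|}) :=
          measureReal_mono hsub (measure_ne_top _ _)
      _ ≤ (hubs G Δ).card • ((T : ℝ) * (4 * Real.exp (-(17 / 8 + 1) * D))) := by
          refine (measureReal_biUnion_finset_le _ _).trans (Finset.sum_le_card_nsmul _ _ _
            fun i hi => (measureReal_biUnion_finset_le _ _).trans ?_)
          refine (Finset.sum_le_card_nsmul _ _ _ fun t _ => hone i hi t).trans_eq ?_
          rw [Nat.card_Ico, nsmul_eq_mul, Nat.add_sub_cancel_left]
      _ ≤ N * ((2 * Real.exp D) * (4 * Real.exp (-(17 / 8 + 1) * D))) := by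
          rw [nsmul_eq_mul]; gcongr
      _ = 8 * N * Real.exp (-(17 / 8) * D) := by
          rw [show -(17 / 8) * D = D + -(17 / 8 + 1) * D by ring, Real.exp_add]; ring
      _ ≤ Real.exp D * Real.exp (-(17 / 8) * D) := by gcongr
      _ = Real.exp (-(9 / 8) * D) := by rw [← Real.exp_add]; congr 1; ring
      _ ≤ Real.exp (-D) := Real.exp_le_exp.2 (by linarith)
  have := one_sub_measureReal_compl_le (dynProb N) A
  linarith

end FixedTime


/-! ### A Chernoff bound for independent Bernoulli variables -/

section Chernoff

/-- Exponential Markov inequality at parameter 1, with 1 + p(e - 1) ≤ 1 + 2p ≤ e^(2p) for each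
factor. -/
lemma pi_bernoulli_chernoff {ι : Type*} [Fintype ι] (p : ι → unitInterval) (E : Finset ι) (s : ℝ) :
    (Measure.pi fun e => bernoulliMeasure true false (p e)).real
      {c | s ≤ ∑ e ∈ E, if c e = true then (1 : ℝ) else 0} ≤
      Real.exp (2 * ∑ e ∈ E, (p e : ℝ) - s) := by
  classical
  have h := measure_ge_le_exp_mul_mgf (μ := Measure.pi fun e => bernoulliMeasure true false (p e))
    (X := fun c => ∑ e ∈ E, if c e = true then (1 : ℝ) else 0) (t := 1) s zero_le_one
    Integrable.of_finite
  refine h.trans ?_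
  have hmgf : mgf (fun c => ∑ e ∈ E, if c e = true then (1 : ℝ) else 0)
      (Measure.pi fun e => bernoulliMeasure true false (p e)) 1 ≤
      Real.exp (2 * ∑ e ∈ E, (p e : ℝ)) := by
    have h1 : ∀ c : ι → Bool, Real.exp (1 * ∑ e ∈ E, if c e = true then (1 : ℝ) else 0) =
        ∏ e, if e ∈ E then Real.exp (if c e = true then (1 : ℝ) else 0) else 1 := by
      intro c
      rw [Finset.prod_ite_mem, Finset.univ_inter, ← Real.exp_sum, one_mul]
    rw [mgf]
    simp only [h1]
    rw [integral_fintype_prod_eq_prod (fun e b =>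
      if e ∈ E then Real.exp (if b = true then (1 : ℝ) else 0) else 1), Finset.mul_sum,
      Real.exp_sum, ← Finset.univ_inter E, ← Finset.prod_ite_mem, Finset.univ_inter]
    refine Finset.prod_le_prod (fun e _ => integral_nonneg fun b => ?_) fun e _ => ?_
    · simp only [Pi.zero_apply]
      split_ifs <;> positivity
    · split_ifs with he
      · rw [integral_bernoulliMeasure]
        simp only [if_true, Bool.false_eq_true, if_false, Real.exp_zero, smul_eq_mul, mul_one]
        have hp0 := (p e).2.1
        have h3 := Real.exp_one_lt_d9
        have h4 := Real.add_one_le_exp (2 * (p e : ℝ))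
        simp
        nlinarith
      · simp
  calc _ ≤ Real.exp (-1 * s) * Real.exp (2 * ∑ e ∈ E, (p e : ℝ)) := by gcongr
    _ = _ := by rw [← Real.exp_add]; congr 1; ring

end Chernoff

/-! ### Neighbourhoods in the Chung–Lu graph -/

section ChungLuGraph

variable {N : ℕ}

/-- The linking probability of two nodes. -/
def linkProb (β w m : ℝ) (N : ℕ) (i j : Fin N) : unitInterval :=
  Set.projIcc (0 : ℝ) 1 zero_le_one
    (expDeg β w m N i * expDeg β w m N j / ∑ k : Fin N, expDeg β w m N k)

lemma linkProb_comm (β w m : ℝ) (i j : Fin N) :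
    linkProb β w m N i j = linkProb β w m N j i := by
  rw [linkProb, linkProb, mul_comm]

/-- The pairs that join `i` to a node of `S`. -/
def pairsTo (i : Fin N) (S : Finset (Fin N)) : Finset (NodePair N) :=
  Finset.univ.filter fun e => (e.1.1 = i ∧ e.1.2 ∈ S) ∨ (e.1.2 = i ∧ e.1.1 ∈ S)

/-- The end of `e` that is not `i`. -/
def otherEnd (i : Fin N) (e : NodePair N) : Fin N := if e.1.1 = i then e.1.2 else e.1.1

lemma card_nbrs_inter_le (c : NodePair N → Bool) (i : Fin N) (S : Finset (Fin N)) :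
    ((nbrs (graphOf c) i ∩ S).card : ℝ) ≤
      ∑ e ∈ pairsTo i S, if c e = true then (1 : ℝ) else 0 := by
  have hsub : nbrs (graphOf c) i ∩ S ⊆
      ((pairsTo i S).filter fun e => c e = true).image (otherEnd i) := by
    intro j hj
    obtain ⟨hj, hS⟩ := Finset.mem_inter.1 hj
    have hadj : (graphOf c).Adj i j := by simpa [nbrs] using hj
    rcases hadj with ⟨h, hc⟩ | ⟨h, hc⟩
    · refine Finset.mem_image.2 ⟨⟨(i, j), h⟩, ?_, by simp [otherEnd]⟩
      simp [pairsTo, hc, hS]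
    · refine Finset.mem_image.2 ⟨⟨(j, i), h⟩, ?_, by simp [otherEnd, h.ne]⟩
      simp [pairsTo, hc, hS]
  have h1 := (Finset.card_le_card hsub).trans Finset.card_image_le
  rw [Finset.card_filter] at h1
  calc ((nbrs (graphOf c) i ∩ S).card : ℝ) ≤
      ((∑ e ∈ pairsTo i S, if c e = true then 1 else 0 : ℕ) : ℝ) := by exact_mod_cast h1
    _ = _ := by push_cast; rfl

/-- A pair through i is determined by its other end, so no node of S is counted twice. -/
lemma sum_pairsTo_le (β w m : ℝ) (i : Fin N) (S : Finset (Fin N)) :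
    ∑ e ∈ pairsTo i S, (linkProb β w m N e.1.1 e.1.2 : ℝ) ≤
      ∑ j ∈ S, (linkProb β w m N i j : ℝ) := by
  have hinj : Set.InjOn (otherEnd i) (pairsTo i S : Set (NodePair N)) := by
    rintro ⟨⟨a, b⟩, h⟩ he ⟨⟨a', b'⟩, h'⟩ he' heq
    simp only [pairsTo, Finset.coe_filter, Finset.mem_univ, true_and, Set.mem_ofPred_eq] at he he'
    simp only [otherEnd] at heq
    simp only at h h'
    rw [Subtype.mk.injEq, Prod.mk.injEq]
    rcases he with ⟨rfl, -⟩ | ⟨rfl, -⟩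
    · rcases he' with ⟨rfl, -⟩ | ⟨rfl, -⟩
      · simpa using heq
      · rw [if_pos rfl, if_neg h'.ne] at heq
        subst heq
        exact absurd h (not_lt.2 h'.le)
    · rcases he' with ⟨rfl, -⟩ | ⟨rfl, -⟩
      · rw [if_pos rfl, if_neg h.ne] at heq
        subst heq
        exact absurd h (not_lt.2 h'.le)
      · rw [if_neg h.ne, if_neg h'.ne] at heq
        exact ⟨heq, rfl⟩
  have hval : ∀ e ∈ pairsTo i S, (linkProb β w m N e.1.1 e.1.2 : ℝ) =
      (linkProb β w m N i (otherEnd i e) : ℝ) := by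
    rintro ⟨⟨a, b⟩, h⟩ he
    simp only [pairsTo, Finset.mem_filter, Finset.mem_univ, true_and] at he
    simp only [otherEnd]
    simp only at h
    rcases he with ⟨rfl, -⟩ | ⟨rfl, -⟩
    · rw [if_pos rfl]
    · rw [if_neg h.ne, linkProb_comm]
  rw [Finset.sum_congr rfl hval, ← Finset.sum_image hinj (f := fun j =>
    (linkProb β w m N i j : ℝ))]
  refine Finset.sum_le_sum_of_subset_of_nonneg ?_ fun j _ _ => (linkProb β w m N i j).2.1
  intro j hj
  obtain ⟨⟨⟨a, b⟩, h⟩, he, rfl⟩ := Finset.mem_image.1 hj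
  simp only [pairsTo, Finset.mem_filter, Finset.mem_univ, true_and] at he
  simp only [otherEnd]
  simp only at h
  rcases he with ⟨rfl, hS⟩ | ⟨rfl, hS⟩
  · rwa [if_pos rfl]
  · rwa [if_neg h.ne]

instance (β w m : ℝ) : IsProbabilityMeasure (chungLu β w m N) := by
  unfold chungLu; infer_instance

lemma chungLu_card_nbrs_inter_ge_le (β w m : ℝ) (i : Fin N) (S : Finset (Fin N)) {μ : ℝ} (s : ℝ)
    (hμ : ∑ j ∈ S, (linkProb β w m N i j : ℝ) ≤ μ) :
    (chungLu β w m N).real {c | s ≤ ((nbrs (graphOf c) i ∩ S).card : ℝ)} ≤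
      Real.exp (2 * μ - s) := by
  have h := pi_bernoulli_chernoff (fun e : NodePair N => linkProb β w m N e.1.1 e.1.2)
    (pairsTo i S) s
  refine (measureReal_mono fun c hc => ?_).trans (h.trans ?_)
  · exact le_trans hc (card_nbrs_inter_le c i S)
  · have := sum_pairsTo_le β w m i S
    refine Real.exp_le_exp.2 ?_
    linarith

end ChungLuGraph

/-! ### The expected degrees -/

section ExpectedDegrees

variable {N : ℕ} {β w m : ℝ}

lemma expDeg_pos (hβ : 2 < β) (hw : 0 < w) (hm : 0 < m) (i : Fin N) :
    0 < expDeg β w m N i := by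
  have hN : (0 : ℝ) < N := by exact_mod_cast i.pos
  have h1 : 0 < β - 1 := by linarith
  have h2 : 0 < β - 2 := by linarith
  rw [expDeg]
  positivity

/-- The sequence decreases in i, and its offset is calibrated so that index 0 has the value m. -/
lemma expDeg_le (hβ : 2 < β) (hw : 0 < w) (hm : 0 < m) (i : Fin N) :
    expDeg β w m N i ≤ m := by
  have hN : (0 : ℝ) < N := by exact_mod_cast i.pos
  have h1 : 0 < β - 1 := by linarith
  have h2 : 0 < β - 2 := by linarith
  set q := w * (β - 2) / (m * (β - 1)) with hq
  have hq0 : 0 < q := by positivity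
  have hanti : ((N : ℝ) * q ^ (β - 1) + (i.val : ℝ)) ^ (-(1 / (β - 1))) ≤
      ((N : ℝ) * q ^ (β - 1)) ^ (-(1 / (β - 1))) := by
    refine Real.rpow_le_rpow_of_nonpos (by positivity) ?_ ?_
    · have : (0 : ℝ) ≤ i.val := by positivity
      linarith
    · rw [neg_nonpos]; positivity
  have hval : ((N : ℝ) * q ^ (β - 1)) ^ (-(1 / (β - 1))) = (N : ℝ) ^ (-(1 / (β - 1))) * q⁻¹ := by
    rw [Real.mul_rpow hN.le (by positivity), ← Real.rpow_mul hq0.le,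
      show (β - 1) * -(1 / (β - 1)) = -1 by field_simp, Real.rpow_neg_one]
  rw [expDeg, ← hq]
  calc _ ≤ (β - 2) / (β - 1) * w * (N : ℝ) ^ (1 / (β - 1)) *
        ((N : ℝ) ^ (-(1 / (β - 1))) * q⁻¹) := by
        rw [← hval]; gcongr
    _ = (β - 2) / (β - 1) * w * ((N : ℝ) ^ (1 / (β - 1)) * (N : ℝ) ^ (-(1 / (β - 1)))) *
        q⁻¹ := by ring
    _ = m := by
        rw [← Real.rpow_add hN, add_neg_cancel, Real.rpow_zero, hq]
        field_simp

lemma le_expDeg (hβ : 2 < β) (hw : 0 < w) (hm : 0 < m) (hwm : w ≤ m) (i : Fin N) :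
    (β - 2) / (β - 1) * 2 ^ (-(1 / (β - 1))) * w ≤ expDeg β w m N i := by
  have hN : (0 : ℝ) < N := by exact_mod_cast i.pos
  have h1 : 0 < β - 1 := by linarith
  have h2 : 0 < β - 2 := by linarith
  set q := w * (β - 2) / (m * (β - 1)) with hq
  have hq0 : 0 < q := by positivity
  have hq1 : q ≤ 1 := by
    rw [hq, div_le_one (by positivity)]
    nlinarith
  have hqp : q ^ (β - 1) ≤ 1 := Real.rpow_le_one hq0.le hq1 h1.le
  have hi : (i.val : ℝ) ≤ N := by exact_mod_cast i.2.le
  have hanti : (2 * (N : ℝ)) ^ (-(1 / (β - 1))) ≤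
      ((N : ℝ) * q ^ (β - 1) + (i.val : ℝ)) ^ (-(1 / (β - 1))) := by
    refine Real.rpow_le_rpow_of_nonpos (by positivity) ?_ ?_
    · nlinarith
    · rw [neg_nonpos]; positivity
  rw [expDeg, ← hq]
  calc _ = (β - 2) / (β - 1) * w * ((N : ℝ) ^ (1 / (β - 1)) * (N : ℝ) ^ (-(1 / (β - 1)))) *
        2 ^ (-(1 / (β - 1))) := by
        rw [← Real.rpow_add hN, add_neg_cancel, Real.rpow_zero]; ring
    _ = (β - 2) / (β - 1) * w * (N : ℝ) ^ (1 / (β - 1)) * (2 * (N : ℝ)) ^ (-(1 / (β - 1))) := by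
        rw [Real.mul_rpow (by norm_num) hN.le]; ring
    _ ≤ _ := by gcongr

lemma expDeg_le_rpow (hβ : 2 < β) (hw : 0 < w) (hm : 0 < m) (i : Fin N) (hi : 0 < i.val) :
    expDeg β w m N i ≤ (β - 2) / (β - 1) * w * (N : ℝ) ^ (1 / (β - 1)) *
      (i.val : ℝ) ^ (-(1 / (β - 1))) := by
  have hN : (0 : ℝ) < N := by exact_mod_cast i.pos
  have h1 : 0 < β - 1 := by linarith
  have h2 : 0 < β - 2 := by linarith
  have hi' : (0 : ℝ) < i.val := by exact_mod_cast hi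
  rw [expDeg]
  gcongr ?_ * ?_
  refine Real.rpow_le_rpow_of_nonpos hi' ?_ ?_
  · have : 0 ≤ (N : ℝ) * (w * (β - 2) / (m * (β - 1))) ^ (β - 1) := by positivity
    linarith
  · rw [neg_nonpos]; positivity

/-- Integral comparison in discrete form: by Bernoulli's inequality the right side grows by at least
(n+1)^(-a) at each step. -/
lemma sum_rpow_neg_le {a : ℝ} (ha0 : 0 < a) (ha1 : a < 1) (n : ℕ) :
    ∑ k ∈ Finset.Icc 1 n, (k : ℝ) ^ (-a) ≤ (n : ℝ) ^ (1 - a) / (1 - a) := by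
  induction n with
  | zero =>
    simp only [Finset.Icc_eq_empty (by norm_num : ¬ (1 ≤ 0)), Finset.sum_empty]
    have : 0 < 1 - a := by linarith
    positivity
  | succ n ih =>
    rw [Finset.sum_Icc_succ_top (by omega)]
    have hb : 0 < 1 - a := by linarith
    have hn : (0 : ℝ) < (n : ℝ) + 1 := by positivity
    have h := rpow_one_add_le_one_add_mul_self (s := -1 / ((n : ℝ) + 1)) (p := 1 - a)
      (by rw [le_div_iff₀ hn]; linarith [(Nat.cast_nonneg n : (0 : ℝ) ≤ n)]) hb.le (by linarith)
    have h2 : 1 + -1 / ((n : ℝ) + 1) = n / (n + 1) := by field_simp; ring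
    rw [h2, Real.div_rpow (by positivity) hn.le, div_le_iff₀ (by positivity)] at h
    have h3 : ((n : ℝ) + 1) ^ (1 - a) = (n + 1) * ((n : ℝ) + 1) ^ (-a) := by
      rw [sub_eq_add_neg, Real.rpow_add hn, Real.rpow_one]
    have h4 : (1 + (1 - a) * (-1 / ((n : ℝ) + 1))) * ((n : ℝ) + 1) ^ (1 - a) =
        ((n : ℝ) + 1) ^ (1 - a) - (1 - a) * ((n : ℝ) + 1) ^ (-a) := by
      rw [h3]; field_simp; ring
    rw [h4] at h
    push_cast
    rw [le_div_iff₀ hb] at ih ⊢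
    nlinarith

/-- The total expected degree of the nodes with expected degree above `θ`, except the first one. -/
lemma sum_expDeg_large_le (hβ : 2 < β) (hw : 0 < w) (hm : 0 < m) {θ : ℝ} (hθ : 0 < θ) :
    ∑ j ∈ Finset.univ.filter (fun j : Fin N => 0 < j.val ∧ θ < expDeg β w m N j),
      expDeg β w m N j ≤ ((β - 2) / (β - 1)) ^ (β - 2) * w * N * (w / θ) ^ (β - 2) := by
  rcases Nat.eq_zero_or_pos N with rfl | hNpos
  · simp
  have hN : (0 : ℝ) < N := by exact_mod_cast hNpos
  have h1 : 0 < β - 1 := by linarith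
  have h2 : 0 < β - 2 := by linarith
  set a := 1 / (β - 1) with ha
  have ha0 : 0 < a := by positivity
  have ha1 : a < 1 := by rw [ha, div_lt_one h1]; linarith
  have hca : 1 - a = (β - 2) / (β - 1) := by rw [ha]; field_simp; ring
  set c := (β - 2) / (β - 1) with hc
  have hc0 : 0 < c := by positivity
  set A := c * w * (N : ℝ) ^ a with hA
  have hA0 : 0 < A := by positivity
  -- Since w_j ≤ A j^(-a), only indices up to this n can exceed θ.
  set n := ⌊(A / θ) ^ (β - 1)⌋₊ with hn
  have hJ0 : 0 ≤ (A / θ) ^ (β - 1) := by positivity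
  set S := Finset.univ.filter (fun j : Fin N => 0 < j.val ∧ θ < expDeg β w m N j) with hS
  have hmem : ∀ j ∈ S, j.val ∈ Finset.Icc 1 n := by
    intro j hj
    simp only [hS, Finset.mem_filter, Finset.mem_univ, true_and] at hj
    have hj' : (0 : ℝ) < j.val := by exact_mod_cast hj.1
    rw [Finset.mem_Icc]
    refine ⟨hj.1, Nat.le_floor ?_⟩
    have h3 := hj.2.trans_le (expDeg_le_rpow hβ hw hm j hj.1)
    rw [← ha, ← hc, ← hA, Real.rpow_neg hj'.le, ← div_eq_mul_inv, lt_div_iff₀ (by positivity)] at h3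
    have h4 : (j.val : ℝ) ^ a ≤ A / θ := by rw [le_div_iff₀ hθ]; linarith
    calc (j.val : ℝ) = ((j.val : ℝ) ^ a) ^ (β - 1) := by
          rw [← Real.rpow_mul hj'.le, ha, one_div_mul_cancel h1.ne', Real.rpow_one]
      _ ≤ _ := by gcongr
  calc ∑ j ∈ S, expDeg β w m N j ≤ ∑ j ∈ S, A * (j.val : ℝ) ^ (-a) := by
        refine Finset.sum_le_sum fun j hj => ?_
        simp only [hS, Finset.mem_filter, Finset.mem_univ, true_and] at hj
        exact expDeg_le_rpow hβ hw hm j hj.1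
    _ = ∑ k ∈ S.image Fin.val, A * (k : ℝ) ^ (-a) := by
        rw [Finset.sum_image (fun x _ y _ h => Fin.ext h)]
    _ ≤ ∑ k ∈ Finset.Icc 1 n, A * (k : ℝ) ^ (-a) := by
        refine Finset.sum_le_sum_of_subset_of_nonneg ?_ fun k _ _ => by positivity
        intro k hk
        obtain ⟨j, hj, rfl⟩ := Finset.mem_image.1 hk
        exact hmem j hj
    _ = A * ∑ k ∈ Finset.Icc 1 n, (k : ℝ) ^ (-a) := by rw [Finset.mul_sum]
    _ ≤ A * ((n : ℝ) ^ (1 - a) / (1 - a)) := by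
        gcongr
        exact sum_rpow_neg_le ha0 ha1 n
    _ ≤ A * (((A / θ) ^ (β - 1)) ^ c / c) := by
        rw [hca]
        gcongr
        exact Nat.floor_le hJ0
    _ = A / c * (A / θ) ^ (β - 2) := by
        rw [← Real.rpow_mul (by positivity), show (β - 1) * c = β - 2 by rw [hc]; field_simp]
        ring
    _ = w * (N : ℝ) ^ a * (c ^ (β - 2) * (w / θ) ^ (β - 2) * ((N : ℝ) ^ a) ^ (β - 2)) := by
        rw [← Real.mul_rpow (by positivity) (by positivity),
          ← Real.mul_rpow (by positivity) (by positivity), hA]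
        congr 2
        · field_simp
        · ring
    _ = c ^ (β - 2) * w * ((N : ℝ) ^ a * ((N : ℝ) ^ a) ^ (β - 2)) * (w / θ) ^ (β - 2) := by ring
    _ = _ := by
        congr 2
        rw [← Real.rpow_mul hN.le, ← Real.rpow_add hN,
          show a + a * (β - 2) = 1 by rw [ha]; field_simp; ring, Real.rpow_one]

lemma linkProb_le (hβ : 2 < β) (hw : 0 < w) (hm : 0 < m) (i j : Fin N) :
    (linkProb β w m N i j : ℝ) ≤
      expDeg β w m N i * expDeg β w m N j / ∑ k : Fin N, expDeg β w m N k := by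
  have h1 := expDeg_pos hβ hw hm i
  have h2 := expDeg_pos hβ hw hm j
  have h3 : 0 ≤ ∑ k : Fin N, expDeg β w m N k :=
    Finset.sum_nonneg fun k _ => (expDeg_pos hβ hw hm k).le
  rw [linkProb, Set.coe_projIcc]
  exact max_le (by positivity) (min_le_right _ _)

lemma sum_linkProb_le (hβ : 2 < β) (hw : 0 < w) (hm : 0 < m) (i : Fin N) :
    ∑ j, (linkProb β w m N i j : ℝ) ≤ expDeg β w m N i := by
  have h3 : 0 < ∑ k : Fin N, expDeg β w m N k :=
    Finset.sum_pos (fun k _ => expDeg_pos hβ hw hm k) ⟨i, Finset.mem_univ i⟩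
  calc _ ≤ ∑ j, expDeg β w m N i * expDeg β w m N j / ∑ k : Fin N, expDeg β w m N k :=
        Finset.sum_le_sum fun j _ => linkProb_le hβ hw hm i j
    _ = _ := by
        rw [← Finset.sum_div, ← Finset.mul_sum]
        field_simp

/-- A constant depending on the exponent `β` only. -/
def largeConst (β : ℝ) : ℝ :=
  ((β - 2) / (β - 1)) ^ (β - 2) / ((β - 2) / (β - 1) * 2 ^ (-(1 / (β - 1))))

/-- Index 0, where the power bound is not available, is charged probability 1. For the others w_i ≤
m, and the total weight is at least a constant times wN, which cancels the factor wN of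
`sum_expDeg_large_le`. -/
lemma sum_linkProb_large_le (hβ : 2 < β) (hw : 0 < w) (hm : 0 < m) (hwm : w ≤ m) {θ : ℝ}
    (hθ : 0 < θ) (i : Fin N) :
    ∑ j ∈ Finset.univ.filter (fun j : Fin N => θ < expDeg β w m N j),
      (linkProb β w m N i j : ℝ) ≤ 1 + m * largeConst β * (w / θ) ^ (β - 2) := by
  have hN : (0 : ℝ) < N := by exact_mod_cast i.pos
  have h1 : 0 < β - 1 := by linarith
  have h2 : 0 < β - 2 := by linarith
  set W := ∑ k : Fin N, expDeg β w m N k with hW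
  set c₁ := (β - 2) / (β - 1) * 2 ^ (-(1 / (β - 1))) with hc₁
  have hc₁0 : 0 < c₁ := by positivity
  have hWge : c₁ * w * N ≤ W := by
    have := Finset.card_nsmul_le_sum Finset.univ (fun k : Fin N => expDeg β w m N k) (c₁ * w)
      fun k _ => le_expDeg hβ hw hm hwm k
    rw [Finset.card_univ, Fintype.card_fin, nsmul_eq_mul] at this
    rw [hW]
    linarith
  have hW0 : 0 < W := lt_of_lt_of_le (by positivity) hWge
  set z : Fin N := ⟨0, i.pos⟩ with hz
  have hsub : Finset.univ.filter (fun j : Fin N => θ < expDeg β w m N j) ⊆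
      {z} ∪ Finset.univ.filter (fun j : Fin N => 0 < j.val ∧ θ < expDeg β w m N j) := by
    intro j hj
    simp only [Finset.mem_filter, Finset.mem_univ, true_and, Finset.mem_union,
      Finset.mem_singleton] at hj ⊢
    rcases Nat.eq_zero_or_pos j.val with h | h
    · left; exact Fin.ext h
    · right; exact ⟨h, hj⟩
  have hnn : ∀ j, (0 : ℝ) ≤ linkProb β w m N i j := fun j => (linkProb β w m N i j).2.1
  calc _ ≤ ∑ j ∈ {z} ∪ Finset.univ.filter (fun j : Fin N => 0 < j.val ∧ θ < expDeg β w m N j),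
        (linkProb β w m N i j : ℝ) :=
        Finset.sum_le_sum_of_subset_of_nonneg hsub fun j _ _ => hnn j
    _ ≤ ∑ j ∈ {z}, (linkProb β w m N i j : ℝ) +
        ∑ j ∈ Finset.univ.filter (fun j : Fin N => 0 < j.val ∧ θ < expDeg β w m N j),
          (linkProb β w m N i j : ℝ) := by
        have := Finset.sum_union_inter (s₁ := {z}) (s₂ := Finset.univ.filter
          (fun j : Fin N => 0 < j.val ∧ θ < expDeg β w m N j))
          (f := fun j => (linkProb β w m N i j : ℝ))
        have hi : 0 ≤ ∑ j ∈ {z} ∩ Finset.univ.filter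
          (fun j : Fin N => 0 < j.val ∧ θ < expDeg β w m N j), (linkProb β w m N i j : ℝ) :=
          Finset.sum_nonneg fun j _ => hnn j
        linarith
    _ ≤ 1 + ∑ j ∈ Finset.univ.filter (fun j : Fin N => 0 < j.val ∧ θ < expDeg β w m N j),
          m * expDeg β w m N j / (c₁ * w * N) := by
        rw [Finset.sum_singleton]
        refine add_le_add (linkProb β w m N i z).2.2 (Finset.sum_le_sum fun j _ => ?_)
        refine (linkProb_le hβ hw hm i j).trans ?_
        have := expDeg_le hβ hw hm i
        have h4 := expDeg_pos hβ hw hm j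
        gcongr
    _ = 1 + m * (∑ j ∈ Finset.univ.filter (fun j : Fin N => 0 < j.val ∧ θ < expDeg β w m N j),
          expDeg β w m N j) / (c₁ * w * N) := by
        rw [Finset.mul_sum, Finset.sum_div]
    _ ≤ 1 + m * (((β - 2) / (β - 1)) ^ (β - 2) * w * N * (w / θ) ^ (β - 2)) / (c₁ * w * N) := by
        gcongr
        exact sum_expDeg_large_le hβ hw hm hθ
    _ = _ := by
        rw [largeConst, ← hc₁]
        field_simp

/-- With high probability the star-like index of the Chung–Lu graph is close to one. -/
lemma chungLu_starIndex (hβ : 2 < β) (hw : 0 < w) (hm : 0 < m) (hwm : w ≤ m) {δ Δ : ℝ}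
    (hδ : 0 < δ) (hΔ : 0 < Δ) (hN : 0 < N) :
    1 - (N * Real.exp (-(δ / 2)) + 1 / N) ≤ (chungLu β w m N).real
      {c | 1 - starIndex (graphOf c) Δ δ ≤
        (2 * (1 + m * largeConst β * (w / (δ / 4)) ^ (β - 2)) + 2 * Real.log N) / Δ} := by
  have hN' : (0 : ℝ) < N := by exact_mod_cast hN
  set μ := 1 + m * largeConst β * (w / (δ / 4)) ^ (β - 2) with hμ
  have hlog : 0 ≤ Real.log N := Real.log_natCast_nonneg N
  have hμ0 : 0 ≤ μ := by
    have h1 : 0 < β - 1 := by linarith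
    have h2 : 0 < β - 2 := by linarith
    rw [hμ, largeConst]
    positivity
  -- Outside S, Chernoff gives P(k_j ≥ δ) ≤ exp(2·δ/4 - δ) = e^(-δ/2).
  set S := Finset.univ.filter (fun j : Fin N => δ / 4 < expDeg β w m N j) with hS
  set A := {c : NodePair N → Bool | 1 - starIndex (graphOf c) Δ δ ≤
        (2 * μ + 2 * Real.log N) / Δ} with hA
  -- Off these events the high degree neighbours of a hub all lie in S, and there are at most 2μ + 2
  -- log N of them. The term 2 log N buys failure probability N^(-2) per node.
  have hsub : Aᶜ ⊆ (⋃ j ∈ (Finset.univ \ S), {c | δ ≤ ((nbrs (graphOf c) j ∩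
      Finset.univ).card : ℝ)}) ∪ (⋃ i ∈ (Finset.univ : Finset (Fin N)),
        {c | 2 * μ + 2 * Real.log N ≤ ((nbrs (graphOf c) i ∩ S).card : ℝ)}) := by
    intro c hc
    by_contra hcon
    rw [Set.mem_union, not_or] at hcon
    obtain ⟨h1, h2⟩ := hcon
    simp only [Set.mem_iUnion, not_exists, Finset.mem_univ, forall_true_left, Finset.mem_sdiff,
      true_and, Set.mem_ofPred_eq, not_le, Finset.inter_univ] at h1 h2
    apply hc
    change 1 - starIndex (graphOf c) Δ δ ≤ (2 * μ + 2 * Real.log N) / Δ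
    rw [sub_le_comm, starIndex]
    split_ifs with hh
    · refine Finset.le_inf' _ _ fun i hi => ?_
      have hdeg : Δ < deg (graphOf c) i := by simpa [hubs] using hi
      have hd0 : (0 : ℝ) < deg (graphOf c) i := hΔ.trans hdeg
      have hhigh : highNbrs (graphOf c) δ i ⊆ nbrs (graphOf c) i ∩ S := by
        intro j hj
        simp only [highNbrs, Finset.mem_filter] at hj
        refine Finset.mem_inter.2 ⟨hj.1, ?_⟩
        by_contra hjS
        exact absurd hj.2 (not_le.2 (h1 j hjS))
      have hcard : ((highNbrs (graphOf c) δ i).card : ℝ) ≤ 2 * μ + 2 * Real.log N :=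
        le_trans (by exact_mod_cast Finset.card_le_card hhigh) (h2 i).le
      have hsum := card_low_add_card_high (graphOf c) δ i
      rw [sub_le_comm, nodeIndex]
      calc 1 - ((lowNbrs (graphOf c) δ i).card : ℝ) / deg (graphOf c) i =
          (highNbrs (graphOf c) δ i).card / deg (graphOf c) i := by
            field_simp
            linarith
        _ ≤ (2 * μ + 2 * Real.log N) / Δ := by gcongr
    · have : 0 ≤ (2 * μ + 2 * Real.log N) / Δ := by positivity
      linarith
  have hbad : (chungLu β w m N).real Aᶜ ≤ N * Real.exp (-(δ / 2)) + 1 / N := by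
    refine (measureReal_mono hsub (measure_ne_top _ _)).trans
      ((measureReal_union_le _ _).trans (add_le_add ?_ ?_))
    · refine (measureReal_biUnion_finset_le _ _).trans ((Finset.sum_le_card_nsmul _ _
        (Real.exp (-(δ / 2))) fun j hj => ?_).trans ?_)
      · have hjS : expDeg β w m N j ≤ δ / 4 := by
          simpa [hS] using hj
        refine (chungLu_card_nbrs_inter_ge_le β w m j Finset.univ δ
          ((sum_linkProb_le hβ hw hm j).trans hjS)).trans (Real.exp_le_exp.2 (by linarith))
      · rw [nsmul_eq_mul]
        gcongr
        exact (Finset.card_le_univ _).trans_eq (Fintype.card_fin N)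
    · refine (measureReal_biUnion_finset_le _ _).trans ((Finset.sum_le_card_nsmul _ _
        (1 / (N : ℝ) ^ 2) fun i _ => ?_).trans_eq ?_)
      · refine (chungLu_card_nbrs_inter_ge_le β w m i S (2 * μ + 2 * Real.log N)
          (sum_linkProb_large_le hβ hw hm hwm (by positivity) i)).trans_eq ?_
        rw [← hμ, show 2 * μ - (2 * μ + 2 * Real.log N) = -(Real.log N * 2) by ring, Real.exp_neg,
          Real.exp_mul, Real.exp_log hN', one_div]
        norm_num
      · rw [Finset.card_univ, Fintype.card_fin, nsmul_eq_mul]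
        field_simp
  have := one_sub_measureReal_compl_le (chungLu β w m N) A
  linarith

end ExpectedDegrees


/-! ### Asymptotics of the parameters -/

section Asymptotic

lemma exists_bounds_of_isTheta {f g : ℕ → ℝ} (h : f =Θ[atTop] g) (hf : ∀ N, 0 ≤ f N)
    (hg : ∀ N, 0 ≤ g N) :
    ∃ c₁ > 0, ∃ c₂ > 0, ∀ᶠ N in atTop, c₁ * g N ≤ f N ∧ f N ≤ c₂ * g N := by
  obtain ⟨c₂, h₂, hO⟩ := h.1.exists_pos
  obtain ⟨c₁, h₁, hO'⟩ := h.2.exists_pos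
  refine ⟨c₁⁻¹, inv_pos.2 h₁, c₂, h₂, ?_⟩
  filter_upwards [hO.bound, hO'.bound] with N h3 h4
  rw [Real.norm_of_nonneg (hf N), Real.norm_of_nonneg (hg N)] at h3 h4
  exact ⟨by rwa [inv_mul_le_iff₀ h₁], h3⟩

lemma eventually_exp_neg_rpow_le {c p : ℝ} (hc : 0 < c) (hp : 0 < p) (k : ℝ) :
    ∀ᶠ N : ℕ in atTop, Real.exp (-(c * (N : ℝ) ^ p)) ≤ (N : ℝ) ^ (-k) := by
  have h := ((isLittleO_exp_neg_mul_rpow_atTop hc (-k / p)).comp_tendsto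
    ((tendsto_rpow_atTop hp).comp (tendsto_natCast_atTop_atTop (R := ℝ)))).bound one_pos
  filter_upwards [h] with N hN
  simp only [Function.comp_apply, one_mul, Real.norm_eq_abs, Real.abs_exp, neg_mul] at hN
  rwa [← Real.rpow_mul (Nat.cast_nonneg N), mul_div_cancel₀ _ hp.ne',
    abs_of_nonneg (by positivity)] at hN

lemma eventually_log_le {ε r : ℝ} (hε : 0 < ε) (hr : 0 < r) :
    ∀ᶠ N : ℕ in atTop, Real.log N ≤ ε * (N : ℝ) ^ r := by
  have h := ((isLittleO_log_rpow_atTop hr).comp_tendsto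
    (tendsto_natCast_atTop_atTop (R := ℝ))).bound hε
  filter_upwards [h] with N hN
  simp only [Function.comp_apply, Real.norm_eq_abs] at hN
  rw [abs_of_nonneg (a := (N : ℝ) ^ r) (by positivity)] at hN
  exact (le_abs_self _).trans hN

lemma eventually_le_of_isLittleO {f g : ℕ → ℝ} (h : f =o[atTop] g) (hg : ∀ N, 0 ≤ g N) {ε : ℝ}
    (hε : 0 < ε) : ∀ᶠ N in atTop, f N ≤ ε * g N := by
  filter_upwards [h.bound hε] with N hN
  rw [Real.norm_of_nonneg (hg N)] at hN
  exact (le_abs_self _).trans hN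

/-- The bound for the star-like index of the Chung–Lu graph in terms of `N`. -/
lemma starIndex_bound_le {β w m δ Δ n cHub d e K lam : ℝ} (hβ : 2 < β) (hw : 0 < w) (hm : 0 < m)
    (hn : 1 ≤ Real.log n) (hn0 : 0 < n) (hc : 0 < cHub) (hd : 0 < d) (he : 0 < e) (hK : 0 ≤ K)
    (hΔ : Δ = cHub * m) (hdΔ : d * n ^ (1 / (β - 1)) ≤ Δ) (heδ : e * n ^ (lam / (β - 1)) ≤ δ) :
    (2 * (1 + m * K * (w / (δ / 4)) ^ (β - 2)) + 2 * Real.log n) / Δ ≤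
      (2 * K / cHub * (4 / e) ^ (β - 2) + 4 / d) *
        (n ^ (-(lam * ((β - 2) / (β - 1)))) * w ^ (β - 2) + n ^ (-(1 / (β - 1))) * Real.log n) := by
  have h1 : 0 < β - 1 := by linarith
  have h2 : 0 < β - 2 := by linarith
  have hA : 0 < n ^ (1 / (β - 1)) := by positivity
  have hB : 0 < n ^ (lam / (β - 1)) := by positivity
  have hΔ0 : 0 < Δ := lt_of_lt_of_le (by positivity) hdΔ
  have hδ0 : 0 < δ := lt_of_lt_of_le (by positivity) heδ
  have hfirst : 2 * (m * K * (w / (δ / 4)) ^ (β - 2)) / Δ ≤ 2 * K / cHub * (4 / e) ^ (β - 2) *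
      (n ^ (-(lam * ((β - 2) / (β - 1)))) * w ^ (β - 2)) := by
    have h3 : (w / (δ / 4)) ^ (β - 2) ≤ (w / (e * n ^ (lam / (β - 1)) / 4)) ^ (β - 2) := by
      gcongr
    have h4 : (w / (e * n ^ (lam / (β - 1)) / 4)) ^ (β - 2) =
        (4 / e) ^ (β - 2) * (n ^ (-(lam * ((β - 2) / (β - 1)))) * w ^ (β - 2)) := by
      rw [show w / (e * n ^ (lam / (β - 1)) / 4) = 4 / e * (n ^ (-(lam / (β - 1))) * w) by
        rw [Real.rpow_neg hn0.le]; field_simp, Real.mul_rpow (by positivity) (by positivity),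
        Real.mul_rpow (by positivity) (by positivity), ← Real.rpow_mul hn0.le]
      congr 3
      ring
    calc _ = 2 * K / cHub * (w / (δ / 4)) ^ (β - 2) := by
          rw [hΔ]; field_simp
      _ ≤ 2 * K / cHub * (w / (e * n ^ (lam / (β - 1)) / 4)) ^ (β - 2) := by gcongr
      _ = _ := by rw [h4]; ring
  have hsecond : (2 + 2 * Real.log n) / Δ ≤ 4 / d * (n ^ (-(1 / (β - 1))) * Real.log n) := by
    calc _ ≤ (4 * Real.log n) / (d * n ^ (1 / (β - 1))) := by gcongr; linarith
      _ = _ := by rw [Real.rpow_neg hn0.le]; field_simp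
  have h5 : 0 ≤ 2 * K / cHub * (4 / e) ^ (β - 2) := by positivity
  have h6 : 0 ≤ 4 / d := by positivity
  have h7 : 0 ≤ n ^ (-(lam * ((β - 2) / (β - 1)))) * w ^ (β - 2) := by positivity
  have h8 : 0 ≤ n ^ (-(1 / (β - 1))) * Real.log n := by positivity
  calc _ = 2 * (m * K * (w / (δ / 4)) ^ (β - 2)) / Δ + (2 + 2 * Real.log n) / Δ := by ring
    _ ≤ _ := by nlinarith [mul_nonneg h5 h8, mul_nonneg h6 h7]

/-- As δ grows like a power of N, e^(-δ/2) is at most N^(-2). The sum is thus at most 2/N, stronger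
than required. -/
lemma eventually_fail_prob_le {δ : ℕ → ℝ} {e p : ℝ} (he : 0 < e) (hp : 0 < p)
    (hδ : ∀ᶠ N : ℕ in atTop, e * (N : ℝ) ^ p ≤ δ N) :
    ∀ᶠ N : ℕ in atTop, N * Real.exp (-(δ N / 2)) + 1 / N ≤ 2 * (N : ℝ) ^ (-(1 / 5) : ℝ) := by
  filter_upwards [hδ, eventually_exp_neg_rpow_le (half_pos he) hp 2, eventually_ge_atTop 1]
    with N h1 h2 hN
  have hN' : (1 : ℝ) ≤ N := by exact_mod_cast hN
  have hN0 : (0 : ℝ) < N := by linarith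
  have h3 : Real.exp (-(δ N / 2)) ≤ (N : ℝ) ^ (-2 : ℝ) :=
    (Real.exp_le_exp.2 (by linarith)).trans h2
  have h4 : (N : ℝ) * (N : ℝ) ^ (-2 : ℝ) = (N : ℝ) ^ (-1 : ℝ) := by
    rw [← Real.rpow_one_add' hN0.le (by norm_num)]; norm_num
  have h5 : (N : ℝ) ^ (-1 : ℝ) ≤ (N : ℝ) ^ (-(1 / 5) : ℝ) :=
    Real.rpow_le_rpow_of_exponent_le hN' (by norm_num)
  have h6 : 1 / (N : ℝ) = (N : ℝ) ^ (-1 : ℝ) := by rw [Real.rpow_neg_one, one_div]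
  have h7 := mul_le_mul_of_nonneg_left h3 hN0.le
  linarith

/-- This is where w = o(N^(λ/(β-1))) acts. It gives ν ≥ 1/2 on good graphs, so that hubs have at
least Δ/2 low degree neighbours. -/
lemma eventually_high_fraction_le_half {w : ℕ → ℝ} {β lam C : ℝ} (hβ : 2 < β) (hC : 0 < C)
    (hw0 : ∀ N, 0 < w N) (hw : w =o[atTop] fun N : ℕ => (N : ℝ) ^ (lam / (β - 1))) :
    ∀ᶠ N : ℕ in atTop, C * ((N : ℝ) ^ (-(lam * ((β - 2) / (β - 1)))) * w N ^ (β - 2) +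
      (N : ℝ) ^ (-(1 / (β - 1))) * Real.log N) ≤ 1 / 2 := by
  have h1 : 0 < β - 1 := by linarith
  have h2 : 0 < β - 2 := by linarith
  have hε : 0 < (1 / (4 * C)) ^ (1 / (β - 2)) := by positivity
  filter_upwards [eventually_le_of_isLittleO hw (fun N => by positivity) hε,
    eventually_log_le (ε := 1 / (4 * C)) (by positivity) (one_div_pos.2 h1),
    eventually_ge_atTop 1] with N h3 h4 hN
  have hN0 : (0 : ℝ) < N := by exact_mod_cast hN
  have h5 : (N : ℝ) ^ (-(lam * ((β - 2) / (β - 1)))) * w N ^ (β - 2) ≤ 1 / (4 * C) := by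
    calc _ ≤ (N : ℝ) ^ (-(lam * ((β - 2) / (β - 1)))) *
          ((1 / (4 * C)) ^ (1 / (β - 2)) * (N : ℝ) ^ (lam / (β - 1))) ^ (β - 2) := by
          have := (hw0 N).le
          gcongr
      _ = (N : ℝ) ^ (-(lam * ((β - 2) / (β - 1)))) * (N : ℝ) ^ (lam * ((β - 2) / (β - 1))) *
          (1 / (4 * C)) := by
          rw [Real.mul_rpow (by positivity) (by positivity), ← Real.rpow_mul (by positivity),
            one_div_mul_cancel h2.ne', Real.rpow_one, ← Real.rpow_mul hN0.le,
            show lam / (β - 1) * (β - 2) = lam * ((β - 2) / (β - 1)) by ring]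
          ring
      _ = _ := by rw [← Real.rpow_add hN0, neg_add_cancel, Real.rpow_zero, one_mul]
  have h6 : (N : ℝ) ^ (-(1 / (β - 1))) * Real.log N ≤ 1 / (4 * C) := by
    rw [Real.rpow_neg hN0.le, inv_mul_le_iff₀ (by positivity)]
    linarith
  calc _ ≤ C * (1 / (4 * C) + 1 / (4 * C)) := by gcongr
    _ = 1 / 2 := by field_simp; norm_num

/-- The scale on which the distribution of the fluctuation is normal. -/
lemma smoothing_scale_le {β α δ Δ n d e lam ν Cg Y : ℝ} (hβ : 2 < β) (hlam : 0 < lam)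
    (hlam1 : lam < 1) (hα : 0 < α) (hn : 0 < n) (hd : 0 < d) (hCg : 0 < Cg)
    (hY : 0 ≤ Y) (he : 0 < e)
    (hdΔ : d * n ^ (1 / (β - 1)) ≤ Δ) (heδ : δ ≤ e * n ^ (lam / (β - 1)))
    (hlog : Real.log n ≤ 1 * n ^ (lam / (β - 1)))
    (hν : 1 - ν ≤ Cg * (Y + n ^ (-(1 / (β - 1))) * Real.log n)) :
    α * Δ ^ lam / Δ + 17 / 3 * Real.pi * α ^ 2 * δ / Δ + 17 / 6 * α * (1 - ν) ≤
      (d ^ (lam - 1) + 17 / 3 * Real.pi * (e / d) + 17 / 6 * Cg) * α *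
        ((1 + α) * n ^ (-((1 - lam) / (β - 1))) + Y) := by
  have h1 : 0 < β - 1 := by linarith
  set X := n ^ (-((1 - lam) / (β - 1))) with hX
  have hX0 : 0 < X := by positivity
  have hA : 0 < n ^ (1 / (β - 1)) := by positivity
  have hΔ0 : 0 < Δ := lt_of_lt_of_le (by positivity) hdΔ
  have hXe : n ^ (-(1 / (β - 1))) * n ^ (lam / (β - 1)) = X := by
    rw [← Real.rpow_add hn, hX]; congr 1; field_simp; ring
  have hXe' : n ^ (lam / (β - 1)) / n ^ (1 / (β - 1)) = X := by
    rw [← hXe, Real.rpow_neg hn.le]; field_simp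
  have t1 : Δ ^ lam / Δ ≤ d ^ (lam - 1) * X := by
    calc Δ ^ lam / Δ = Δ ^ (lam - 1) := by rw [Real.rpow_sub_one hΔ0.ne']
      _ ≤ (d * n ^ (1 / (β - 1))) ^ (lam - 1) :=
        Real.rpow_le_rpow_of_nonpos (by positivity) hdΔ (by linarith)
      _ = _ := by
        rw [Real.mul_rpow hd.le hA.le, ← Real.rpow_mul hn.le, hX]
        congr 2; field_simp; ring
  have t2 : δ / Δ ≤ e / d * X := by
    calc δ / Δ ≤ (e * n ^ (lam / (β - 1))) / (d * n ^ (1 / (β - 1))) := by gcongr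
      _ = _ := by rw [← hXe']; field_simp
  -- The logarithmic term is absorbed by X because log N ≤ N^(λ/(β-1)).
  have t3 : 1 - ν ≤ Cg * (Y + X) := by
    refine hν.trans ?_
    gcongr
    rw [← hXe]
    gcongr
    linarith
  have hπ := Real.pi_pos
  have hd1 : 0 < d ^ (lam - 1) := by positivity
  calc _ = α * (Δ ^ lam / Δ) + 17 / 3 * Real.pi * α ^ 2 * (δ / Δ) + 17 / 6 * α * (1 - ν) := by ring
    _ ≤ α * (d ^ (lam - 1) * X) + 17 / 3 * Real.pi * α ^ 2 * (e / d * X) +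
        17 / 6 * α * (Cg * (Y + X)) := by gcongr
    _ = α * (d ^ (lam - 1) * X + (17 / 3 * Real.pi * (e / d)) * (α * X) +
        17 / 6 * Cg * (Y + X)) := by ring
    _ ≤ α * (d ^ (lam - 1) * ((1 + α) * X + Y) + (17 / 3 * Real.pi * (e / d)) * ((1 + α) * X + Y) +
        17 / 6 * Cg * ((1 + α) * X + Y)) := by
        have hαX : 0 ≤ α * X := by positivity
        refine mul_le_mul_of_nonneg_left (add_le_add (add_le_add ?_ ?_) ?_) hα.le <;>
          exact mul_le_mul_of_nonneg_left (by linarith) (by positivity)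
    _ = _ := by ring

lemma eventually_normal_error_le {Δ : ℕ → ℝ} {β lam d : ℝ} (hβ : 2 < β) (hlam : 0 < lam)
    (hd : 0 < d) (hΔ : ∀ᶠ N : ℕ in atTop, d * (N : ℝ) ^ (1 / (β - 1)) ≤ Δ N) :
    ∀ᶠ N : ℕ in atTop, 32 / Δ N + 34 * Real.exp (-(Δ N ^ lam) / 8) ≤
      (32 / d + 34) * (N : ℝ) ^ (-(1 / (2 * β - 2))) := by
  have h1 : 0 < β - 1 := by linarith
  have hp : 0 < 1 / (β - 1) * lam := by positivity
  filter_upwards [hΔ, eventually_exp_neg_rpow_le (c := d ^ lam / 8) (by positivity) hp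
    (1 / (2 * β - 2)), eventually_ge_atTop 1] with N h2 h3 hN
  have hN1 : (1 : ℝ) ≤ N := by exact_mod_cast hN
  have hN0 : (0 : ℝ) < N := by linarith
  have h4 : d ^ lam * (N : ℝ) ^ (1 / (β - 1) * lam) ≤ Δ N ^ lam := by
    rw [Real.rpow_mul hN0.le, ← Real.mul_rpow hd.le (by positivity)]
    gcongr
  have h5 : Real.exp (-(Δ N ^ lam) / 8) ≤ (N : ℝ) ^ (-(1 / (2 * β - 2))) :=
    (Real.exp_le_exp.2 (by linarith)).trans h3
  have h6 : 32 / Δ N ≤ 32 / d * (N : ℝ) ^ (-(1 / (2 * β - 2))) := by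
    calc 32 / Δ N ≤ 32 / (d * (N : ℝ) ^ (1 / (β - 1))) := by gcongr
      _ = 32 / d * (N : ℝ) ^ (-(1 / (β - 1))) := by rw [Real.rpow_neg hN0.le]; field_simp
      _ ≤ _ := by
        gcongr 32 / d * ?_
        refine Real.rpow_le_rpow_of_exponent_le hN1 (neg_le_neg ?_)
        exact one_div_le_one_div_of_le h1 (by linarith)
  linarith

/-- As κ < 1, a factor N^(a(1-κ)) is left to absorb the logarithm. -/
lemma eventually_rpow_neg_mul_log_le {Δ : ℕ → ℝ} {a d κ ε : ℝ} (ha : 0 < a) (hd : 0 < d)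
    (hκ : 0 < κ) (hκ1 : κ < 1) (hε : 0 < ε) (hΔ0 : ∀ N, 0 < Δ N)
    (hΔ : ∀ᶠ N : ℕ in atTop, Δ N ≤ d * (N : ℝ) ^ a) :
    ∀ᶠ N : ℕ in atTop, (N : ℝ) ^ (-a) * Real.log N ≤ ε * Δ N ^ (-κ) := by
  have hr : 0 < a * (1 - κ) := mul_pos ha (by linarith)
  filter_upwards [hΔ, eventually_log_le (ε := ε * d ^ (-κ)) (by positivity) hr,
    eventually_ge_atTop 1] with N h1 h2 hN
  have hN0 : (0 : ℝ) < N := by exact_mod_cast hN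
  calc (N : ℝ) ^ (-a) * Real.log N ≤ (N : ℝ) ^ (-a) * (ε * d ^ (-κ) * (N : ℝ) ^ (a * (1 - κ))) := by
        gcongr
    _ = ε * (d ^ (-κ) * ((N : ℝ) ^ (-a) * (N : ℝ) ^ (a * (1 - κ)))) := by ring
    _ = ε * (d * (N : ℝ) ^ a) ^ (-κ) := by
        rw [← Real.rpow_add hN0, Real.mul_rpow hd.le (by positivity), ← Real.rpow_mul hN0.le]
        congr 3; ring
    _ ≤ _ := by
        gcongr ε * ?_
        exact Real.rpow_le_rpow_of_nonpos (hΔ0 N) h1 (by linarith)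

/-- The influence of the hubs on the low degree nodes is of lower order than `Δ ^ (-κ / 2)`. -/
lemma eventually_feedback_le {α δ Δ : ℕ → ℝ} {a lam d₁ d₂ e κ ε : ℝ} (ha : 0 < a)
    (hd₁ : 0 < d₁) (hd₂ : 0 < d₂) (he : 0 < e) (hκ : 0 < κ) (hκl : κ < 1 - lam) (hε : 0 < ε)
    (hα0 : ∀ N, 0 < α N) (hδ0 : ∀ N, 0 < δ N) (hΔ0 : ∀ N, 0 < Δ N)
    (hα : ∀ ε > 0, ∀ᶠ N : ℕ in atTop, α N ≤ ε * (N : ℝ) ^ (a * (1 - lam) / 2))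
    (hΔ₁ : ∀ᶠ N : ℕ in atTop, d₁ * (N : ℝ) ^ a ≤ Δ N)
    (hΔ₂ : ∀ᶠ N : ℕ in atTop, Δ N ≤ d₂ * (N : ℝ) ^ a)
    (hδ : ∀ᶠ N : ℕ in atTop, δ N ≤ e * (N : ℝ) ^ (a * lam)) :
    ∀ᶠ N : ℕ in atTop, α N * δ N / Δ N ≤ ε ∧ (α N * δ N / Δ N) ^ 2 ≤ ε * Δ N ^ (-κ) := by
  have hd₂κ : 0 < d₂ ^ (-κ) := by positivity
  -- Then αδ/Δ is at most the minimum times N^(-a(1-λ)/2). The first entry serves the linear bound;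
  -- the second is squared, giving N^(-a(1-λ)) ≤ N^(-aκ).
  set η := min ε (√(ε * d₂ ^ (-κ))) * (d₁ / e) with hη
  have hη0 : 0 < η := by positivity
  filter_upwards [hα η hη0, hΔ₁, hΔ₂, hδ, eventually_ge_atTop 1] with N h1 h2 h3 h4 hN
  have hN1 : (1 : ℝ) ≤ N := by exact_mod_cast hN
  have hN0 : (0 : ℝ) < N := by linarith
  have hα' := hα0 N
  have hδ' := hδ0 N
  have hΔ' := hΔ0 N
  set Z := (N : ℝ) ^ (-(a * (1 - lam) / 2)) with hZ
  have hZ0 : 0 < Z := by positivity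
  have h5 : α N * δ N / Δ N ≤ min ε (√(ε * d₂ ^ (-κ))) * Z := by
    calc α N * δ N / Δ N ≤ (η * (N : ℝ) ^ (a * (1 - lam) / 2)) * (e * (N : ℝ) ^ (a * lam)) /
          (d₁ * (N : ℝ) ^ a) := by gcongr
      _ = η * (e / d₁) * ((N : ℝ) ^ (a * (1 - lam) / 2) * (N : ℝ) ^ (a * lam) *
          (N : ℝ) ^ (-a)) := by
          rw [Real.rpow_neg hN0.le]; field_simp
      _ = min ε (√(ε * d₂ ^ (-κ))) * Z := by
          rw [← Real.rpow_add hN0, ← Real.rpow_add hN0, hη, hZ]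
          congr 1
          · field_simp
          · congr 1; ring
  have hp : 0 < a * (1 - lam) / 2 := by
    have : 0 < 1 - lam := by linarith
    positivity
  have hZ1 : Z ≤ 1 := Real.rpow_le_one_of_one_le_of_nonpos hN1 (by linarith)
  have hmin0 : 0 ≤ min ε (√(ε * d₂ ^ (-κ))) := by positivity
  constructor
  · calc _ ≤ ε * 1 := h5.trans (by gcongr; exact min_le_left _ _)
      _ = ε := mul_one _
  · calc (α N * δ N / Δ N) ^ 2 ≤ (√(ε * d₂ ^ (-κ)) * Z) ^ 2 := by
          have : 0 ≤ α N * δ N / Δ N := by positivity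
          refine pow_le_pow_left₀ this (h5.trans ?_) 2
          gcongr
          exact min_le_right _ _
      _ = ε * d₂ ^ (-κ) * (N : ℝ) ^ (-(a * (1 - lam))) := by
          rw [mul_pow, Real.sq_sqrt (by positivity), hZ, ← Real.rpow_natCast, ← Real.rpow_mul hN0.le]
          congr 2; push_cast; ring
      _ ≤ ε * d₂ ^ (-κ) * (N : ℝ) ^ (a * (-κ)) := by
          gcongr ε * d₂ ^ (-κ) * ?_
          exact Real.rpow_le_rpow_of_exponent_le hN1 (by nlinarith)
      _ = ε * (d₂ * (N : ℝ) ^ a) ^ (-κ) := by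
          rw [Real.mul_rpow hd₂.le (by positivity), ← Real.rpow_mul hN0.le]; ring
      _ ≤ _ := by
          gcongr ε * ?_
          exact Real.rpow_le_rpow_of_nonpos hΔ' h3 (by linarith)

lemma eventually_eight_mul_le_exp {Δ : ℕ → ℝ} {a d r : ℝ} (ha : 0 < a) (hd : 0 < d) (hr : 0 < r)
    (hΔ : ∀ᶠ N : ℕ in atTop, d * (N : ℝ) ^ a ≤ Δ N) :
    ∀ᶠ N : ℕ in atTop, 8 * (N : ℝ) ≤ Real.exp (Δ N ^ r) := by
  filter_upwards [hΔ, eventually_exp_neg_rpow_le (c := d ^ r) (by positivity) (mul_pos ha hr) 2,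
    eventually_ge_atTop 8] with N h1 h2 hN
  have hN8 : (8 : ℝ) ≤ N := by exact_mod_cast hN
  have hN0 : (0 : ℝ) < N := by linarith
  have h4 : d ^ r * (N : ℝ) ^ (a * r) ≤ Δ N ^ r := by
    rw [Real.rpow_mul hN0.le, ← Real.mul_rpow hd.le (by positivity)]
    gcongr
  rw [Real.exp_neg, Real.rpow_neg hN0.le, inv_le_inv₀ (Real.exp_pos _) (by positivity)] at h2
  norm_cast at h2
  push_cast at h2
  calc 8 * (N : ℝ) ≤ (N : ℝ) ^ 2 := by nlinarith
    _ ≤ _ := h2.trans (Real.exp_le_exp.2 h4)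

end Asymptotic

end HubDynamics
end

/-! ### Assembly of the theorem -/

open HubDynamics in
theorem theoremC
    (β cHub lam : ℝ) (hβ : 2 < β) (hcHub : cHub ∈ Set.Ioo (0 : ℝ) 1) (hlam : lam ∈ Set.Ioo (0 : ℝ) 1)
    -- the parameters `m, w, δ, α` as functions of the number `N` of nodes
    (m w δ α : ℕ → ℝ)
    (hm0 : ∀ N, 0 < m N) (hw0 : ∀ N, 0 < w N) (hδ0 : ∀ N, 0 < δ N) (hα0 : ∀ N, 0 < α N)
    (hm : m =Θ[atTop] fun N : ℕ => (N : ℝ) ^ (1 / (β - 1)))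
    (hw : w =o[atTop] fun N : ℕ => (N : ℝ) ^ (lam / (β - 1)))
    -- the hub scale is `Δ = cHub * m`
    (Δ : ℕ → ℝ) (hΔ : ∀ N, Δ N = cHub * m N)
    (hδ : δ =Θ[atTop] fun N : ℕ => Δ N ^ lam)
    (hα : α =o[atTop] fun N : ℕ =>
      min ((N : ℝ) ^ (lam * ((β - 2) / (β - 1)))) ((N : ℝ) ^ ((1 - lam) / (2 * β - 2)))) :
    ∃ C : ℝ, 0 < C ∧ ∃ N₀ : ℕ, ∃ good : ∀ N : ℕ, Set (SimpleGraph (Fin N)),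
      -- the Chung–Lu network is good with probability `1 - O(N^{-1/5})`
      (∀ N ≥ N₀, 1 - C * (N : ℝ) ^ (-(1 / 5) : ℝ) ≤
        (chungLu β (w N) (m N) N).real {c | graphOf c ∈ good N}) ∧
      (∀ N ≥ N₀, ∀ G ∈ good N,
        -- hubs follow the reduced map at effective coupling `α_i`, up to the fluctuation `ξ_i^t`
        (∀ i ∈ hubs G (Δ N), ∀ (ω : Noise N) (x : Fin N → UnitAddCircle) (t : ℕ),
          traj G (α N) ω x (t + 1) i =
            reducedMap (effCoupling G (δ N) (α N) i) (ω (t, i)) (traj G (α N) ω x t i) +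
              ((fluct G (δ N) (α N) ω x i t : ℝ) : UnitAddCircle)) ∧
        1 - starIndex G (Δ N) (δ N) ≤
          C * ((N : ℝ) ^ (-(lam * ((β - 2) / (β - 1)))) * w N ^ (β - 2) +
            (N : ℝ) ^ (-(1 / (β - 1))) * Real.log N) ∧
        -- (i)
        (∀ ε : ℝ,
          17 / 2 * α N * (1 - starIndex G (Δ N) (δ N)) ≤ ε →
          34 * Real.pi * α N ^ 2 * δ N / Δ N ≤ ε →
          C * α N * √(Real.log ((hubs G (Δ N)).card + 1) / Δ N) ≤ ε →
          ∀ᵐ p ∂(dynProb N),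
            1 - Real.exp (-(starIndex G (Δ N) (δ N) * Δ N * ε ^ 2 / (19 * α N ^ 2))) ≤
              liminf (fun T : ℕ => (1 / (T : ℝ)) * ∑ t ∈ Finset.range T,
                Set.indicator {s : ℕ | ∀ i ∈ hubs G (Δ N), |fluct G (δ N) (α N) p.1 p.2 i s| ≤ ε}
                  (fun _ => (1 : ℝ)) t) atTop) ∧
        -- (iii)
        (∀ i ∈ hubs G (Δ N), ∀ (t : ℕ) (s : ℝ),
          let F : ℝ → ℝ := fun u => cdf (gaussianReal 0
            (effCoupling G (δ N) (α N) i ^ 2 /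
              (2 * (nodeIndex G (δ N) i * (deg G i : ℝ)))).toNNReal) u
          let s₁ : ℝ := C * α N * ((1 + α N) * (N : ℝ) ^ (-((1 - lam) / (β - 1))) +
            (N : ℝ) ^ (-(lam * ((β - 2) / (β - 1)))) * w N ^ (β - 2))
          let s₂ : ℝ := C * (N : ℝ) ^ (-(1 / (2 * β - 2)))
          (dynProb N).real {p | fluct G (δ N) (α N) p.1 p.2 i t ≤ s} ∈
            Set.Icc (F (s - s₁) - s₂) (F (s + s₁) + s₂))) ∧
      -- (ii)
      (∀ κ : ℝ, 0 < κ → κ < min (1 / 2) (min (1 - lam) (lam * ((β - 2) / (β - 1)))) →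
        ((fun N : ℕ => (N : ℝ) ^ (-(lam * ((β - 2) / (β - 1)))) * w N ^ (β - 2))
          =o[atTop] fun N : ℕ => Δ N ^ (-κ)) →
        ((fun N : ℕ => α N * w N / Δ N) =o[atTop] fun N : ℕ => Δ N ^ (-κ)) →
        ∃ N₁ : ℕ, ∀ N ≥ N₁, ∀ G ∈ good N, ∀ t₀ T : ℕ,
          T ≤ ⌈Real.exp (Δ N ^ (1 - 2 * κ))⌉₊ →
          1 - Real.exp (-(Δ N ^ (1 - 2 * κ))) ≤
            (dynProb N).real {p | ∀ i ∈ hubs G (Δ N), ∀ t : ℕ, t₀ ≤ t → t < t₀ + T →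
              |fluct G (δ N) (α N) p.1 p.2 i t| ≤ 3 * α N * Δ N ^ (-κ)}) := by
  have h1 : 0 < β - 1 := by linarith
  have h2 : 0 < β - 2 := by linarith
  have hl0 := hlam.1
  have hl1 := hlam.2
  have ha : 0 < 1 / (β - 1) := by positivity
  have hΔ0 : ∀ N, 0 < Δ N := fun N => by rw [hΔ]; exact mul_pos hcHub.1 (hm0 N)
  have hΔm : Δ = fun N => cHub * m N := funext hΔ
  have hΔΘ : Δ =Θ[atTop] fun N : ℕ => (N : ℝ) ^ (1 / (β - 1)) := by
    rw [hΔm]; exact hm.const_mul_left hcHub.1.ne'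
  have hδΘ : δ =Θ[atTop] fun N : ℕ => (N : ℝ) ^ (lam / (β - 1)) := by
    have h := hδ.trans (hΔΘ.rpow (r := lam) (Eventually.of_forall fun N => (hΔ0 N).le)
      (Eventually.of_forall fun N => by positivity))
    refine h.trans_eventuallyEq (Eventually.of_forall fun N => ?_)
    simp only
    rw [← Real.rpow_mul (Nat.cast_nonneg N), one_div_mul_eq_div]
  obtain ⟨d₁, hd₁, d₂, hd₂, hdΔ⟩ := exists_bounds_of_isTheta hΔΘ (fun N => (hΔ0 N).le)
    fun N => by positivity
  obtain ⟨e₁, he₁, e₂, he₂, heδ⟩ := exists_bounds_of_isTheta hδΘ (fun N => (hδ0 N).le)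
    fun N => by positivity
  have hdΔ₁ := hdΔ.mono fun N h => h.1
  have hdΔ₂ := hdΔ.mono fun N h => h.2
  have heδ₁ := heδ.mono fun N h => h.1
  have heδ₂ := heδ.mono fun N h => h.2
  have hK : 0 ≤ largeConst β := by rw [largeConst]; positivity
  obtain ⟨Cg, hCg⟩ : ∃ Cg, Cg = 2 * largeConst β / cHub * (4 / e₁) ^ (β - 2) + 4 / d₁ := ⟨_, rfl⟩
  have hCg0 : 0 < Cg := by
    have := hcHub.1
    rw [hCg]; positivity
  obtain ⟨Cs, hCs⟩ : ∃ Cs, Cs = d₁ ^ (lam - 1) + 17 / 3 * Real.pi * (e₂ / d₁) + 17 / 6 * Cg :=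
    ⟨_, rfl⟩
  have hCs0 : 0 < Cs := by rw [hCs]; positivity
  obtain ⟨Cn, hCn⟩ : ∃ Cn, Cn = 32 / d₁ + 34 := ⟨_, rfl⟩
  have hCn0 : 0 < Cn := by rw [hCn]; positivity
  have hwm : ∀ᶠ N in atTop, w N ≤ m N := by
    have hmain := eventually_le_of_isLittleO hw (fun N => by positivity)
      (div_pos hd₁ hcHub.1)
    filter_upwards [hmain, hdΔ₁, eventually_ge_atTop 1] with N h3 h4 hN
    have hN1 : (1 : ℝ) ≤ N := by exact_mod_cast hN
    have hexp : (N : ℝ) ^ (lam / (β - 1)) ≤ (N : ℝ) ^ (1 / (β - 1)) := by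
      refine Real.rpow_le_rpow_of_exponent_le hN1 ?_
      gcongr
    have hc := hcHub.1
    rw [hΔ] at h4
    calc w N ≤ d₁ / cHub * (N : ℝ) ^ (lam / (β - 1)) := h3
      _ ≤ d₁ / cHub * (N : ℝ) ^ (1 / (β - 1)) := by gcongr
      _ = d₁ * (N : ℝ) ^ (1 / (β - 1)) / cHub := by ring
      _ ≤ m N := by rw [div_le_iff₀ hc]; linarith
  have hlog1 : ∀ᶠ N : ℕ in atTop, 1 ≤ Real.log N :=
    (Real.tendsto_log_atTop.comp tendsto_natCast_atTop_atTop).eventually_ge_atTop 1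
  have hΔ1 : ∀ᶠ N in atTop, 1 ≤ Δ N := by
    have h := ((tendsto_rpow_atTop ha).comp (tendsto_natCast_atTop_atTop (R := ℝ))).const_mul_atTop
      hd₁
    filter_upwards [h.eventually_ge_atTop 1, hdΔ₁] with N h3 h4
    exact h3.trans h4
  have hlp : 0 < lam / (β - 1) := by positivity
  have hall := hwm.and <| hlog1.and <| hΔ1.and <| hdΔ.and <| heδ.and <|
    (eventually_fail_prob_le he₁ hlp heδ₁).and <|
    (eventually_high_fraction_le_half hβ hCg0 hw0 hw).and <|
    (eventually_log_le one_pos hlp).and <|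
    (eventually_normal_error_le hβ hl0 hd₁ hdΔ₁).and (eventually_ge_atTop 1)
  obtain ⟨N₀, hN₀⟩ := eventually_atTop.1 hall
  -- The summands serve the star index, the threshold in (i), s₁ and s₂ in turn; 6 also covers the 2
  -- of the failure probability. Goodness does not depend on κ, so one family of graphs serves every
  -- κ in (ii).
  refine ⟨Cg + 6 + Cs + Cn, by positivity, N₀, fun N => {G | 1 - starIndex G (Δ N) (δ N) ≤
    Cg * ((N : ℝ) ^ (-(lam * ((β - 2) / (β - 1)))) * w N ^ (β - 2) +
      (N : ℝ) ^ (-(1 / (β - 1))) * Real.log N)}, ?_, ?_, ?_⟩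
  · intro N hN
    obtain ⟨hwmN, hlogN, -, hdN, heN, hprob, -, -, -, hN1⟩ := hN₀ N hN
    have hN0 : (0 : ℝ) < N := by exact_mod_cast hN1
    have hstar := chungLu_starIndex (N := N) hβ (hw0 N) (hm0 N) hwmN (hδ0 N) (hΔ0 N) hN1
    have hbound := starIndex_bound_le (lam := lam) hβ (hw0 N) (hm0 N) hlogN hN0 hcHub.1 hd₁ he₁ hK
      (hΔ N) hdN.1 heN.1
    rw [← hCg] at hbound
    have hX : 0 ≤ (N : ℝ) ^ (-(1 / 5) : ℝ) := by positivity
    calc 1 - (Cg + 6 + Cs + Cn) * (N : ℝ) ^ (-(1 / 5) : ℝ) ≤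
        1 - (N * Real.exp (-(δ N / 2)) + 1 / N) := by nlinarith
      _ ≤ _ := hstar
      _ ≤ _ := measureReal_mono fun c hc => le_trans hc hbound
  · intro N hN G hG
    obtain ⟨-, hlogN, hΔN, hdN, heN, -, hhalf, hlogN', herr, hN1⟩ := hN₀ N hN
    have hN0 : (0 : ℝ) < N := by exact_mod_cast hN1
    have hwN := hw0 N
    have hαN := hα0 N
    have hY : 0 ≤ (N : ℝ) ^ (-(lam * ((β - 2) / (β - 1)))) * w N ^ (β - 2) := by positivity
    refine ⟨fun i _ ω x t => traj_succ_eq_reducedMap G (δ N) (α N) ω x i t, ?_, ?_, ?_⟩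
    · refine le_trans hG ?_
      gcongr
      linarith
    · intro ε hε1 hε2 hε3
      exact ae_le_liminf_frequency G hαN (hδ0 N) (hΔ0 N) (by linarith) hε1 hε2 hε3
    · intro i hi t s
      have hdeg : Δ N < deg G i := by simpa [hubs] using hi
      have hcard : Δ N / 2 ≤ (lowNbrs G (δ N) i).card := by
        rw [← nodeIndex_mul_deg]
        have h3 := starIndex_le_nodeIndex G (δ := δ N) hi
        have h4 : 1 - starIndex G (Δ N) (δ N) ≤ 1 / 2 := le_trans hG hhalf
        nlinarith [hΔ0 N]
      have hcard0 : (0 : ℝ) < (lowNbrs G (δ N) i).card := lt_of_lt_of_le (half_pos (hΔ0 N)) hcard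
      have hJ : (lowNbrs G (δ N) i).Nonempty := Finset.card_pos.1 (by exact_mod_cast hcard0)
      have hscale := smoothing_scale_le hβ hl0 hl1 hαN hN0 hd₁ hCg0 hY he₂ hdN.1 heN.2
        hlogN' hG
      rw [← hCs] at hscale
      have hs₁ := hscale.trans (b := Cs * α N * ((1 + α N) * (N : ℝ) ^ (-((1 - lam) / (β - 1))) +
          (N : ℝ) ^ (-(lam * ((β - 2) / (β - 1)))) * w N ^ (β - 2)))
        (c := (Cg + 6 + Cs + Cn) * α N * ((1 + α N) * (N : ℝ) ^ (-((1 - lam) / (β - 1))) +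
          (N : ℝ) ^ (-(lam * ((β - 2) / (β - 1)))) * w N ^ (β - 2))) (by gcongr; linarith)
      -- The smoothing parameter is h = Δ^λ. The shift αh/Δ is then of order αN^(-(1-λ)/(β-1)),
      -- within s₁, and e^(-h/8) decays faster than any power of N.
      have hmain := fluct_normal_approximation G hαN (hδ0 N) (hΔ0 N)
        (Real.one_le_rpow hΔN hl0.le) hi hJ hs₁ t s
      have herr' : 16 / ((lowNbrs G (δ N) i).card : ℝ) + 34 * Real.exp (-(Δ N ^ lam) / 8) ≤
          (Cg + 6 + Cs + Cn) * (N : ℝ) ^ (-(1 / (2 * β - 2))) := by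
        have h3 : 16 / ((lowNbrs G (δ N) i).card : ℝ) ≤ 32 / Δ N := by
          rw [div_le_div_iff₀ hcard0 (hΔ0 N)]
          linarith
        have h4 : Cn * (N : ℝ) ^ (-(1 / (2 * β - 2))) ≤
            (Cg + 6 + Cs + Cn) * (N : ℝ) ^ (-(1 / (2 * β - 2))) := by
          gcongr
          linarith
        rw [← hCn] at herr
        linarith
      simp only [cdf_eq_real]
      exact ⟨by linarith [hmain.1], by linarith [hmain.2]⟩
  · intro κ hκ0 hκ hκ1 _
    obtain ⟨hκa, hκb⟩ := lt_min_iff.1 hκ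
    have hκb := (lt_min_iff.1 hκb).1
    have hπ := Real.pi_pos
    have hα' : ∀ ε > 0, ∀ᶠ N : ℕ in atTop,
        α N ≤ ε * (N : ℝ) ^ (1 / (β - 1) * (1 - lam) / 2) := by
      intro ε hε
      filter_upwards [eventually_le_of_isLittleO hα (fun N => by positivity) hε] with N h3
      refine h3.trans ?_
      gcongr
      refine (min_le_right _ _).trans_eq ?_
      congr 1
      field_simp
    have hδ₂ : ∀ᶠ N : ℕ in atTop, δ N ≤ e₂ * (N : ℝ) ^ (1 / (β - 1) * lam) := by
      filter_upwards [heδ₂] with N h3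
      rwa [one_div_mul_eq_div]
    -- The value makes 6π²(17/6)²ε ≤ 1/8 and 2π(17/6)ε ≤ 1/20. Below, two terms with 1/(48 Cg) bound
    -- 1-ν by Δ^(-κ)/24, and 17/6 of this is at most Δ^(-κ)/8.
    have hfeed := eventually_feedback_le (ε := 1 / (400 * Real.pi ^ 2)) ha hd₁ hd₂ he₂ hκ0 hκb
      (by positivity) hα0 hδ0 hΔ0 hα' hdΔ₁ hdΔ₂ hδ₂
    have hlogκ := eventually_rpow_neg_mul_log_le (ε := 1 / (48 * Cg)) ha hd₂ hκ0 (by linarith)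
      (by positivity) hΔ0 hdΔ₂
    have hwκ := eventually_le_of_isLittleO hκ1 (fun N => (Real.rpow_pos_of_pos (hΔ0 N) _).le)
      (ε := 1 / (48 * Cg)) (by positivity)
    have hexp := eventually_eight_mul_le_exp (r := 1 - 2 * κ) ha hd₁ (by linarith) hdΔ₁
    obtain ⟨N₁, hN₁⟩ := eventually_atTop.1 (hfeed.and (hlogκ.and (hwκ.and hexp)))
    refine ⟨N₁, fun N hN G hG t₀ T hT => ?_⟩
    obtain ⟨⟨hf1, hf2⟩, hl, hwN, hexpN⟩ := hN₁ N hN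
    have hΔκ : 0 < Δ N ^ (-κ) := Real.rpow_pos_of_pos (hΔ0 N) _
    refine dynProb_window_ge G (hα0 N) (hδ0 N) (hΔ0 N) ?_ ?_ ?_ hexpN t₀ T hT
    · have hπ3 := Real.pi_gt_three
      calc 2 * Real.pi * (17 / 6 * (α N * δ N / Δ N)) ≤
          2 * Real.pi * (17 / 6 * (1 / (400 * Real.pi ^ 2))) := by gcongr
        _ = 17 / (1200 * Real.pi) := by field_simp; norm_num
        _ ≤ 1 / 20 := by rw [div_le_div_iff₀ (by positivity) (by norm_num)]; linarith
    · calc 6 * Real.pi ^ 2 * (17 / 6 * (α N * δ N / Δ N)) ^ 2 =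
          6 * Real.pi ^ 2 * (17 / 6) ^ 2 * (α N * δ N / Δ N) ^ 2 := by ring
        _ ≤ 6 * Real.pi ^ 2 * (17 / 6) ^ 2 * (1 / (400 * Real.pi ^ 2) * Δ N ^ (-κ)) := by gcongr
        _ = 6 * (17 / 6) ^ 2 / 400 * Δ N ^ (-κ) := by field_simp
        _ ≤ Δ N ^ (-κ) / 8 := by linarith
    · have hGN : 1 - starIndex G (Δ N) (δ N) ≤ Cg * (1 / (48 * Cg) * Δ N ^ (-κ) +
          1 / (48 * Cg) * Δ N ^ (-κ)) := by
        refine le_trans hG ?_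
        gcongr
      have hval : Cg * (1 / (48 * Cg) * Δ N ^ (-κ) + 1 / (48 * Cg) * Δ N ^ (-κ)) =
          Δ N ^ (-κ) / 24 := by field_simp; norm_num
      rw [hval] at hGN
      linarith
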